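/- (All curves below are given by equations over $\mathbb{Q}(t)$ for a parameter $t$, hence have specialisations over every field $K$ in which the formulas make sense. "Admissible" values of the parameter are those for which the denominators and the discriminant do not vanish.) **Tate's normal form.** Let $K$ be a field, $E/K$ an elliptic curve and $P\in E(K)$ with $P,2P,3P\ne 0$. Then there are unique $a,b\in K$, $b\neq 0$, and a unique isomorphism from $E$ to $$E(a,b):\quad y^2+axy+by=x^3+bx^2$$ that sends $P$ to $(0,0)$. **Explicit models.** Put * $E_1(4)$: $E(1,t)$; * $E_1(6)$: $E(a,\,-(a-1)(a-2))$, with parameter $a$; * $E_1(8)$: $E\bigl(\tfrac{-2k^2+4k-1}{k},\,-2k^2+3k-1\bigr)$, with parameter $k$; * $E_1(7)$: $E(1+t-t^2,\,t^2-t^3)$; * $E(6,2)$: the pull-back of $E_1(6)$ by $a=\frac{2\xi^2-10}{\xi^2-9}$, with parameter $\xi$; * $E(4)$: $y^2=x(x-1)(x-\lambda)$ with $\lambda=\frac14(\sigma+\sigma^{-1})^2$, with parameter $\sigma$; * $E(8,2)$: $y^2=x\bigl(x^2+(2+\tfrac12(\sigma+\sigma^{-1})^2)x+\tfrac1{16}(\sigma-\sigma^{-1})^4\bigr)$,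 with parameter $\sigma$; * $E(8;4,1,2)$: $y^2=x\bigl(x^2-2(8k^4-16k^3+16k^2-8k+1)x+(8k^2-8k+1)(2k-1)^4\bigr)$, with parameter $k$. These are models over $\mathbb{Q}$ of the elliptic modular surfaces attached to $\Gamma_1(4)$, $\Gamma_1(6)$, $\Gamma_1(8)$, $\Gamma_1(7)$, $\Gamma_1(6)\cap\Gamma(2)$, $\Gamma(4)$, $\Gamma_1(4)\cap\Gamma_0(8)\cap\Gamma(2)$ and $\left\{\begin{pmatrix}1+4a&2b\\4c&1+4d\end{pmatrix}\in \mathrm{SL}_2(\mathbb{Z}): a\equiv c \bmod 2\right\}$ respectively, in the following sense: over the admissible values of the parameter each is the universal elliptic curve for the corresponding level structure. That is, for every field $K$ with $N\neq 0$ in $K$ for $E_1(N)$, and for every field $K$ of characteristic $0$ in the other cases, the fibres at admissible parameters in $K$ are elliptic curves carrying the level structure, and every elliptic curve over $K$ with such a level structure is isomorphic, together with it, to exactly one of these fibres, by a unique isomorphism. The level structures are: * for $E_1(N)$: a point $P\in E(K)$ of exact order $N$, which in the model is $(0,0)$; * for $E(6,2)$: points $P,Q\in E(K)$ of orders $6$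 and $2$ with $Q\ne 3P$; in the model $P=(0,0)$ and $Q=\bigl(\frac{4(\xi-1)}{(\xi-3)^2(\xi+3)},\frac{-8(\xi-1)^2}{(\xi-3)^3(\xi+3)^2}\bigr)$; * for $E(4)$: a point $P\in E(K)$ of order $4$ and a $K$-rational pair $\{\pm Q\}$ of geometric points of order $4$ with $2P\neq2Q$; in the model $P=\bigl(\frac{\sigma^2+1}2,\frac{\sigma^4-1}{4\sigma}\bigr)$ and $x(Q)=\frac{\sigma+\sigma^{-1}}2$; * for $E(8,2)$: a $K$-rational pair $\{U,5U\}$ of geometric points of order $8$ and a point $Q\in E(K)$ of order $2$ with $Q\ne 4U$; in the model $Q=\bigl(-\frac{(\sigma-1)^4}{4\sigma^2},0\bigr)$, and $\{U,5U\}$ is the preimage of the point $P$ of $E(4)$ under the isogeny $(u,v)\mapsto\bigl(\frac{v^2}{4u^2},\frac{v(b'-u^2)}{8u^2}\bigr)$ from $E(8,2)$ to $E(4)$, where $b'=\tfrac1{16}(\sigma-\sigma^{-1})^4$; * for $E(8;4,1,2)$: a point $D\in E(K)$ of order $2$ and a $K$-rational pair $\{U,U+D\}$ of geometric points of order $8$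 with $D\neq4U$; in the model $D=(0,0)$, and $\{U,U+D\}$ is the preimage of the point $(4k^3(1-k),-4k^3(2k-1)(k-1))$, which corresponds to $(0,0)$ on $E_1(8)$, under the isogeny $(u,v)\mapsto\bigl(\frac{v^2}{4u^2},\frac{v(b'-u^2)}{8u^2}\bigr)$, with $b'=(8k^2-8k+1)(2k-1)^4$, from $E(8;4,1,2)$ to $Y^2=X\bigl(X^2+(8k^4-16k^3+16k^2-8k+1)X+(2k(k-1))^4\bigr)\cong E_1(8)$. **Quotients.** Over fields of characteristic $0$ and for admissible parameters, $E(8,2)$ is the quotient of $E(4)$ by the subgroup generated by the $2$-torsion section $(0,0)$, and $E(8;4,1,2)$ is the quotient of $E_1(8)$ by the subgroup generated by the $2$-torsion section $4\cdot(0,0)$. **Singular fibres.** Over an algebraically closed field of characteristic $0$, the singular fibres of the relatively minimal elliptic surfaces over $\mathbb{P}^1$ with these generic fibres have exactly the following Kodaira types: * $E_1(4)$: $I_1^*, I_4, I_1$; * $E_1(6)$: $I_6,I_3,I_2,I_1$; * $E_1(8)$: $I_8,I_8,I_4,I_2,I_1,I_1$; * $E_1(7)$: $I_7,I_7,I_7,I_1,I_1,I_1$;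 * $E(6,2)$: $I_6,I_6,I_6,I_2,I_2,I_2$; * $E(8,2)$: $I_8,I_8,I_2,I_2,I_2,I_2$; * $E(8;4,1,2)$: $I_8,I_4,I_4,I_4,I_2,I_2$. -/

import Mathlib

open scoped WeierstrassCurve

noncomputable section

namespace TateModular

/-! ## The explicit Weierstrass equations

All curves are given by formulas that make sense over any field: with a field element as argument
they are fibres of the family, with `RatFunc.X` as argument they are its generic fibre. -/

section Equations

variable {K : Type*} [Field K]

/-- Tate's normal form `y² + a x y + b y = x³ + b x²`. -/
def tate (a b : K) : WeierstrassCurve K := ⟨a, b, b, 0, 0⟩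

/-- `E₁(4)`: `y² + xy + ty = x³ + t x²`. -/
def E14 (t : K) : WeierstrassCurve K := tate 1 t

/-- `E₁(6)`: `y² + axy - (a-1)(a-2)y = x³ - (a-1)(a-2)x²`. -/
def E16 (a : K) : WeierstrassCurve K := tate a (-((a - 1) * (a - 2)))

/-- `E₁(8)`; the equation makes sense for `k ≠ 0`. -/
def E18 (k : K) : WeierstrassCurve K :=
  tate ((-2 * k ^ 2 + 4 * k - 1) / k) (-2 * k ^ 2 + 3 * k - 1)

/-- `E₁(7)`: `y² + (1+t-t²)xy + (t²-t³)y = x³ + (t²-t³)x²`. -/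
def E17 (t : K) : WeierstrassCurve K := tate (1 + t - t ^ 2) (t ^ 2 - t ^ 3)

/-- `E(6,2)`: the pull-back of `E₁(6)` under `a = (2ξ²-10)/(ξ²-9)`, where `ξ² ≠ 9`. -/
def E62 (ξ : K) : WeierstrassCurve K := E16 ((2 * ξ ^ 2 - 10) / (ξ ^ 2 - 9))

/-- The curve `y² = x (x² + a x + b)`. -/
def twoTorsionForm (a b : K) : WeierstrassCurve K := ⟨0, a, 0, b, 0⟩

/-- `λ = (σ + σ⁻¹)² / 4`. -/
def lam (σ : K) : K := (σ + σ⁻¹) ^ 2 / 4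

/-- `E(4)` in Legendre form: `y² = x (x - 1) (x - λ) = x (x² - (1 + λ) x + λ)`, where `σ ≠ 0`. -/
def E4 (σ : K) : WeierstrassCurve K := twoTorsionForm (-(1 + lam σ)) (lam σ)

/-- `E(8,2)`: `y² = x (x² + (2 + (σ + σ⁻¹)²/2) x + (σ - σ⁻¹)⁴/16)`, where `σ ≠ 0`. -/
def E82 (σ : K) : WeierstrassCurve K :=
  twoTorsionForm (2 + (σ + σ⁻¹) ^ 2 / 2) ((σ - σ⁻¹) ^ 4 / 16)

/-- `E(8;4,1,2)`:
`y² = x (x² - 2 (8k⁴ - 16k³ + 16k² - 8k + 1) x + (8k² - 8k + 1) (2k - 1)⁴)`. -/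
def E8412 (k : K) : WeierstrassCurve K :=
  twoTorsionForm (-2 * (8 * k ^ 4 - 16 * k ^ 3 + 16 * k ^ 2 - 8 * k + 1))
    ((8 * k ^ 2 - 8 * k + 1) * (2 * k - 1) ^ 4)

end Equations

/-! ## Elliptic curves with level structure -/

section Moduli

open WeierstrassCurve

/-- The change of variables `C : W ≅ C • W`, `(x, y) ↦ (x', y')` with `x = u² x' + r`,
`y = u³ y' + u² s x' + t`, carries the point `P` of `W` to the affine point `(x', y')`. -/
def Carries {L : Type*} [Field L] (C : VariableChange L) {W : WeierstrassCurve L}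
    (P : W.toAffine.Point) (x' y' : L) : Prop :=
  ∃ h, P = .some ((C.u : L) ^ 2 * x' + C.r)
    ((C.u : L) ^ 3 * y' + (C.u : L) ^ 2 * C.s * x' + C.t) h

open scoped Classical in
/-- Every elliptic curve over `K` with a `K`-point `P` such that `P, 2P, 3P ≠ 0` can be put, in a
unique way, in Tate's normal form with `P` at the origin. -/
def HasTateNormalForms (K : Type*) [Field K] : Prop :=
  ∀ (W : WeierstrassCurve K), W.IsElliptic → ∀ P : W.toAffine.Point,
    P ≠ 0 → 2 • P ≠ 0 → 3 • P ≠ 0 →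
    ∃! q : K × K × VariableChange K,
      q.2.1 ≠ 0 ∧ q.2.2 • W = tate q.1 q.2.1 ∧ Carries q.2.2 P 0 0

open scoped Classical in
/-- Over `K`, the curves `E t` (`t ∈ U`) with the point `(0, 0)` form the universal elliptic curve
with a point of exact order `N`: they are elliptic curves with such a point, and every elliptic
curve over `K` with such a point is isomorphic to exactly one of them, by a unique isomorphism. -/
def IsUniversalGamma1 (N : ℕ) {K : Type*} [Field K] (E : K → WeierstrassCurve K) (U : Set K) :
    Prop :=
  (∀ t ∈ U, (E t).IsElliptic ∧
    ∃ h, addOrderOf (Affine.Point.some 0 0 h : (E t).toAffine.Point) = N) ∧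
  ∀ (W : WeierstrassCurve K), W.IsElliptic → ∀ P : W.toAffine.Point, addOrderOf P = N →
    ∃! q : K × VariableChange K, q.1 ∈ U ∧ q.2 • W = E q.1 ∧ Carries q.2 P 0 0

/-- The points of `W` over the algebraic closure of `K`. -/
abbrev GeomPoint {K : Type*} [Field K] (W : WeierstrassCurve K) : Type _ :=
  (W⁄(AlgebraicClosure K)).toAffine.Point

open scoped Classical in
/-- The multiple `n P` of a geometric point. -/
def mulPoint {K : Type*} [Field K] {W : WeierstrassCurve K} (n : ℕ) (P : GeomPoint W) :
    GeomPoint W :=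
  n • P

open scoped Classical in
/-- The Galois action on geometric points. -/
def gal {K : Type*} [Field K] {W : WeierstrassCurve K}
    (g : AlgebraicClosure K ≃ₐ[K] AlgebraicClosure K) (P : GeomPoint W) : GeomPoint W :=
  Affine.Point.map (W' := W) (g : AlgebraicClosure K →ₐ[K] AlgebraicClosure K) P

/-- A level problem whose data are represented by two geometric points. -/
abbrev LevelProblem (K : Type*) [Field K] : Type _ :=
  ∀ W : WeierstrassCurve K, GeomPoint W → GeomPoint W → Prop

open scoped Classical in
/-- Level structure for `Γ₁(6) ∩ Γ(2)`: a rational point `P` of order `6` and a rational point `Q`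
of order `2` with `Q ≠ 3P` (a point of `Y₁(6) ×_{Y₁(2)} Y(2)`). -/
def level62 (K : Type*) [Field K] : LevelProblem K := fun _ P Q =>
  addOrderOf P = 6 ∧ addOrderOf Q = 2 ∧ Q ≠ 3 • P ∧ ∀ g, gal g P = P ∧ gal g Q = Q

open scoped Classical in
/-- Level structure for `Γ(4)`: a rational point `P` of order `4` and a rational cyclic subgroup
`{0, ±Q, 2Q}` of order `4` meeting that of `P` trivially. By the Weil pairing with `P` this subgroup
is identified with `μ₄`, so this is an isomorphism of the `4`-torsion with `ℤ/4 × μ₄` of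
determinant one. It depends on `Q` only up to sign. -/
def level4 (K : Type*) [Field K] : LevelProblem K := fun _ P Q =>
  addOrderOf P = 4 ∧ addOrderOf Q = 4 ∧ 2 • P ≠ 2 • Q ∧
    ∀ g, gal g P = P ∧ (gal g Q = Q ∨ gal g Q = -Q)

open scoped Classical in
/-- Level structure for `Γ₁(4) ∩ Γ₀(8) ∩ Γ(2)`: a rational cyclic subgroup of order `8`, together
with a rational generator of its subgroup of order `4`, and a rational point `Q` of order `2` not in
it. The first two are given by a geometric point `U` of order `8`, as `⟨U⟩` and `2U`; they depend
only on `{U, 5U}`, which has to be rational. On `ℂ/(ℤ + ℤτ)` take `U = 1/8`, `Q = τ/2`. -/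
def level82 (K : Type*) [Field K] : LevelProblem K := fun _ U Q =>
  addOrderOf U = 8 ∧ addOrderOf Q = 2 ∧ Q ≠ 4 • U ∧
    ∀ g, (gal g U = U ∨ gal g U = 5 • U) ∧ gal g Q = Q

open scoped Classical in
/-- Level structure for the group of matrices `(1+4a, 2b; 4c, 1+4d)` with `a ≡ c mod 2`: a rational
point `D` of order `2` and a rational coset `{U, U + D}` where `U` is a geometric point of order `8`
with `4U ≠ D`. This group is the stabiliser of these data on `ℂ/(ℤ + ℤτ)` for `U = 1/8`,
`D = (1+τ)/2`. -/
def level8412 (K : Type*) [Field K] : LevelProblem K := fun _ U D =>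
  addOrderOf U = 8 ∧ addOrderOf D = 2 ∧ D ≠ 4 • U ∧
    ∀ g, (gal g U = U ∨ gal g U = U + D) ∧ gal g D = D

/-- Over `K`, the curves `E t` (`t ∈ U`) form the universal elliptic curve with level structure of
the kind `Lvl`. The universal level structure at `t` consists of two affine points with coordinates
`x₁, y₁` and `x₂, y₂` such that `Mark t x₁ y₁ x₂ y₂`. The fibres carry it, and every elliptic curve
over `K` with level structure is isomorphic, together with the level structure, to exactly one
fibre, by a unique isomorphism. -/
def IsUniversal {K : Type*} [Field K] (Lvl : LevelProblem K) (E : K → WeierstrassCurve K)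
    (U : Set K)
    (Mark : K → AlgebraicClosure K → AlgebraicClosure K → AlgebraicClosure K →
      AlgebraicClosure K → Prop) : Prop :=
  (∀ t ∈ U, (E t).IsElliptic ∧ ∃ x₁ y₁ h₁ x₂ y₂ h₂,
    Mark t x₁ y₁ x₂ y₂ ∧ Lvl (E t) (.some x₁ y₁ h₁) (.some x₂ y₂ h₂)) ∧
  ∀ (W : WeierstrassCurve K), W.IsElliptic → ∀ P Q : GeomPoint W, Lvl W P Q →
    ∃! q : K × VariableChange K, q.1 ∈ U ∧ q.2 • W = E q.1 ∧
      ∃ x₁ y₁ x₂ y₂, Mark q.1 x₁ y₁ x₂ y₂ ∧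
        Carries (q.2.baseChange (AlgebraicClosure K)) P x₁ y₁ ∧
        Carries (q.2.baseChange (AlgebraicClosure K)) Q x₂ y₂

section Marks

variable {K L : Type*} [Field K] [Field L] [Algebra K L]

/-- On `E(6,2)`: the point `(0, 0)` of order `6`, and the point of order `2` with coordinates
`4(ξ-1)/((ξ-3)²(ξ+3))` and `-8(ξ-1)²/((ξ-3)³(ξ+3)²)`. -/
def mark62 (ξ : K) (x₁ y₁ x₂ y₂ : L) : Prop :=
  x₁ = 0 ∧ y₁ = 0 ∧
  x₂ = algebraMap K L (4 * (ξ - 1) / ((ξ - 3) ^ 2 * (ξ + 3))) ∧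
  y₂ = algebraMap K L (-8 * (ξ - 1) ^ 2 / ((ξ - 3) ^ 3 * (ξ + 3) ^ 2))

/-- On `E(4)`: the point `P = ((σ²+1)/2, (σ⁴-1)/(4σ))` and the two points `±Q` with
`x`-coordinate `(σ+σ⁻¹)/2`. -/
def mark4 (σ : K) (x₁ y₁ x₂ _y₂ : L) : Prop :=
  x₁ = algebraMap K L ((σ ^ 2 + 1) / 2) ∧ y₁ = algebraMap K L ((σ ^ 4 - 1) / (4 * σ)) ∧
  x₂ = algebraMap K L ((σ + σ⁻¹) / 2)

/-- The isogeny dual to `(x, y) ↦ (y²/x², y(b - x²)/x²)` from `y² = x(x² + a x + b)` to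
`y² = x(x² - 2a x + b')`, where `b' = a² - 4b`, sends `(u, v)` to
`(v²/(4u²), v(b' - u²)/(8u²))`; this is `(X, Y)`. -/
def DualIsogenyMaps (b' u v X Y : L) : Prop :=
  u ≠ 0 ∧ X = v ^ 2 / (4 * u ^ 2) ∧ Y = v * (b' - u ^ 2) / (8 * u ^ 2)

/-- On `E(8,2)`: the two points `U` which the dual isogeny to `E(4)` maps to the marked point
of order `4` of `E(4)`, and the point `(-(σ-1)⁴/(4σ²), 0)` of order `2`. -/
def mark82 (σ : K) (x₁ y₁ x₂ y₂ : L) : Prop :=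
  DualIsogenyMaps (algebraMap K L ((σ - σ⁻¹) ^ 4 / 16)) x₁ y₁
    (algebraMap K L ((σ ^ 2 + 1) / 2)) (algebraMap K L ((σ ^ 4 - 1) / (4 * σ))) ∧
  x₂ = algebraMap K L (-(σ - 1) ^ 4 / (4 * σ ^ 2)) ∧ y₂ = 0

/-- On `E(8;4,1,2)`: the two points `U` which the dual isogeny to `E₁(8)`, written as
`Y² = X(X² + (8k⁴-16k³+16k²-8k+1)X + (2k(k-1))⁴)`, maps to the marked point
`(4k³(1-k), -4k³(2k-1)(k-1))` of order `8`, and the point `(0, 0)` of order `2`. -/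
def mark8412 (k : K) (x₁ y₁ x₂ y₂ : L) : Prop :=
  DualIsogenyMaps (algebraMap K L ((8 * k ^ 2 - 8 * k + 1) * (2 * k - 1) ^ 4)) x₁ y₁
    (algebraMap K L (4 * k ^ 3 * (1 - k)))
    (algebraMap K L (-4 * k ^ 3 * (2 * k - 1) * (k - 1))) ∧
  x₂ = 0 ∧ y₂ = 0

end Marks

open scoped Classical in
/-- Over a field `K` of characteristic zero: `W'` is the quotient of `W` by the subgroup `{0, S}`
generated by the point `S` of order two, that is, there is an isogeny `φ : W → W'` over `K` with
kernel `{0, S}`. It is given by rational functions `f/h`, `g/h` with coefficients in `K`. -/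
def IsQuotientByTwoTorsion {K : Type*} [Field K] (W W' : WeierstrassCurve K) (S : GeomPoint W) :
    Prop :=
  addOrderOf S = 2 ∧
  ∃ φ : GeomPoint W →+ GeomPoint W', Function.Surjective φ ∧
    (∀ P, φ P = 0 ↔ P = 0 ∨ P = S) ∧
    ∃ f g h : MvPolynomial (Fin 2) K, ∀ x y hxy,
      φ (.some x y hxy) ≠ 0 → MvPolynomial.aeval ![x, y] h ≠ 0 ∧
        ∃ h', φ (.some x y hxy) =
          .some (MvPolynomial.aeval ![x, y] f / MvPolynomial.aeval ![x, y] h)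
            (MvPolynomial.aeval ![x, y] g / MvPolynomial.aeval ![x, y] h) h'

end Moduli

/-! ## Kodaira types of the fibres of an elliptic surface over the projective line -/

section Kodaira

open WeierstrassCurve WithZero

/-- Kodaira's symbols; `I 0` is a smooth fibre. -/
inductive KodairaType
  | I (n : ℕ)
  | II
  | III
  | IV
  | Istar (n : ℕ)
  | IVstar
  | IIIstar
  | IIstar

variable {F : Type*} [Field F]

/-- The place `t = c` of `F(t)`. -/
def finitePlace (c : F) : IsDedekindDomain.HeightOneSpectrum (Polynomial F) where
  asIdeal := Ideal.span {Polynomial.X - Polynomial.C c}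
  isPrime := (Ideal.span_singleton_prime (Polynomial.X_sub_C_ne_zero c)).2
    (Polynomial.prime_X_sub_C c)
  ne_bot := by
    rw [ne_eq, Ideal.span_singleton_eq_bot]
    exact Polynomial.X_sub_C_ne_zero c

open scoped Classical in
/-- The valuation of `F(t)` at a point of the projective line over `F`; a function that vanishes to
order `n` there has valuation `exp (-n)`. -/
def placeVal : OnePoint F → Valuation (RatFunc F) ℤᵐ⁰
  | .some c => (finitePlace c).valuation (RatFunc F)
  | .none => RatFunc.inftyValuation F

/-- The coefficients are regular at the place. -/
def IsIntegralAt (v : Valuation (RatFunc F) ℤᵐ⁰) (W : WeierstrassCurve (RatFunc F)) : Prop :=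
  v W.a₁ ≤ 1 ∧ v W.a₂ ≤ 1 ∧ v W.a₃ ≤ 1 ∧ v W.a₄ ≤ 1 ∧ v W.a₆ ≤ 1

/-- Minimal Weierstrass equation at the place. -/
def IsMinimalAt (v : Valuation (RatFunc F) ℤᵐ⁰) (W : WeierstrassCurve (RatFunc F)) : Prop :=
  IsIntegralAt v W ∧
    ∀ C : VariableChange (RatFunc F), IsIntegralAt v (C • W) → v (C • W).Δ ≤ v W.Δ

/-- Kodaira's table (residue field algebraically closed of characteristic zero): the type of the
special fibre of the minimal regular model, read off from the orders of vanishing of `Δ`, `c₄`, `c₆`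
of a minimal Weierstrass equation. -/
def KodairaType.Table (v : Valuation (RatFunc F) ℤᵐ⁰) (W : WeierstrassCurve (RatFunc F)) :
    KodairaType → Prop
  | .I n => v W.Δ = exp (-(n : ℤ)) ∧ (0 < n → v W.c₄ = 1)
  | .II => v W.Δ = exp (-2) ∧ v W.c₄ < 1
  | .III => v W.Δ = exp (-3) ∧ v W.c₄ < 1
  | .IV => v W.Δ = exp (-4) ∧ v W.c₄ < 1
  | .Istar n => v W.Δ = exp (-(n + 6 : ℤ)) ∧ v W.c₄ ≤ exp (-2) ∧ v W.c₆ ≤ exp (-3) ∧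
      (0 < n → v W.c₄ = exp (-2) ∧ v W.c₆ = exp (-3))
  | .IVstar => v W.Δ = exp (-8) ∧ v W.c₄ ≤ exp (-3)
  | .IIIstar => v W.Δ = exp (-9) ∧ v W.c₄ ≤ exp (-3)
  | .IIstar => v W.Δ = exp (-10) ∧ v W.c₄ ≤ exp (-4)

/-- The relatively minimal elliptic surface over the projective line with generic fibre `W` has a
fibre of type `T` over the point `c`. -/
def HasKodairaType (W : WeierstrassCurve (RatFunc F)) (c : OnePoint F) (T : KodairaType) : Prop :=
  ∃ C : VariableChange (RatFunc F),
    IsMinimalAt (placeVal c) (C • W) ∧ T.Table (placeVal c) (C • W)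

/-- The singular fibres of the relatively minimal elliptic surface over the projective line with
generic fibre `W` have the types listed, with multiplicities, in `L`. -/
def SingularFibres (W : WeierstrassCurve (RatFunc F)) (L : Multiset KodairaType) : Prop :=
  ∃ (S : Finset (OnePoint F)) (T : OnePoint F → KodairaType),
    (∀ c, HasKodairaType W c (T c)) ∧ (∀ c, T c ≠ .I 0 ↔ c ∈ S) ∧ S.val.map T = L

end Kodaira

end TateModular

end

namespace TateModular

open WeierstrassCurve

/-! ## The chord and tangent process in coordinates -/

section Addition

variable {F : Type*} [Field F] [DecidableEq F] {W : WeierstrassCurve F}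

/-! Each moduli statement is reduced to coordinates in which the level structure leaves no freedom.
Move `P` to the origin and make its tangent horizontal, which is possible as `2P ≠ 0`. Then `3P ≠ 0`
says `a₂ ≠ 0`, and the remaining scaling is used up by requiring `a₂ = a₃`. This is Tate's form
(`hasTateNormalForms`). On it `2P`, `3P` and, with `d = b/(a-1)`, `4P` have short formulas, so
having order `N` is one equation in `a, b`: `a = 1` for 4, `2(3P) = 0` for 6, `x(4P) = x(3P)` for 7,
`2(4P) = 0` for 8. Each defines a rational curve, with parameter `d` itself for 7 and 8.

In characteristic zero Galois-invariant points are rational. For `E(6,2)` a further point of order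
two on `E₁(6)` is a rational root of a quadratic, and `ξ` parametrises the condition that its
discriminant be a square. For `E(4)` put `2Q` at the origin: `x(Q)` is a rational square root of
`a₄`, and `σ = x(P)/x(Q)` (`exists_sigma`). For the last two families let `φ` be the isogeny of
degree two with kernel generated by `T`, where `T = 4U` for `E(8,2)` and `T = D` for `E(8;4,1,2)`.
The pair `{U, U + T}` is Galois stable exactly when `φ(U)` is rational, so `U` is traded for a
rational point of order 4 or 8, and the family is found from `E(4)` or `E₁(8)`. Uniqueness is a
comparison of two fibres (`isUniversal_of`).

That `φ` is a homomorphism (`twoIsogFun_add`) holds because points on a line `y = ℓx + ν` go to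
points on a line of slope `c(a₄/ν - ℓ)`. Its surjectivity over an algebraically closed field also
gives the quotient statements.

For the singular fibres, take a model with polynomial coefficients and factor `Δ`. At a root of
multiplicity `n` with `c₄ ≠ 0` the model is minimal and the fibre is `I n`. At infinity, if `deg aᵢ
≤ i d`, scaling by `t^d` gives an integral model whose discriminant vanishes to order `12d - deg Δ`
(`singularFibres_of_semistable_model`). Only `E₁(4)` has an additive fibre, which lies at infinity.
-/

lemma exists_add_eq_of_secant {x₁ y₁ x₂ y₂ x₃ y₃ : F} (ℓ : F) (h₁ : W.toAffine.Nonsingular x₁ y₁)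
    (h₂ : W.toAffine.Nonsingular x₂ y₂) (hx : x₁ ≠ x₂) (hℓ : y₁ - y₂ = ℓ * (x₁ - x₂))
    (hx₃ : x₃ = ℓ ^ 2 + W.a₁ * ℓ - W.a₂ - x₁ - x₂)
    (hy₃ : y₃ = -(ℓ * (x₃ - x₁) + y₁) - W.a₁ * x₃ - W.a₃) :
    ∃ h₃, (Affine.Point.some x₁ y₁ h₁ : W.toAffine.Point) + .some x₂ y₂ h₂ = .some x₃ y₃ h₃ := by
  have hs : W.toAffine.slope x₁ x₂ y₁ y₂ = ℓ := by
    rw [Affine.slope_of_X_ne hx, hℓ, mul_div_cancel_right₀ _ (sub_ne_zero.2 hx)]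
  have e₁ : x₃ = W.toAffine.addX x₁ x₂ (W.toAffine.slope x₁ x₂ y₁ y₂) := by
    rw [hs, hx₃, Affine.addX]
  have e₂ : y₃ = W.toAffine.addY x₁ x₂ y₁ (W.toAffine.slope x₁ x₂ y₁ y₂) := by
    rw [Affine.addY, Affine.negAddY, ← e₁, hs, hy₃, Affine.negY]
  subst e₁ e₂
  exact ⟨_, Affine.Point.add_of_X_ne hx⟩

lemma exists_add_eq_of_tangent {x₁ y₁ x₃ y₃ : F} (ℓ : F) (h₁ : W.toAffine.Nonsingular x₁ y₁)
    (hy : 2 * y₁ + W.a₁ * x₁ + W.a₃ ≠ 0)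
    (hℓ : 3 * x₁ ^ 2 + 2 * W.a₂ * x₁ + W.a₄ - W.a₁ * y₁ = ℓ * (2 * y₁ + W.a₁ * x₁ + W.a₃))
    (hx₃ : x₃ = ℓ ^ 2 + W.a₁ * ℓ - W.a₂ - x₁ - x₁)
    (hy₃ : y₃ = -(ℓ * (x₃ - x₁) + y₁) - W.a₁ * x₃ - W.a₃) :
    ∃ h₃, (Affine.Point.some x₁ y₁ h₁ : W.toAffine.Point) + .some x₁ y₁ h₁ = .some x₃ y₃ h₃ := by
  have hy' : y₁ ≠ W.toAffine.negY x₁ y₁ := fun h ↦ hy (by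
    rw [Affine.negY] at h; linear_combination h)
  have hs : W.toAffine.slope x₁ x₁ y₁ y₁ = ℓ := by
    rw [Affine.slope_of_Y_ne rfl hy', hℓ, Affine.negY, div_eq_iff]
    · ring
    · intro h; exact hy (by linear_combination h)
  have e₁ : x₃ = W.toAffine.addX x₁ x₁ (W.toAffine.slope x₁ x₁ y₁ y₁) := by
    rw [hs, hx₃, Affine.addX]
  have e₂ : y₃ = W.toAffine.addY x₁ x₁ y₁ (W.toAffine.slope x₁ x₁ y₁ y₁) := by
    rw [Affine.addY, Affine.negAddY, ← e₁, hs, hy₃, Affine.negY]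
  subst e₁ e₂
  exact ⟨_, Affine.Point.add_self_of_Y_ne hy'⟩

lemma add_self_eq_zero_iff {x y : F} (h : W.toAffine.Nonsingular x y) :
    (Affine.Point.some x y h : W.toAffine.Point) + .some x y h = 0 ↔
      2 * y + W.a₁ * x + W.a₃ = 0 := by
  rw [add_eq_zero_iff_eq_neg, Affine.Point.neg_some, Affine.Point.some.injEq, Affine.negY]
  constructor
  · rintro ⟨-, h⟩; linear_combination h
  · intro h; exact ⟨rfl, by linear_combination h⟩

end Addition

/-! ## The action of a change of variables on points -/

section VariableChange

variable {F : Type*} [Field F] {W W' V : WeierstrassCurve F} {C D : VariableChange F}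

lemma nonsingular_of_variableChange (h : C • W = W') {x y : F}
    (hxy : W'.toAffine.Nonsingular x y) :
    W.toAffine.Nonsingular ((C.u : F) ^ 2 * x + C.r)
      ((C.u : F) ^ 3 * y + (C.u : F) ^ 2 * C.s * x + C.t) := by
  subst h
  obtain ⟨u, r, s, t⟩ := C
  have hu : (u : F) ≠ 0 := u.ne_zero
  rw [Affine.nonsingular_iff'] at hxy ⊢
  rw [Affine.equation_iff'] at hxy ⊢
  simp only [variableChange_def, Units.val_inv_eq_inv_val] at hxy ⊢
  obtain ⟨h₁, h₂⟩ := hxy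
  refine ⟨?_, ?_⟩
  · field_simp at h₁
    linear_combination h₁
  -- The two partial derivatives transform by an invertible triangular matrix, so they vanish
  -- simultaneously on both curves.
  · by_contra! hc
    obtain ⟨h₃, h₄⟩ := hc
    rcases h₂ with h₂ | h₂ <;> apply h₂ <;> field_simp
    · linear_combination h₃ + s * h₄
    · linear_combination h₄

/-- The isomorphism from `W' = C • W` to `W` on points. -/
def vcFun (h : C • W = W') : W'.toAffine.Point → W.toAffine.Point
  | .zero => 0
  | .some _ _ hxy => .some _ _ (nonsingular_of_variableChange h hxy)

variable [DecidableEq F]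

/-- Lines go to lines: slope `ℓ` on `W'` becomes slope `u ℓ + s` on `W`. The chord and tangent
formulas then match by the coefficient relations `e₁` to `e₄`. -/
lemma vcFun_add (h : C • W = W') (P Q : W'.toAffine.Point) :
    vcFun h (P + Q) = vcFun h P + vcFun h Q := by
  rcases P with _ | ⟨x₁, y₁, h₁⟩
  · exact (congrArg _ (zero_add Q)).trans (zero_add _).symm
  rcases Q with _ | ⟨x₂, y₂, h₂⟩
  · exact (congrArg _ (add_zero _)).trans (add_zero _).symm
  have hu : (C.u : F) ≠ 0 := C.u.ne_zero
  have e₁ : C.u * W'.a₁ = W.a₁ + 2 * C.s := by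
    rw [← h, variableChange_a₁, Units.mul_inv_cancel_left]
  have e₂ : (C.u : F) ^ 2 * W'.a₂ = W.a₂ - C.s * W.a₁ + 3 * C.r - C.s ^ 2 := by
    rw [← h, variableChange_a₂, Units.val_inv_eq_inv_val]; field_simp
  have e₃ : (C.u : F) ^ 3 * W'.a₃ = W.a₃ + C.r * W.a₁ + 2 * C.t := by
    rw [← h, variableChange_a₃, Units.val_inv_eq_inv_val]; field_simp
  have e₄ : (C.u : F) ^ 4 * W'.a₄ = W.a₄ - C.s * W.a₃ + 2 * C.r * W.a₂ -
      (C.t + C.r * C.s) * W.a₁ + 3 * C.r ^ 2 - 2 * C.s * C.t := by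
    rw [← h, variableChange_a₄, Units.val_inv_eq_inv_val]; field_simp
  by_cases hxy : x₁ = x₂ ∧ y₁ = W'.toAffine.negY x₂ y₂
  · rw [Affine.Point.add_of_Y_eq hxy.1 hxy.2]
    refine (Affine.Point.add_of_Y_eq ?_ ?_).symm
    · rw [hxy.1]
    · obtain ⟨rfl, hy⟩ := hxy
      rw [hy, Affine.negY, Affine.negY]
      linear_combination -C.u ^ 2 * x₁ * e₁ - e₃
  · rw [Affine.Point.add_some hxy]
    symm
    by_cases hx : x₁ = x₂
    · subst hx
      have hy : y₁ ≠ W'.toAffine.negY x₁ y₂ := fun h ↦ hxy ⟨rfl, h⟩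
      obtain rfl : y₁ = y₂ := Affine.Y_eq_of_Y_ne h₁.1 h₂.1 rfl hy
      have hy' : 2 * y₁ + W'.a₁ * x₁ + W'.a₃ ≠ 0 := fun h ↦ hy (by
        rw [Affine.negY]; linear_combination h)
      obtain ⟨ℓ, hℓ⟩ : ∃ ℓ, W'.toAffine.slope x₁ x₁ y₁ y₁ = ℓ := ⟨_, rfl⟩
      have hℓ' : 3 * x₁ ^ 2 + 2 * W'.a₂ * x₁ + W'.a₄ - W'.a₁ * y₁ =
          ℓ * (2 * y₁ + W'.a₁ * x₁ + W'.a₃) := by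
        rw [← hℓ, Affine.slope_of_Y_ne rfl hy, Affine.negY, eq_comm, div_mul_eq_mul_div,
          div_eq_iff (fun h ↦ hy' (by linear_combination h))]
        ring
      refine (exists_add_eq_of_tangent (C.u * ℓ + C.s) _ ?_ ?_ ?_ ?_).choose_spec
      · intro h
        apply hy'
        apply mul_left_cancel₀ (pow_ne_zero 3 hu)
        linear_combination h + C.u ^ 2 * x₁ * e₁ + e₃
      · linear_combination C.u ^ 4 * hℓ' + C.u ^ 3 * y₁ * e₁ - 2 * C.u ^ 2 * x₁ * e₂ - e₄ +
          (C.u * ℓ) * (C.u ^ 2 * x₁ * e₁ + e₃)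
      · rw [Affine.addX, hℓ]
        linear_combination C.u * ℓ * e₁ - e₂
      · rw [Affine.addY, Affine.negY, Affine.negAddY, Affine.addX, hℓ]
        linear_combination -C.u ^ 2 * (ℓ ^ 2 + W'.a₁ * ℓ - W'.a₂ - x₁ - x₁) * e₁ - e₃
    · obtain ⟨ℓ, hℓ⟩ : ∃ ℓ, W'.toAffine.slope x₁ x₂ y₁ y₂ = ℓ := ⟨_, rfl⟩
      have hℓ' : y₁ - y₂ = ℓ * (x₁ - x₂) := by
        rw [← hℓ, Affine.slope_of_X_ne hx, div_mul_cancel₀ _ (sub_ne_zero.2 hx)]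
      refine (exists_add_eq_of_secant (C.u * ℓ + C.s) _ _ ?_ ?_ ?_ ?_).choose_spec
      · intro h
        exact hx (mul_left_cancel₀ (pow_ne_zero 2 hu) (by linear_combination h))
      · linear_combination C.u ^ 3 * hℓ'
      · rw [Affine.addX, hℓ]
        linear_combination C.u * ℓ * e₁ - e₂
      · rw [Affine.addY, Affine.negY, Affine.negAddY, Affine.addX, hℓ]
        linear_combination -C.u ^ 2 * (ℓ ^ 2 + W'.a₁ * ℓ - W'.a₂ - x₁ - x₂) * e₁ - e₃

/-- The isomorphism from `W' = C • W` to `W`, as a homomorphism of groups of points. -/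
def vcHom (h : C • W = W') : W'.toAffine.Point →+ W.toAffine.Point where
  toFun := vcFun h
  map_zero' := rfl
  map_add' := vcFun_add h

end VariableChange

end TateModular

namespace TateModular

open WeierstrassCurve

section VariableChange

variable {F : Type*} [Field F] {W W' V : WeierstrassCurve F} {C D : VariableChange F}

lemma exists_eq_of_nonsingular_of_variableChange (h : C • W = W') {x y : F}
    (hxy : W.toAffine.Nonsingular x y) :
    ∃ x' y', x = C.u ^ 2 * x' + C.r ∧ y = C.u ^ 3 * y' + C.u ^ 2 * C.s * x' + C.t ∧
      W'.toAffine.Nonsingular x' y' := by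
  have h' : C⁻¹ • W' = W := by rw [← h, inv_smul_smul]
  refine ⟨_, _, ?_, ?_, nonsingular_of_variableChange h' hxy⟩ <;>
  · simp only [VariableChange.inv_def, Units.val_inv_eq_inv_val]
    field_simp
    ring

variable [DecidableEq F]

@[simp]
lemma vcHom_some (h : C • W = W') {x y : F} (hxy : W'.toAffine.Nonsingular x y) :
    vcHom h (.some x y hxy) = .some _ _ (nonsingular_of_variableChange h hxy) := rfl

lemma vcHom_injective (h : C • W = W') : Function.Injective (vcHom h) := by
  rw [injective_iff_map_eq_zero]
  rintro (_ | ⟨x, y, hxy⟩) hP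
  · rfl
  · exact absurd hP (Affine.Point.some_ne_zero _)

lemma vcHom_surjective (h : C • W = W') : Function.Surjective (vcHom h) := by
  rintro (_ | ⟨x, y, hxy⟩)
  · exact ⟨0, rfl⟩
  · obtain ⟨x', y', rfl, rfl, h'⟩ := exists_eq_of_nonsingular_of_variableChange h hxy
    exact ⟨.some x' y' h', rfl⟩

/-- Expresses `Carries` through the group isomorphism `vcHom`, so that orders and multiples of
points can be transported. -/
lemma carries_iff (h : C • W = W') {P : W.toAffine.Point} {x y : F} :
    Carries C P x y ↔ ∃ hxy : W'.toAffine.Nonsingular x y, P = vcHom h (.some x y hxy) := by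
  constructor
  · rintro ⟨h₁, rfl⟩
    obtain ⟨x', y', hx, hy, h'⟩ := exists_eq_of_nonsingular_of_variableChange h h₁
    have hu : (C.u : F) ≠ 0 := C.u.ne_zero
    obtain rfl : x = x' := by
      apply mul_left_cancel₀ (pow_ne_zero 2 hu)
      linear_combination hx
    obtain rfl : y = y' := by
      apply mul_left_cancel₀ (pow_ne_zero 3 hu)
      linear_combination hy
    exact ⟨h', rfl⟩
  · rintro ⟨h₁, rfl⟩
    exact ⟨_, rfl⟩

lemma vcHom_mul (h : C • W = W') (h' : D • W' = V) (h'' : (D * C) • W = V) (P : V.toAffine.Point) :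
    vcHom h'' P = vcHom h (vcHom h' P) := by
  rcases P with _ | ⟨x, y, hxy⟩
  · rfl
  · simp only [vcHom_some, Affine.Point.some.injEq, VariableChange.mul_def, Units.val_mul]
    constructor <;> ring

lemma Carries.mul (h : C • W = W') {P : W'.toAffine.Point} {x y : F} (h' : D • W' = V)
    (hP : Carries D P x y) : Carries (D * C) (vcHom h P) x y := by
  have h'' : (D * C) • W = V := by rw [mul_smul, h, h']
  obtain ⟨hxy, rfl⟩ := (carries_iff h').1 hP
  exact (carries_iff h'').2 ⟨hxy, (vcHom_mul h h' h'' _).symm⟩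

lemma addOrderOf_vcHom (h : C • W = W') (P : W'.toAffine.Point) :
    addOrderOf (vcHom h P) = addOrderOf P :=
  addOrderOf_injective (vcHom h) (vcHom_injective h) P

end VariableChange

/-! ### Galois action on geometric points and descent to rational points -/

section Galois

variable {K : Type*} [Field K] {W W' : WeierstrassCurve K} {C : VariableChange K}

lemma baseChange_smul (L : Type*) [Field L] [Algebra K L] (h : C • W = W') :
    C.baseChange L • W.baseChange L = W'.baseChange L := by
  rw [← h]
  exact map_variableChange W C (algebraMap K L)

open scoped Classical in
lemma gal_some (g : AlgebraicClosure K ≃ₐ[K] AlgebraicClosure K) {x y : AlgebraicClosure K}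
    (h : (W⁄(AlgebraicClosure K)).toAffine.Nonsingular x y) :
    ∃ h', gal g (.some x y h : GeomPoint W) = .some (g x) (g y) h' :=
  ⟨_, Affine.Point.map_some ..⟩

open scoped Classical in
/-- The isomorphism from `W' = C • W` to `W` on geometric points. -/
noncomputable abbrev geomHom (h : C • W = W') : GeomPoint W' →+ GeomPoint W :=
  vcHom (baseChange_smul (AlgebraicClosure K) h)

open scoped Classical in
lemma geomHom_injective (h : C • W = W') : Function.Injective (geomHom h) :=
  vcHom_injective _

open scoped Classical in
lemma geomHom_surjective (h : C • W = W') : Function.Surjective (geomHom h) :=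
  vcHom_surjective _

open scoped Classical in
lemma geomHom_add (h : C • W = W') (P Q : GeomPoint W') :
    geomHom h (P + Q) = geomHom h P + geomHom h Q :=
  map_add _ _ _

open scoped Classical in
lemma geomHom_neg (h : C • W = W') (P : GeomPoint W') : geomHom h (-P) = -geomHom h P :=
  map_neg _ _

open scoped Classical in
lemma geomHom_nsmul (h : C • W = W') (n : ℕ) (P : GeomPoint W') :
    geomHom h (n • P) = n • geomHom h P :=
  map_nsmul _ _ _

open scoped Classical in
lemma gal_nsmul (g : AlgebraicClosure K ≃ₐ[K] AlgebraicClosure K) (n : ℕ) (P : GeomPoint W) :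
    gal g (n • P) = n • gal g P :=
  map_nsmul _ _ _

open scoped Classical in
-- The coefficients of `C` lie in `K`, so the Galois group fixes them.
lemma gal_geomHom (h : C • W = W') (g : AlgebraicClosure K ≃ₐ[K] AlgebraicClosure K)
    (P : GeomPoint W') : gal g (geomHom h P) = geomHom h (gal g P) := by
  rcases P with _ | ⟨x, y, hxy⟩
  · rfl
  · obtain ⟨h₁, e₁⟩ := gal_some g hxy
    obtain ⟨h₂, e₂⟩ := gal_some g
      (nonsingular_of_variableChange (baseChange_smul (AlgebraicClosure K) h) hxy)
    rw [e₁, vcHom_some, vcHom_some, e₂]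
    simp only [VariableChange.baseChange, VariableChange.map_u, VariableChange.map_r,
      VariableChange.map_s, VariableChange.map_t, Units.coe_map, MonoidHom.coe_coe, map_add,
      map_mul, map_pow, AlgEquiv.commutes]

/-- In characteristic zero the algebraic closure is Galois over `K`, with fixed field `K`. -/
lemma exists_algebraMap_eq [CharZero K] {x : AlgebraicClosure K}
    (hx : ∀ g : AlgebraicClosure K ≃ₐ[K] AlgebraicClosure K, g x = x) :
    ∃ x₀ : K, algebraMap K (AlgebraicClosure K) x₀ = x := by
  have := (InfiniteGalois.mem_bot_iff_fixed (k := K) x).2 hx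
  exact IntermediateField.mem_bot.1 this

lemma exists_eq_of_gal_eq [CharZero K] {x y : AlgebraicClosure K}
    {h : (W⁄(AlgebraicClosure K)).toAffine.Nonsingular x y}
    (hg : ∀ g, gal g (.some x y h : GeomPoint W) = .some x y h) :
    ∃ x₀ y₀, algebraMap K (AlgebraicClosure K) x₀ = x ∧
      algebraMap K (AlgebraicClosure K) y₀ = y ∧ W.toAffine.Nonsingular x₀ y₀ := by
  have key (g : AlgebraicClosure K ≃ₐ[K] AlgebraicClosure K) : g x = x ∧ g y = y := by
    obtain ⟨h', e⟩ := gal_some g h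
    rw [hg] at e
    exact ⟨(Affine.Point.some.inj e).1.symm, (Affine.Point.some.inj e).2.symm⟩
  obtain ⟨x₀, rfl⟩ := exists_algebraMap_eq fun g ↦ (key g).1
  obtain ⟨y₀, rfl⟩ := exists_algebraMap_eq fun g ↦ (key g).2
  exact ⟨x₀, y₀, rfl, rfl,
    (Affine.map_nonsingular (W := W) (algebraMap K (AlgebraicClosure K)).injective x₀ y₀).1 h⟩

lemma gal_algebraMap (g : AlgebraicClosure K ≃ₐ[K] AlgebraicClosure K) {x y : K}
    (h : (W⁄(AlgebraicClosure K)).toAffine.Nonsingular (algebraMap K (AlgebraicClosure K) x)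
      (algebraMap K (AlgebraicClosure K) y)) :
    gal g (.some _ _ h : GeomPoint W) = .some _ _ h := by
  obtain ⟨h', e⟩ := gal_some g h
  simp only [e, AlgEquiv.commutes]

end Galois

/-! ### Reduction of universality to normal forms -/

section Universal

variable {K : Type*} [Field K] {E : K → WeierstrassCurve K} {U : Set K}
  {Mark : K → AlgebraicClosure K → AlgebraicClosure K → AlgebraicClosure K →
      AlgebraicClosure K → Prop}

/-- The curve `W` with the points `P`, `Q` is isomorphic to a marked fibre of the family `E`. -/
def IsMarkedFibre (E : K → WeierstrassCurve K) (U : Set K)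
    (Mark : K → AlgebraicClosure K → AlgebraicClosure K → AlgebraicClosure K →
      AlgebraicClosure K → Prop) (W : WeierstrassCurve K) (P Q : GeomPoint W) : Prop :=
  ∃ t ∈ U, ∃ C : VariableChange K, C • W = E t ∧ ∃ x₁ y₁ x₂ y₂, Mark t x₁ y₁ x₂ y₂ ∧
    Carries (C.baseChange (AlgebraicClosure K)) P x₁ y₁ ∧
    Carries (C.baseChange (AlgebraicClosure K)) Q x₂ y₂

/-- Allows the existence half of universality to be proved after a convenient change of coordinates.
-/
lemma IsMarkedFibre.of_smul {W W' : WeierstrassCurve K} {C : VariableChange K} (h : C • W = W')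
    {P Q : GeomPoint W'} (hPQ : IsMarkedFibre E U Mark W' P Q) :
    IsMarkedFibre E U Mark W (geomHom h P) (geomHom h Q) := by
  classical
  obtain ⟨t, ht, D, hD, x₁, y₁, x₂, y₂, hm, h₁, h₂⟩ := hPQ
  have hmul : (D * C).baseChange (AlgebraicClosure K) =
      D.baseChange (AlgebraicClosure K) * C.baseChange (AlgebraicClosure K) :=
    map_mul (VariableChange.mapHom (algebraMap K (AlgebraicClosure K))) D C
  refine ⟨t, ht, D * C, by rw [mul_smul, h, hD], x₁, y₁, x₂, y₂, hm, ?_, ?_⟩ <;> rw [hmul]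
  · exact h₁.mul _ (baseChange_smul (AlgebraicClosure K) hD)
  · exact h₂.mul _ (baseChange_smul (AlgebraicClosure K) hD)

/-- Two isomorphisms from `W` to marked fibres differ by an isomorphism between the fibres, so
uniqueness need only be tested on the family itself. -/
lemma isUniversal_of {Lvl : LevelProblem K}
    (hlvl : ∀ t ∈ U, (E t).IsElliptic ∧ ∃ x₁ y₁ h₁ x₂ y₂ h₂,
      Mark t x₁ y₁ x₂ y₂ ∧ Lvl (E t) (.some x₁ y₁ h₁) (.some x₂ y₂ h₂))
    (hex : ∀ W : WeierstrassCurve K, W.IsElliptic → ∀ P Q : GeomPoint W, Lvl W P Q →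
      IsMarkedFibre E U Mark W P Q)
    (huniq : ∀ t ∈ U, ∀ t' ∈ U, ∀ C : VariableChange K, ∀ h : C • E t = E t',
      ∀ x₁ y₁ x₂ y₂ x₁' y₁' x₂' y₂' h₁ h₁' h₂ h₂', Mark t x₁ y₁ x₂ y₂ → Mark t' x₁' y₁' x₂' y₂' →
        (.some x₁ y₁ h₁ : GeomPoint (E t)) = geomHom h (.some x₁' y₁' h₁') →
        (.some x₂ y₂ h₂ : GeomPoint (E t)) = geomHom h (.some x₂' y₂' h₂') → t = t' ∧ C = 1) :
    IsUniversal Lvl E U Mark := by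
  classical
  refine ⟨hlvl, fun W hW P Q hPQ ↦ ?_⟩
  obtain ⟨t, ht, C, hC, x₁, y₁, x₂, y₂, hm, hP, hQ⟩ := hex W hW P Q hPQ
  refine ⟨(t, C), ⟨ht, hC, x₁, y₁, x₂, y₂, hm, hP, hQ⟩, ?_⟩
  rintro ⟨t', C'⟩ ⟨ht', hC', x₁', y₁', x₂', y₂', hm', hP', hQ'⟩
  dsimp only at ht' hC' hm' hP' hQ'
  have h : (C' * C⁻¹) • E t = E t' := by rw [← hC, ← hC', mul_smul, inv_smul_smul]
  have hmul : C' = (C' * C⁻¹) * C := by group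
  generalize C' * C⁻¹ = D at h hmul
  have hCL := baseChange_smul (AlgebraicClosure K) hC
  have hCL' := baseChange_smul (AlgebraicClosure K) hC'
  have hmulL : C'.baseChange (AlgebraicClosure K) =
      D.baseChange (AlgebraicClosure K) * C.baseChange (AlgebraicClosure K) := by
    rw [hmul]
    exact map_mul (VariableChange.mapHom (algebraMap K (AlgebraicClosure K))) D C
  rw [carries_iff hCL] at hP hQ
  rw [carries_iff hCL'] at hP' hQ'
  obtain ⟨h₁, e₁⟩ := hP
  obtain ⟨h₂, e₂⟩ := hQ
  obtain ⟨h₁', e₁'⟩ := hP'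
  obtain ⟨h₂', e₂'⟩ := hQ'
  have key : ∀ P, vcHom hCL' P = vcHom hCL (geomHom h P) := by
    intro P
    have hh := hCL'
    rw [hmulL] at hh
    rw [← vcHom_mul hCL (baseChange_smul (AlgebraicClosure K) h) hh]
    congr!
  rw [key, e₁] at e₁'
  rw [key, e₂] at e₂'
  obtain ⟨rfl, hD⟩ := huniq t ht t' ht' D h x₁ y₁ x₂ y₂ x₁' y₁' x₂' y₂' h₁ h₁' h₂ h₂' hm hm'
    (vcHom_injective hCL e₁') (vcHom_injective hCL e₂')
  rw [hmul, hD, one_mul]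

end Universal

/-! ### Invariance of level structures under isomorphism -/

section Levels

variable {K : Type*} [Field K] {W W' : WeierstrassCurve K} {C : VariableChange K}
  {P Q : GeomPoint W'}

/-- A level structure is described by orders, multiples and Galois action, all of which the
injective homomorphism `geomHom` reflects. -/
lemma level4_of_smul (h : C • W = W') (hl : level4 K W (geomHom h P) (geomHom h Q)) :
    level4 K W' P Q := by
  simpa only [level4, addOrderOf_vcHom, gal_geomHom, ← geomHom_nsmul, ← geomHom_neg,
    (geomHom_injective h).eq_iff,
    (geomHom_injective h).ne_iff] using hl

lemma level82_of_smul (h : C • W = W') (hl : level82 K W (geomHom h P) (geomHom h Q)) :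
    level82 K W' P Q := by
  simpa only [level82, addOrderOf_vcHom, gal_geomHom, ← geomHom_nsmul,
    (geomHom_injective h).eq_iff,
    (geomHom_injective h).ne_iff] using hl

lemma level8412_of_smul (h : C • W = W') (hl : level8412 K W (geomHom h P) (geomHom h Q)) :
    level8412 K W' P Q := by
  simpa only [level8412, addOrderOf_vcHom, gal_geomHom, ← geomHom_nsmul, ← geomHom_add,
    (geomHom_injective h).eq_iff,
    (geomHom_injective h).ne_iff] using hl

end Levels

end TateModular

namespace TateModular

open WeierstrassCurve

/-! ### Tate's normal form and the multiples of its marked point -/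

section Tate

open scoped Classical in
lemma hasTateNormalForms (K : Type*) [Field K] : HasTateNormalForms K := by
  intro W _ P hP h2P h3P
  rcases P with _ | ⟨x, y, h⟩
  · exact absurd rfl hP
  have hA₃ : 2 * y + W.a₁ * x + W.a₃ ≠ 0 := by
    rwa [two_nsmul, ne_eq, add_self_eq_zero_iff] at h2P
  -- `s` is the slope of the tangent at `P`; the division is legitimate because `2P ≠ 0`.
  obtain ⟨s, hs⟩ : ∃ s, 3 * x ^ 2 + 2 * W.a₂ * x + W.a₄ - W.a₁ * y =
      s * (2 * y + W.a₁ * x + W.a₃) := ⟨_, (div_mul_cancel₀ _ hA₃).symm⟩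
  -- After translation and shear, `A` is the new `a₂` and, below, `B` the new `a₃`.
  obtain ⟨A, hA⟩ : ∃ A, A = W.a₂ - s * W.a₁ + 3 * x - s ^ 2 := ⟨_, rfl⟩
  have hA₂ : A ≠ 0 := by
    intro h0
    obtain ⟨h', e⟩ := exists_add_eq_of_tangent s h hA₃ hs rfl rfl
    -- `A = 0` would mean `x(2P) = x(P)`, hence `2P = ±P`, contrary to `P ≠ 0` and `3P ≠ 0`.
    have hx : x = s ^ 2 + W.a₁ * s - W.a₂ - x - x := by linear_combination h0 - hA
    rcases (Affine.Point.X_eq_iff (h₁ := h) (h₂ := h')).1 hx with h1 | h1 <;>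
      rw [← e] at h1
    · exact hP (left_eq_add.1 h1)
    · apply h3P
      rw [succ_nsmul', two_nsmul]
      nth_rw 1 [h1]
      exact neg_add_cancel _
  have heq := h.1
  rw [Affine.equation_iff'] at heq
  obtain ⟨B, hB⟩ : ∃ B, B = 2 * y + W.a₁ * x + W.a₃ := ⟨_, rfl⟩
  rw [← hB] at hA₃ hs
  -- Scaling divides `a₂` by `u²` and `a₃` by `u³`, so they become equal exactly for `u = B / A`.
  refine ⟨((B / A)⁻¹ * (W.a₁ + 2 * s), (B / A)⁻¹ ^ 2 * A,
    ⟨Units.mk0 (B / A) (div_ne_zero hA₃ hA₂), x, s, y⟩), ⟨?_, ?_, ?_⟩, ?_⟩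
  · exact mul_ne_zero (pow_ne_zero _ (inv_ne_zero (div_ne_zero hA₃ hA₂))) hA₂
  · simp only [tate, variableChange_def, Units.val_inv_eq_inv_val, Units.val_mk0]
    ext <;> dsimp only
    · rw [hA]
    · have : W.a₃ + x * W.a₁ + 2 * y = B := by rw [hB]; ring
      rw [this]
      field_simp
    · rw [mul_eq_zero]; right
      linear_combination hs + s * hB
    · rw [mul_eq_zero]; right
      linear_combination -heq
  · refine ⟨?_, ?_⟩ <;> simp [h]
  · rintro ⟨a, b, C⟩ ⟨hb, hC, hc, e⟩
    dsimp only at hb hC hc e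
    obtain ⟨u, r, s', t⟩ := C
    rw [Affine.Point.some.injEq] at e
    simp only [mul_zero, zero_add] at e
    obtain ⟨rfl, rfl⟩ := e
    have hu : (u : K) ≠ 0 := u.ne_zero
    simp only [tate, variableChange_def, Units.val_inv_eq_inv_val, WeierstrassCurve.mk.injEq] at hC
    obtain ⟨e₁, e₂, e₃, e₄, -⟩ := hC
    have e₃' : W.a₃ + x * W.a₁ + 2 * y = B := by rw [hB]; ring
    -- The vanishing of the new `a₄` forces the shear to be along the tangent.
    obtain rfl : s = s' := by
      rw [mul_eq_zero, or_iff_right (pow_ne_zero _ (inv_ne_zero hu))] at e₄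
      apply mul_right_cancel₀ hA₃
      linear_combination e₄ - hs - s' * hB
    rw [← hA] at e₂
    rw [e₃'] at e₃
    have hu' : (u : K) = B / A := by
      rw [← e₂] at e₃
      field_simp at e₃ ⊢
      exact e₃.symm
    obtain rfl : u = Units.mk0 (B / A) (div_ne_zero hA₃ hA₂) := Units.ext hu'
    rw [← e₁, ← e₂]
    simp

lemma tate_Δ {F : Type*} [Field F] (a b : F) : (tate a b).Δ =
    -b ^ 3 * (a ^ 4 - a ^ 3 + 8 * a ^ 2 * b - 36 * a * b + 16 * b ^ 2 + 27 * b) := by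
  simp only [WeierstrassCurve.Δ, WeierstrassCurve.b₂, WeierstrassCurve.b₄, WeierstrassCurve.b₆,
    WeierstrassCurve.b₈, tate]
  ring

variable {F : Type*} [Field F] [DecidableEq F] {a b : F}
  {h : (tate a b).toAffine.Nonsingular 0 0}

lemma tate_two_nsmul (hb : b ≠ 0) :
    ∃ h₂, 2 • (.some 0 0 h : (tate a b).toAffine.Point) = .some (-b) (b * (a - 1)) h₂ := by
  rw [two_nsmul]
  apply exists_add_eq_of_tangent 0 <;> simp [tate, hb]
  ring

lemma tate_three_nsmul (hb : b ≠ 0) :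
    ∃ h₃, 3 • (.some 0 0 h : (tate a b).toAffine.Point) = .some (1 - a) (a - 1 - b) h₃ := by
  obtain ⟨h₂, e⟩ := tate_two_nsmul (a := a) (h := h) hb
  rw [succ_nsmul, e]
  apply exists_add_eq_of_secant (1 - a) <;> simp [tate, hb] <;> ring

/-- The chord through `3P` and `P` has slope `d - 1`, so introducing `d = b/(a-1)` removes all
denominators. -/
lemma tate_four_nsmul (hb : b ≠ 0) {d : F} (hd : b = d * (a - 1)) :
    ∃ h₄, 4 • (.some 0 0 h : (tate a b).toAffine.Point) =
      .some (d ^ 2 - d) (-(d ^ 2 - d) * (d - 1 + a) - b) h₄ := by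
  obtain ⟨h₂, e⟩ := tate_three_nsmul (a := a) (h := h) hb
  have ha : a - 1 ≠ 0 := right_ne_zero_of_mul (hd ▸ hb)
  rw [succ_nsmul, e]
  apply exists_add_eq_of_secant (d - 1)
  · exact fun h0 ↦ ha (by linear_combination -h0)
  · linear_combination -hd
  · simp only [tate]
    linear_combination hd
  · simp only [tate]
    linear_combination -hd

lemma tate_nsmul_ne_zero (hb : b ≠ 0) {n : ℕ} (hn : 0 < n) (hn' : n < 4) :
    n • (.some 0 0 h : (tate a b).toAffine.Point) ≠ 0 := by
  interval_cases n
  · rw [one_nsmul]; exact Affine.Point.some_ne_zero _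
  · obtain ⟨h₂, e⟩ := tate_two_nsmul (a := a) (h := h) hb
    rw [e]; exact Affine.Point.some_ne_zero _
  · obtain ⟨h₂, e⟩ := tate_three_nsmul (a := a) (h := h) hb
    rw [e]; exact Affine.Point.some_ne_zero _

lemma tate_four_nsmul_eq_zero_iff (hb : b ≠ 0) :
    4 • (.some 0 0 h : (tate a b).toAffine.Point) = 0 ↔ a = 1 := by
  obtain ⟨h₃, e⟩ := tate_three_nsmul (a := a) (h := h) hb
  rw [succ_nsmul, e, add_eq_zero_iff_eq_neg, Affine.Point.neg_some, Affine.Point.some.injEq]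
  simp only [Affine.negY, tate]
  constructor
  · rintro ⟨h, -⟩; linear_combination -h
  · rintro rfl; simp

lemma tate_addOrderOf_eq_four_iff (hb : b ≠ 0) :
    addOrderOf (.some 0 0 h : (tate a b).toAffine.Point) = 4 ↔ a = 1 := by
  rw [← tate_four_nsmul_eq_zero_iff (h := h) hb]
  refine ⟨fun h4 ↦ h4 ▸ addOrderOf_nsmul_eq_zero _, fun h4 ↦ ?_⟩
  exact addOrderOf_eq_prime_pow (p := 2) (n := 1)
    (tate_nsmul_ne_zero hb (by norm_num) (by norm_num)) h4

/-- The equation says that `3P` is its own inverse. The order then divides 6, and 1, 2, 3 are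
excluded by `b ≠ 0`. -/
lemma tate_addOrderOf_eq_six_iff (hb : b ≠ 0) :
    addOrderOf (.some 0 0 h : (tate a b).toAffine.Point) = 6 ↔ b = -((a - 1) * (a - 2)) := by
  have h6 : 6 • (.some 0 0 h : (tate a b).toAffine.Point) = 0 ↔ b = -((a - 1) * (a - 2)) := by
    obtain ⟨h₃, e⟩ := tate_three_nsmul (a := a) (h := h) hb
    rw [show 6 = 3 + 3 from rfl, add_nsmul, e, add_self_eq_zero_iff]
    simp only [tate]
    constructor <;> intro h <;> linear_combination -h
  rw [← h6]
  refine ⟨fun h4 ↦ h4 ▸ addOrderOf_nsmul_eq_zero _, fun h4 ↦ ?_⟩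
  have hdvd := addOrderOf_dvd_of_nsmul_eq_zero h4
  have hmem : addOrderOf (.some 0 0 h : (tate a b).toAffine.Point) ∈ Nat.divisors 6 := by
    simpa using hdvd
  have h0 := addOrderOf_nsmul_eq_zero (.some 0 0 h : (tate a b).toAffine.Point)
  have hne := fun n hn hn' ↦ tate_nsmul_ne_zero (h := h) (n := n) hb hn hn'
  rw [show Nat.divisors 6 = {1, 2, 3, 6} from rfl] at hmem
  simp only [Finset.mem_insert, Finset.mem_singleton] at hmem
  rcases hmem with h1 | h1 | h1 | h1
  · rw [h1] at h0; exact absurd h0 (hne 1 (by norm_num) (by norm_num))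
  · rw [h1] at h0; exact absurd h0 (hne 2 (by norm_num) (by norm_num))
  · rw [h1] at h0; exact absurd h0 (hne 3 (by norm_num) (by norm_num))
  · exact h1

/-- `7P = 0` means `4P = -3P`; comparing `x`-coordinates gives `d² - d = 1 - a`, and `t = d`.
Conversely equal `x`-coordinates give `4P = ±3P`, and the plus sign would make `P = 0`. -/
lemma tate_addOrderOf_eq_seven_iff (hb : b ≠ 0) :
    addOrderOf (.some 0 0 h : (tate a b).toAffine.Point) = 7 ↔
      ∃ t, a = 1 + t - t ^ 2 ∧ b = t ^ 2 - t ^ 3 := by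
  obtain ⟨h₃, e₃⟩ := tate_three_nsmul (a := a) (h := h) hb
  constructor
  · intro h7
    -- `a = 1` would give order 4, so `b/(a-1)` makes sense.
    have ha : a - 1 ≠ 0 := by
      intro h0
      have h4 := (tate_addOrderOf_eq_four_iff (h := h) hb).2 (by linear_combination h0)
      omega
    obtain ⟨t, ht⟩ : ∃ t, b = t * (a - 1) := ⟨_, (div_mul_cancel₀ _ ha).symm⟩
    obtain ⟨h₄, e₄⟩ := tate_four_nsmul (a := a) (h := h) hb ht
    have h34 := addOrderOf_nsmul_eq_zero (.some 0 0 h : (tate a b).toAffine.Point)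
    rw [h7, show 7 = 4 + 3 from rfl, add_nsmul, e₃, e₄, add_eq_zero_iff_eq_neg] at h34
    have hx := Affine.Point.X_eq_iff.2 (Or.inr h34)
    have ha' : a = 1 + t - t ^ 2 := by linear_combination hx
    exact ⟨t, ha', by rw [ht, ha']; ring⟩
  · rintro ⟨t, ht⟩
    have hd : b = t * (a - 1) := by rw [ht.1, ht.2]; ring
    obtain ⟨h₄, e₄⟩ := tate_four_nsmul (a := a) (h := h) hb hd
    have := Fact.mk (show Nat.Prime 7 by norm_num)
    refine addOrderOf_eq_prime ?_ (Affine.Point.some_ne_zero _)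
    rw [show 7 = 4 + 3 from rfl, add_nsmul, add_eq_zero_iff_eq_neg]
    have hx := (Affine.Point.X_eq_iff (h₁ := h₄) (h₂ := h₃)).1 (by rw [ht.1]; ring)
    rw [← e₃, ← e₄] at hx
    refine hx.resolve_left fun h0 ↦ Affine.Point.some_ne_zero h ?_
    rwa [succ_nsmul, add_eq_left] at h0

/-- `8P = 0` means that `4P` is its own inverse; the parameter is `k = b/(a-1)`. -/
lemma tate_addOrderOf_eq_eight_iff (hb : b ≠ 0) :
    addOrderOf (.some 0 0 h : (tate a b).toAffine.Point) = 8 ↔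
      ∃ k, k ≠ 0 ∧ a = (-2 * k ^ 2 + 4 * k - 1) / k ∧ b = -2 * k ^ 2 + 3 * k - 1 := by
  constructor
  · intro h8
    have ha : a - 1 ≠ 0 := by
      intro h0
      have h4 := (tate_addOrderOf_eq_four_iff (h := h) hb).2 (by linear_combination h0)
      omega
    obtain ⟨k, hk⟩ : ∃ k, b = k * (a - 1) := ⟨_, (div_mul_cancel₀ _ ha).symm⟩
    have hk0 : k ≠ 0 := left_ne_zero_of_mul (hk ▸ hb)
    obtain ⟨h₄, e₄⟩ := tate_four_nsmul (a := a) (h := h) hb hk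
    have h44 := addOrderOf_nsmul_eq_zero (.some 0 0 h : (tate a b).toAffine.Point)
    rw [h8, show 8 = 4 + 4 from rfl, add_nsmul, e₄, add_self_eq_zero_iff] at h44
    simp only [tate] at h44
    have ha' : a * k = -2 * k ^ 2 + 4 * k - 1 := by
      apply mul_left_cancel₀ hk0
      linear_combination -h44 - hk
    refine ⟨k, hk0, by rw [eq_div_iff hk0, ha'], ?_⟩
    linear_combination hk + ha'
  · rintro ⟨k, hk0, ha, hb'⟩
    rw [eq_div_iff hk0] at ha
    have hk : b = k * (a - 1) := by linear_combination hb' - ha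
    obtain ⟨h₄, e₄⟩ := tate_four_nsmul (a := a) (h := h) hb hk
    refine addOrderOf_eq_prime_pow (p := 2) (n := 2) ?_ ?_
    · rw [show 2 ^ 2 = 4 from rfl, e₄]; exact Affine.Point.some_ne_zero _
    · rw [show 2 ^ (2 + 1) = 4 + 4 from rfl, add_nsmul, e₄, add_self_eq_zero_iff]
      simp only [tate]
      linear_combination -k * ha - hk

end Tate

/-! ### Universal curves with a point of order 4, 6, 7 or 8 -/

section Gamma1

variable {K : Type*} [Field K]

lemma isElliptic_of_Δ_ne_zero {W : WeierstrassCurve K} (h : W.Δ ≠ 0) : W.IsElliptic :=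
  ⟨h.isUnit⟩

lemma Δ_ne_zero_of_isElliptic {W : WeierstrassCurve K} (h : W.IsElliptic) : W.Δ ≠ 0 :=
  h.isUnit.ne_zero

lemma tate_nonsingular {a b : K} (hb : b ≠ 0) : (tate a b).toAffine.Nonsingular 0 0 := by
  rw [Affine.nonsingular_zero]
  simp [tate, hb]

lemma tate_ne_zero_of_Δ_ne_zero {a b : K} (h : (tate a b).Δ ≠ 0) : b ≠ 0 := by
  rintro rfl
  exact h (by rw [tate_Δ]; ring)

open scoped Classical in
-- A point of order at least 4 has a unique Tate form, so universality amounts to the parameter `t`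
-- describing bijectively the pairs `(a, b)` of order `N` with nonzero discriminant.
lemma isUniversalGamma1_of {N : ℕ} (hN : 4 ≤ N) {a b : K → K} {U : Set K}
    (hU : ∀ t ∈ U, (tate (a t) (b t)).Δ ≠ 0)
    (h₁ : ∀ t ∈ U, ∀ h, addOrderOf (.some 0 0 h : (tate (a t) (b t)).toAffine.Point) = N)
    (h₂ : ∀ a' b', (tate a' b').Δ ≠ 0 → ∀ h,
      addOrderOf (.some 0 0 h : (tate a' b').toAffine.Point) = N → ∃ t ∈ U, a' = a t ∧ b' = b t)
    (h₃ : ∀ t ∈ U, ∀ t' ∈ U, a t = a t' → b t = b t' → t = t') :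
    IsUniversalGamma1 N (fun t ↦ tate (a t) (b t)) U := by
  refine ⟨fun t ht ↦ ⟨isElliptic_of_Δ_ne_zero (hU t ht),
    tate_nonsingular (tate_ne_zero_of_Δ_ne_zero (hU t ht)), h₁ t ht _⟩, fun W hW P hP ↦ ?_⟩
  have hne : ∀ n, 0 < n → n < 4 → n • P ≠ 0 := by
    intro n hn hn' h0
    have := Nat.le_of_dvd hn (addOrderOf_dvd_of_nsmul_eq_zero h0)
    omega
  obtain ⟨⟨a', b', C⟩, ⟨hb, hC, hP'⟩, huniq⟩ := hasTateNormalForms K W hW P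
    (by simpa using hne 1 (by norm_num) (by norm_num))
    (hne 2 (by norm_num) (by norm_num)) (hne 3 (by norm_num) (by norm_num))
  dsimp only at hb hC hP'
  have hΔ : (tate a' b').Δ ≠ 0 := by
    rw [← hC]; exact Δ_ne_zero_of_isElliptic inferInstance
  obtain ⟨h, rfl⟩ := (carries_iff hC).1 hP'
  rw [addOrderOf_vcHom] at hP
  obtain ⟨t, ht, rfl, rfl⟩ := h₂ _ _ hΔ h hP
  refine ⟨(t, C), ⟨ht, hC, hP'⟩, ?_⟩
  rintro ⟨t', C'⟩ ⟨ht', hC', hP''⟩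
  have e := huniq (a t', b t', C') ⟨tate_ne_zero_of_Δ_ne_zero (hU t' ht'), hC', hP''⟩
  simp only [Prod.mk.injEq] at e
  rw [Prod.mk.injEq]
  exact ⟨h₃ _ ht' _ ht e.1 e.2.1, e.2.2⟩

open scoped Classical in
lemma isUniversalGamma1_four (K : Type*) [Field K] :
    IsUniversalGamma1 4 E14 {t : K | (E14 t).Δ ≠ 0} := by
  refine isUniversalGamma1_of le_rfl (a := fun _ ↦ 1) (b := fun t ↦ t) (fun t ht ↦ ht) ?_ ?_ ?_
  · exact fun t ht h ↦ (tate_addOrderOf_eq_four_iff (tate_ne_zero_of_Δ_ne_zero ht)).2 rfl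
  · intro a b hΔ h hN
    obtain rfl := (tate_addOrderOf_eq_four_iff (tate_ne_zero_of_Δ_ne_zero hΔ)).1 hN
    exact ⟨b, hΔ, rfl, rfl⟩
  · exact fun t _ t' _ _ h ↦ h

open scoped Classical in
lemma isUniversalGamma1_six (K : Type*) [Field K] :
    IsUniversalGamma1 6 E16 {a : K | (E16 a).Δ ≠ 0} := by
  refine isUniversalGamma1_of (by norm_num) (a := fun a ↦ a) (b := fun a ↦ -((a - 1) * (a - 2)))
    (fun t ht ↦ ht) ?_ ?_ ?_
  · exact fun t ht h ↦ (tate_addOrderOf_eq_six_iff (tate_ne_zero_of_Δ_ne_zero ht)).2 rfl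
  · intro a b hΔ h hN
    obtain rfl := (tate_addOrderOf_eq_six_iff (tate_ne_zero_of_Δ_ne_zero hΔ)).1 hN
    exact ⟨a, hΔ, rfl, rfl⟩
  · exact fun t _ t' _ h _ ↦ h

open scoped Classical in
lemma isUniversalGamma1_seven (K : Type*) [Field K] :
    IsUniversalGamma1 7 E17 {t : K | (E17 t).Δ ≠ 0} := by
  refine isUniversalGamma1_of (by norm_num) (a := fun t ↦ 1 + t - t ^ 2)
    (b := fun t ↦ t ^ 2 - t ^ 3) (fun t ht ↦ ht) ?_ ?_ ?_
  · exact fun t ht h ↦ (tate_addOrderOf_eq_seven_iff (tate_ne_zero_of_Δ_ne_zero ht)).2 ⟨t, rfl, rfl⟩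
  · intro a b hΔ h hN
    obtain ⟨t, rfl, rfl⟩ :=
      (tate_addOrderOf_eq_seven_iff (tate_ne_zero_of_Δ_ne_zero hΔ)).1 hN
    exact ⟨t, hΔ, rfl, rfl⟩
  · intro t ht t' _ h h'
    have hb := tate_ne_zero_of_Δ_ne_zero (a := 1 + t - t ^ 2) (b := t ^ 2 - t ^ 3) ht
    have ha : t - t ^ 2 ≠ 0 := fun h0 ↦ hb (by linear_combination t * h0)
    -- Both parameters equal `b/(a-1)`, where `a - 1 = t - t²`.
    apply mul_right_cancel₀ ha
    linear_combination h' - t' * h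

open scoped Classical in
lemma isUniversalGamma1_eight (K : Type*) [Field K] :
    IsUniversalGamma1 8 E18 {k : K | k ≠ 0 ∧ (E18 k).Δ ≠ 0} := by
  refine isUniversalGamma1_of (by norm_num) (a := fun k ↦ (-2 * k ^ 2 + 4 * k - 1) / k)
    (b := fun k ↦ -2 * k ^ 2 + 3 * k - 1) (fun t ht ↦ ht.2) ?_ ?_ ?_
  · exact fun t ht h ↦ (tate_addOrderOf_eq_eight_iff (tate_ne_zero_of_Δ_ne_zero ht.2)).2
      ⟨t, ht.1, rfl, rfl⟩
  · intro a b hΔ h hN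
    obtain ⟨t, ht, rfl, rfl⟩ :=
      (tate_addOrderOf_eq_eight_iff (tate_ne_zero_of_Δ_ne_zero hΔ)).1 hN
    exact ⟨t, ⟨ht, hΔ⟩, rfl, rfl⟩
  · intro k hk k' hk' h h'
    have hb := tate_ne_zero_of_Δ_ne_zero (a := (-2 * k ^ 2 + 4 * k - 1) / k)
      (b := -2 * k ^ 2 + 3 * k - 1) hk.2
    obtain ⟨a, ha⟩ : ∃ a, a = (-2 * k ^ 2 + 4 * k - 1) / k := ⟨_, rfl⟩
    have ha' := ha
    rw [eq_div_iff hk.1] at ha'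
    rw [← ha, eq_div_iff hk'.1] at h
    have ha1 : a - 1 ≠ 0 := fun h0 ↦ hb (by linear_combination k * h0 - ha')
    apply mul_right_cancel₀ ha1
    linear_combination ha' - h + h'

end Gamma1

end TateModular

namespace TateModular

open WeierstrassCurve

/-! ## Isogenies of degree two -/

section TwoIsogeny

variable {F : Type*} [Field F] {c : F} {W W' : WeierstrassCurve F}

/-- `W : y² = x (x² + a x + b)` and `W' : y² = x (x² - 2 c² a x + c⁴ (a² - 4 b))` are elliptic
curves in characteristic other than two, so that
`(x, y) ↦ (c² y² / x², c³ y (b - x²) / x²)` is an isogeny from `W` to `W'`. -/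
structure IsTwoIsogenous (c : F) (W W' : WeierstrassCurve F) : Prop where
  two_ne_zero : (2 : F) ≠ 0
  scale_ne_zero : c ≠ 0
  a₁ : W.a₁ = 0
  a₃ : W.a₃ = 0
  a₆ : W.a₆ = 0
  a₁' : W'.a₁ = 0
  a₃' : W'.a₃ = 0
  a₆' : W'.a₆ = 0
  a₂' : W'.a₂ = -2 * c ^ 2 * W.a₂
  a₄' : W'.a₄ = c ^ 4 * (W.a₂ ^ 2 - 4 * W.a₄)
  a₄_ne_zero : W.a₄ ≠ 0
  disc_ne_zero : W.a₂ ^ 2 - 4 * W.a₄ ≠ 0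

lemma nonsingular_of_twoTorsionForm (h2 : (2 : F) ≠ 0) (h₁ : W.a₁ = 0) (h₃ : W.a₃ = 0)
    (h₆ : W.a₆ = 0) (h₄ : W.a₄ ≠ 0) (hd : W.a₂ ^ 2 - 4 * W.a₄ ≠ 0) {x y : F}
    (h : y ^ 2 = x * (x ^ 2 + W.a₂ * x + W.a₄)) : W.toAffine.Nonsingular x y := by
  have hΔ : W.Δ = 2 ^ 4 * W.a₄ ^ 2 * (W.a₂ ^ 2 - 4 * W.a₄) := by
    simp only [WeierstrassCurve.Δ, WeierstrassCurve.b₂, WeierstrassCurve.b₄, WeierstrassCurve.b₆,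
      WeierstrassCurve.b₈, h₁, h₃, h₆]
    ring
  have : W.IsElliptic := isElliptic_of_Δ_ne_zero (by
    rw [hΔ]; exact mul_ne_zero (mul_ne_zero (pow_ne_zero _ h2) (pow_ne_zero _ h₄)) hd)
  rw [← Affine.equation_iff_nonsingular, Affine.equation_iff, h₁, h₃, h₆]
  linear_combination h

lemma IsTwoIsogenous.equation (H : IsTwoIsogenous c W W') {x y : F}
    (h : W.toAffine.Nonsingular x y) : y ^ 2 = x * (x ^ 2 + W.a₂ * x + W.a₄) := by
  have h := h.1
  rw [Affine.equation_iff, H.a₁, H.a₃, H.a₆] at h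
  linear_combination h

lemma IsTwoIsogenous.nonsingular (H : IsTwoIsogenous c W W') {x y : F}
    (h : y ^ 2 = x * (x ^ 2 + W.a₂ * x + W.a₄)) : W.toAffine.Nonsingular x y :=
  nonsingular_of_twoTorsionForm H.two_ne_zero H.a₁ H.a₃ H.a₆ H.a₄_ne_zero H.disc_ne_zero h

lemma IsTwoIsogenous.nonsingular' (H : IsTwoIsogenous c W W') {x y : F}
    (h : y ^ 2 = x * (x ^ 2 + W'.a₂ * x + W'.a₄)) : W'.toAffine.Nonsingular x y := by
  refine nonsingular_of_twoTorsionForm H.two_ne_zero H.a₁' H.a₃' H.a₆' ?_ ?_ h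
  · rw [H.a₄']
    exact mul_ne_zero (pow_ne_zero _ H.scale_ne_zero) H.disc_ne_zero
  · have : W'.a₂ ^ 2 - 4 * W'.a₄ = 2 ^ 4 * c ^ 4 * W.a₄ := by rw [H.a₂', H.a₄']; ring
    rw [this]
    exact mul_ne_zero (mul_ne_zero (pow_ne_zero _ H.two_ne_zero)
      (pow_ne_zero _ H.scale_ne_zero)) H.a₄_ne_zero

lemma IsTwoIsogenous.map_nonsingular (H : IsTwoIsogenous c W W') {x y : F}
    (h : W.toAffine.Nonsingular x y) (hx : x ≠ 0) :
    W'.toAffine.Nonsingular (c ^ 2 * y ^ 2 / x ^ 2) (c ^ 3 * y * (W.a₄ - x ^ 2) / x ^ 2) := by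
  apply H.nonsingular'
  have e := H.equation h
  rw [H.a₂', H.a₄']
  -- Eliminating `a₂` by the equation of the curve leaves an identity of rational functions in `x`,
  -- `y`, `a₄`.
  have e' : W.a₂ = y ^ 2 / x ^ 2 - x - W.a₄ / x := by field_simp; linear_combination -e
  rw [e']
  field_simp
  ring

open scoped Classical in
/-- The isogeny of degree two on points. -/
noncomputable def twoIsogFun (H : IsTwoIsogenous c W W') : W.toAffine.Point → W'.toAffine.Point
  | .zero => 0
  | .some x _ h => if hx : x = 0 then 0 else .some _ _ (H.map_nonsingular h hx)

lemma twoIsogFun_zero (H : IsTwoIsogenous c W W') : twoIsogFun H 0 = 0 := rfl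

lemma twoIsogFun_some (H : IsTwoIsogenous c W W') {x y : F} (h : W.toAffine.Nonsingular x y)
    (hx : x ≠ 0) : twoIsogFun H (.some x y h) = .some _ _ (H.map_nonsingular h hx) :=
  dif_neg hx

lemma twoIsogFun_some_of_eq_zero (H : IsTwoIsogenous c W W') {x y : F}
    (h : W.toAffine.Nonsingular x y) (hx : x = 0) : twoIsogFun H (.some x y h) = 0 :=
  dif_pos hx

/-- The kernel of the isogeny of degree two is generated by this point. -/
def IsTwoIsogenous.kerPoint (H : IsTwoIsogenous c W W') : W.toAffine.Point :=
  .some 0 0 (H.nonsingular (by ring))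

lemma twoIsogFun_eq_zero_iff (H : IsTwoIsogenous c W W') (P : W.toAffine.Point) :
    twoIsogFun H P = 0 ↔ P = 0 ∨ P = H.kerPoint := by
  rcases P with _ | ⟨x, y, h⟩
  · exact iff_of_true rfl (Or.inl rfl)
  · rw [or_iff_right (Affine.Point.some_ne_zero h)]
    by_cases hx : x = 0
    · refine iff_of_true (twoIsogFun_some_of_eq_zero H h hx) ?_
      subst hx
      have e := H.equation h
      obtain rfl : y = 0 := by simpa using e
      rfl
    · rw [twoIsogFun_some H h hx]
      refine iff_of_false (Affine.Point.some_ne_zero _) fun h0 ↦ hx ?_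
      exact (Affine.Point.some.inj h0).1

lemma twoIsogFun_neg (H : IsTwoIsogenous c W W') (P : W.toAffine.Point) :
    twoIsogFun H (-P) = -twoIsogFun H P := by
  rcases P with _ | ⟨x, y, h⟩
  · rfl
  · rw [Affine.Point.neg_some]
    by_cases hx : x = 0
    · rw [twoIsogFun_some_of_eq_zero H h hx, twoIsogFun_some_of_eq_zero H _ hx]; rfl
    · rw [twoIsogFun_some H _ hx, twoIsogFun_some H _ hx, Affine.Point.neg_some]
      simp only [Affine.negY, H.a₁, H.a₃, H.a₁', H.a₃', Affine.Point.some.injEq]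
      constructor <;> ring

variable [DecidableEq F]

lemma IsTwoIsogenous.some_add_kerPoint (H : IsTwoIsogenous c W W') {x y : F}
    (h : W.toAffine.Nonsingular x y) (hx : x ≠ 0) :
    ∃ h', .some x y h + H.kerPoint = .some (W.a₄ / x) (-(W.a₄ * y / x ^ 2)) h' := by
  have e := H.equation h
  apply exists_add_eq_of_secant (y / x) _ _ hx
  · field_simp; ring
  · rw [H.a₁]
    have e' : W.a₂ = y ^ 2 / x ^ 2 - x - W.a₄ / x := by field_simp; linear_combination -e
    rw [e']
    field_simp
    ring
  · rw [H.a₁, H.a₃]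
    field_simp
    ring

lemma IsTwoIsogenous.kerPoint_add_self (H : IsTwoIsogenous c W W') :
    H.kerPoint + H.kerPoint = 0 := by
  rw [IsTwoIsogenous.kerPoint, add_self_eq_zero_iff, H.a₃]
  ring

lemma IsTwoIsogenous.neg_kerPoint (H : IsTwoIsogenous c W W') : -H.kerPoint = H.kerPoint :=
  (eq_neg_of_add_eq_zero_left H.kerPoint_add_self).symm

lemma twoIsogFun_add_kerPoint (H : IsTwoIsogenous c W W') (P : W.toAffine.Point) :
    twoIsogFun H (P + H.kerPoint) = twoIsogFun H P := by
  rcases P with _ | ⟨x, y, h⟩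
  · rw [← Affine.Point.zero_def, zero_add, twoIsogFun_zero, twoIsogFun_eq_zero_iff]
    exact Or.inr rfl
  · by_cases hx : x = 0
    · have h0 := (twoIsogFun_some_of_eq_zero H h hx)
      rw [h0]
      rw [twoIsogFun_eq_zero_iff] at h0 ⊢
      rcases h0 with h0 | h0 <;> rw [h0]
      · exact Or.inr (zero_add _)
      · exact Or.inl H.kerPoint_add_self
    · obtain ⟨h', e⟩ := H.some_add_kerPoint h hx
      have hb := H.a₄_ne_zero
      rw [e, twoIsogFun_some H h hx, twoIsogFun_some H h' (div_ne_zero hb hx),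
        Affine.Point.some.injEq]
      constructor
      · field_simp
      · field_simp
        ring

/-- Vieta's relations for the three roots of the cubic obtained by substituting `y = ℓx + ν`. They
express `a₂` and `a₄` through the line and its intersection points, turning addition laws into
rational identities. -/
lemma exists_collinear (ha₁ : W.a₁ = 0) (ha₃ : W.a₃ = 0) (ha₆ : W.a₆ = 0) {x₁ y₁ x₂ y₂ : F}
    (h₁ : W.toAffine.Nonsingular x₁ y₁) (h₂ : W.toAffine.Nonsingular x₂ y₂)
    (hne : (.some x₁ y₁ h₁ : W.toAffine.Point) + .some x₂ y₂ h₂ ≠ 0) :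
    ∃ ℓ ν x₃ h₃, y₁ = ℓ * x₁ + ν ∧ y₂ = ℓ * x₂ + ν ∧ W.a₂ = ℓ ^ 2 - x₁ - x₂ - x₃ ∧
      W.a₄ = x₁ * x₂ + x₁ * x₃ + x₂ * x₃ + 2 * ℓ * ν ∧ ν ^ 2 = x₁ * x₂ * x₃ ∧
      (.some x₁ y₁ h₁ : W.toAffine.Point) + .some x₂ y₂ h₂ = .some x₃ (-(ℓ * x₃ + ν)) h₃ := by
  have hxy : ¬(x₁ = x₂ ∧ y₁ = W.toAffine.negY x₂ y₂) := fun h ↦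
    hne (Affine.Point.add_of_Y_eq h.1 h.2)
  have hp := Affine.addPolynomial_slope h₁.1 h₂.1 hxy
  have hadd := Affine.Point.add_some hxy (h₁ := h₁) (h₂ := h₂)
  have hy₂ : y₂ = W.toAffine.slope x₁ x₂ y₁ y₂ * (x₂ - x₁) + y₁ := by
    by_cases hx : x₁ = x₂
    · have hy : y₁ ≠ W.toAffine.negY x₂ y₂ := fun h ↦ hxy ⟨hx, h⟩
      rw [hx, Affine.Y_eq_of_Y_ne h₁.1 h₂.1 hx hy]
      ring
    · have := sub_ne_zero.2 hx
      rw [Affine.slope_of_X_ne hx]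
      field_simp
      ring
  obtain ⟨ℓ, hℓ⟩ : ∃ ℓ, W.toAffine.slope x₁ x₂ y₁ y₂ = ℓ := ⟨_, rfl⟩
  rw [hℓ] at hp hy₂
  rw [Affine.addPolynomial_eq, neg_inj, Cubic.prod_X_sub_C_eq, Cubic.toPoly_injective] at hp
  obtain ⟨x₃, hx₃⟩ : ∃ x₃, W.toAffine.addX x₁ x₂ ℓ = x₃ := ⟨_, rfl⟩
  simp only [hx₃, Cubic.mk.injEq, ha₁, ha₃, ha₆] at hp
  obtain ⟨-, e₂, e₃, e₄⟩ := hp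
  have hx₃' : W.toAffine.addX x₁ x₂ (W.toAffine.slope x₁ x₂ y₁ y₂) = x₃ := by rw [hℓ, hx₃]
  have hy₃' : W.toAffine.addY x₁ x₂ y₁ (W.toAffine.slope x₁ x₂ y₁ y₂) =
      -(ℓ * x₃ + (y₁ - ℓ * x₁)) := by
    rw [Affine.addY, Affine.negAddY, hx₃', hℓ, Affine.negY, ha₁, ha₃]
    ring
  have h₃ := Affine.nonsingular_add h₁ h₂ hxy
  rw [hx₃', hy₃'] at h₃
  refine ⟨ℓ, y₁ - ℓ * x₁, x₃, h₃, ?_, ?_, ?_, ?_, ?_, ?_⟩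
  · ring
  · rw [hy₂]; ring
  · linear_combination e₂
  · linear_combination e₃
  · linear_combination -e₄
  · rw [hadd, Affine.Point.some.injEq]
    exact ⟨hx₃', hy₃'⟩

lemma twoIsogFun_add_self (H : IsTwoIsogenous c W W') (P : W.toAffine.Point) :
    twoIsogFun H (P + P) = twoIsogFun H P + twoIsogFun H P := by
  rcases P with _ | ⟨x, y, h⟩
  · rfl
  by_cases hx : x = 0
  · have h0 := twoIsogFun_some_of_eq_zero H h hx
    rw [h0, zero_add]
    rcases (twoIsogFun_eq_zero_iff H _).1 h0 with h1 | h1 <;> rw [h1]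
    · rfl
    · rw [H.kerPoint_add_self]; rfl
  by_cases hne : (.some x y h : W.toAffine.Point) + .some x y h = 0
  · rw [hne, twoIsogFun_some H h hx, twoIsogFun_zero, eq_comm, add_self_eq_zero_iff, H.a₁', H.a₃']
    rw [add_self_eq_zero_iff, H.a₁, H.a₃] at hne
    obtain rfl : y = 0 := by simpa [H.two_ne_zero] using hne
    simp
  obtain ⟨ℓ, ν, x₃, h₃, e₁, -, e₂, e₃, e₄, e⟩ := exists_collinear H.a₁ H.a₃ H.a₆ h h hne
  have hy : y ≠ 0 := by
    rintro rfl
    exact hne ((add_self_eq_zero_iff h).2 (by rw [H.a₁, H.a₃]; ring))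
  rw [e, twoIsogFun_some H h hx]
  -- If `2P` generates the kernel, then `ν = 0` and `a₄ = x²`, so the image of `P` has vanishing
  -- `y`-coordinate and doubles to zero.
  by_cases hx₃ : x₃ = 0
  · rw [twoIsogFun_some_of_eq_zero H h₃ hx₃, eq_comm, add_self_eq_zero_iff, H.a₁', H.a₃']
    subst hx₃
    obtain rfl : ν = 0 := by simpa using e₄
    rw [e₃]
    ring
  · rw [twoIsogFun_some H h₃ hx₃]
    have hν : ν ≠ 0 := by
      rintro rfl
      simp [hx, hx₃] at e₄
    -- The tangent at the image point has slope `c(a₄/ν - ℓ)`.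
    obtain ⟨h', e'⟩ := exists_add_eq_of_tangent (c * (W.a₄ / ν - ℓ)) (H.map_nonsingular h hx)
      (x₃ := c ^ 2 * (-(ℓ * x₃ + ν)) ^ 2 / x₃ ^ 2)
      (y₃ := c ^ 3 * (-(ℓ * x₃ + ν)) * (W.a₄ - x₃ ^ 2) / x₃ ^ 2) (by
        rw [H.a₁', H.a₃', zero_mul, add_zero, add_zero]
        refine mul_ne_zero H.two_ne_zero (div_ne_zero (mul_ne_zero (mul_ne_zero
          (pow_ne_zero _ H.scale_ne_zero) hy) ?_) (pow_ne_zero _ hx))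
        intro h0
        have h1 : 2 * (x * x₃ + ℓ * ν) = 0 := by linear_combination h0 - e₃
        have h2 := (mul_eq_zero.1 h1).resolve_left H.two_ne_zero
        have h3 : ν * y = 0 := by rw [e₁]; linear_combination e₄ + x * h2
        exact (mul_ne_zero hν hy) h3) (by
        rw [H.a₂', H.a₄', H.a₁', H.a₃', e₃, e₂, e₁]
        have e₅ : x₃ = ν ^ 2 / (x * x) := by field_simp; linear_combination -e₄
        rw [e₅]
        field_simp
        ring) (by
        rw [H.a₁', H.a₂', e₂, e₃, e₁]
        have e₅ : x₃ = ν ^ 2 / (x * x) := by field_simp; linear_combination -e₄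
        rw [e₅]
        field_simp
        ring) (by
        rw [H.a₁', H.a₃', e₃, e₁]
        have e₅ : x₃ = ν ^ 2 / (x * x) := by field_simp; linear_combination -e₄
        rw [e₅]
        field_simp
        ring)
    exact e'.symm

/-- Once `P`, `Q`, `P + Q` lie outside the kernel and `P` is neither `Q` nor `Q + T`, with `T` the
kernel generator, the images have distinct `x`-coordinates. The chord through them has slope `c(a₄/ν
- ℓ)`, and the Vieta relations of `exists_collinear` verify the sum. -/
lemma twoIsogFun_add (H : IsTwoIsogenous c W W') (P Q : W.toAffine.Point) :
    twoIsogFun H (P + Q) = twoIsogFun H P + twoIsogFun H Q := by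
  by_cases hP : twoIsogFun H P = 0
  · rw [hP, zero_add]
    rcases (twoIsogFun_eq_zero_iff H _).1 hP with rfl | rfl
    · rw [zero_add]
    · rw [add_comm, twoIsogFun_add_kerPoint]
  by_cases hQ : twoIsogFun H Q = 0
  · rw [hQ, add_zero]
    rcases (twoIsogFun_eq_zero_iff H _).1 hQ with rfl | rfl
    · rw [add_zero]
    · rw [twoIsogFun_add_kerPoint]
  by_cases hPQ : twoIsogFun H (P + Q) = 0
  · rw [hPQ, eq_comm]
    rcases (twoIsogFun_eq_zero_iff H _).1 hPQ with h | h
    · rw [eq_neg_of_add_eq_zero_left h, twoIsogFun_neg, neg_add_cancel]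
    · have : P = -Q + H.kerPoint := by rw [← h]; abel
      rw [this, twoIsogFun_add_kerPoint, twoIsogFun_neg, neg_add_cancel]
  by_cases hPQ' : P = Q
  · rw [hPQ', twoIsogFun_add_self]
  by_cases hPQ'' : P = Q + H.kerPoint
  · rw [hPQ'', twoIsogFun_add_kerPoint, ← twoIsogFun_add_self, add_right_comm,
      twoIsogFun_add_kerPoint]
  rcases P with _ | ⟨x₁, y₁, h₁⟩
  · exact absurd rfl hP
  rcases Q with _ | ⟨x₂, y₂, h₂⟩
  · exact absurd rfl hQ
  have hx₁ : x₁ ≠ 0 := fun h ↦ hP (twoIsogFun_some_of_eq_zero H h₁ h)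
  have hx₂ : x₂ ≠ 0 := fun h ↦ hQ (twoIsogFun_some_of_eq_zero H h₂ h)
  obtain ⟨ℓ, ν, x₃, h₃, e₁, e₁', e₂, e₃, e₄, e⟩ := exists_collinear H.a₁ H.a₃ H.a₆ h₁ h₂
    (fun h ↦ hPQ (by rw [h]; rfl))
  rw [e] at hPQ ⊢
  have hx₃ : x₃ ≠ 0 := fun h ↦ hPQ (twoIsogFun_some_of_eq_zero H h₃ h)
  have hν : ν ≠ 0 := by
    rintro rfl
    simp [hx₁, hx₂, hx₃] at e₄
  rw [twoIsogFun_some H h₁ hx₁, twoIsogFun_some H h₂ hx₂, twoIsogFun_some H h₃ hx₃]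
  have hx : x₁ ≠ x₂ := by
    intro h
    rcases (Affine.Point.X_eq_iff (h₁ := h₁) (h₂ := h₂)).1 h with h | h
    · exact hPQ' h
    · rw [h, neg_add_cancel] at e
      exact Affine.Point.some_ne_zero _ e.symm
  -- Since `x(Q + T) = a₄/x₂`, equality would give `P = ±(Q + T)`, and the minus sign would put `P +
  -- Q` in the kernel.
  have hx' : x₁ * x₂ ≠ W.a₄ := by
    intro h
    obtain ⟨h₄, e'⟩ := H.some_add_kerPoint h₂ hx₂
    rcases (Affine.Point.X_eq_iff (h₁ := h₁) (h₂ := h₄)).1 (by field_simp; exact h) with h | h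
    · exact hPQ'' (h.trans e'.symm)
    · rw [← e'] at h
      rw [h, neg_add_rev, H.neg_kerPoint, add_assoc, neg_add_cancel, add_zero,
        IsTwoIsogenous.kerPoint] at e
      exact hx₃ (Affine.Point.some.inj e).1.symm
  have e₅ : x₃ = ν ^ 2 / (x₁ * x₂) := by field_simp; linear_combination -e₄
  obtain ⟨h', e'⟩ := exists_add_eq_of_secant (c * (W.a₄ / ν - ℓ)) (H.map_nonsingular h₁ hx₁)
    (H.map_nonsingular h₂ hx₂)
    (x₃ := c ^ 2 * (-(ℓ * x₃ + ν)) ^ 2 / x₃ ^ 2)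
    (y₃ := c ^ 3 * (-(ℓ * x₃ + ν)) * (W.a₄ - x₃ ^ 2) / x₃ ^ 2) (by
      intro h0
      have q₁ : y₁ ^ 2 / x₁ ^ 2 = x₁ + W.a₂ + W.a₄ / x₁ := by
        have := H.equation h₁
        field_simp
        linear_combination this
      have q₂ : y₂ ^ 2 / x₂ ^ 2 = x₂ + W.a₂ + W.a₄ / x₂ := by
        have := H.equation h₂
        field_simp
        linear_combination this
      rw [mul_div_assoc, mul_div_assoc] at h0
      have h1 := mul_left_cancel₀ (pow_ne_zero 2 H.scale_ne_zero) h0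
      rw [q₁, q₂] at h1
      field_simp at h1
      have h2 : (x₁ - x₂) * (x₁ * x₂ - W.a₄) = 0 := by linear_combination h1
      exact (mul_ne_zero (sub_ne_zero.2 hx) (sub_ne_zero.2 hx')) h2) (by
      rw [e₃, e₁, e₁', e₅]
      field_simp
      ring) (by
      rw [H.a₁', H.a₂', e₂, e₃, e₁, e₁', e₅]
      field_simp
      ring) (by
      rw [H.a₁', H.a₃', e₃, e₁, e₅]
      field_simp
      ring)
  exact e'.symm

/-- The isogeny of degree two as a homomorphism of groups of points. -/
noncomputable def twoIsog (H : IsTwoIsogenous c W W') : W.toAffine.Point →+ W'.toAffine.Point where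
  toFun := twoIsogFun H
  map_zero' := rfl
  map_add' := twoIsogFun_add H

lemma twoIsog_some (H : IsTwoIsogenous c W W') {x y : F} (h : W.toAffine.Nonsingular x y)
    (hx : x ≠ 0) : twoIsog H (.some x y h) = .some _ _ (H.map_nonsingular h hx) :=
  twoIsogFun_some H h hx

lemma twoIsog_eq_zero_iff (H : IsTwoIsogenous c W W') (P : W.toAffine.Point) :
    twoIsog H P = 0 ↔ P = 0 ∨ P = H.kerPoint :=
  twoIsogFun_eq_zero_iff H P

/-- Look for a preimage of the form `(x, wx)` with `c²w² = X`. Then `x` and `a₄/x` are the two roots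
of a quadratic with sum `w² - a₂`, and `Y` prescribes their difference `z`. Above `X = 0` lies a
point of order two outside the kernel. -/
lemma twoIsog_surjective [IsAlgClosed F] (H : IsTwoIsogenous c W W') :
    Function.Surjective (twoIsog H) := by
  have hc := H.scale_ne_zero
  have h2 := H.two_ne_zero
  have hb := H.a₄_ne_zero
  rintro (_ | ⟨X, Y, h⟩)
  · exact ⟨0, rfl⟩
  have hE := h.1
  rw [Affine.equation_iff, H.a₁', H.a₃', H.a₆', H.a₂', H.a₄'] at hE
  by_cases hX : X = 0
  · subst hX
    obtain rfl : Y = 0 := by simpa using hE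
    obtain ⟨d, hd⟩ := IsAlgClosed.exists_pow_nat_eq (W.a₂ ^ 2 - 4 * W.a₄) (n := 2) (by norm_num)
    obtain ⟨x, hx⟩ : ∃ x, x = (d - W.a₂) / 2 := ⟨_, rfl⟩
    rw [eq_div_iff h2] at hx
    have hx' : x ^ 2 + W.a₂ * x + W.a₄ = 0 := by
      apply mul_left_cancel₀ (pow_ne_zero 2 h2)
      linear_combination (2 * x + d + W.a₂) * hx + hd
    have hx0 : x ≠ 0 := by
      rintro rfl
      exact hb (by linear_combination hx')
    refine ⟨.some x 0 (H.nonsingular (by rw [hx']; ring)), ?_⟩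
    rw [twoIsog_some H _ hx0, Affine.Point.some.injEq]
    constructor <;> simp
  · obtain ⟨w, hw⟩ := IsAlgClosed.exists_pow_nat_eq (X / c ^ 2) (n := 2) (by norm_num)
    rw [eq_div_iff (pow_ne_zero _ hc)] at hw
    have hw0 : w ≠ 0 := by
      rintro rfl
      exact hX (by linear_combination -hw)
    obtain ⟨x, hx⟩ : ∃ x, x = (w ^ 2 - W.a₂ - Y / (c ^ 3 * w)) / 2 := ⟨_, rfl⟩
    obtain ⟨z, hz⟩ : ∃ z, z = Y / (c ^ 3 * w) := ⟨_, rfl⟩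
    rw [← hz, eq_div_iff h2] at hx
    rw [eq_div_iff (mul_ne_zero (pow_ne_zero _ hc) hw0)] at hz
    have hz2 : z ^ 2 = w ^ 4 - 2 * W.a₂ * w ^ 2 + (W.a₂ ^ 2 - 4 * W.a₄) := by
      have : c ^ 6 * w ^ 2 ≠ 0 := mul_ne_zero (pow_ne_zero _ hc) (pow_ne_zero _ hw0)
      apply mul_left_cancel₀ this
      rw [← hw, ← hz] at hE
      linear_combination hE
    have hprod : x * (w ^ 2 - W.a₂ - x) = W.a₄ := by
      apply mul_left_cancel₀ (pow_ne_zero 2 h2)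
      linear_combination (2 * (w ^ 2 - W.a₂ - x) - (w ^ 2 - W.a₂ - z)) * hx - hz2
    have hx0 : x ≠ 0 := by
      rintro rfl
      exact hb (by linear_combination -hprod)
    refine ⟨.some x (w * x) (H.nonsingular (by linear_combination x * hprod)), ?_⟩
    rw [twoIsog_some H _ hx0, Affine.Point.some.injEq]
    constructor
    · field_simp
      linear_combination hw
    · rw [← hprod, ← hz]
      field_simp
      linear_combination -hx

end TwoIsogeny

end TateModular

namespace TateModular

open WeierstrassCurve

/-! ### Points of order two and halving on `y² = x(x² + ax + b)` -/

section TwoTorsionPoint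

variable {F : Type*} [Field F] {c : F} {W W' : WeierstrassCurve F}

lemma form_equation (ha₁ : W.a₁ = 0) (ha₃ : W.a₃ = 0) (ha₆ : W.a₆ = 0) {x y : F}
    (h : W.toAffine.Nonsingular x y) : y ^ 2 = x * (x ^ 2 + W.a₂ * x + W.a₄) := by
  have h := h.1
  rw [Affine.equation_iff, ha₁, ha₃, ha₆] at h
  linear_combination h

variable [DecidableEq F]

/-- The point of order two at the origin of the target of the isogeny of degree two. -/
def IsTwoIsogenous.origin (H : IsTwoIsogenous c W W') : W'.toAffine.Point :=
  .some 0 0 (H.nonsingular' (by ring))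

/-- For `x ≠ 0` the image has first coordinate zero exactly when `y = 0`. -/
lemma twoIsog_eq_origin_iff (H : IsTwoIsogenous c W W') (P : W.toAffine.Point) :
    twoIsog H P = H.origin ↔ 2 • P = 0 ∧ P ≠ 0 ∧ P ≠ H.kerPoint := by
  rw [← not_or, ← twoIsog_eq_zero_iff H, two_nsmul]
  rcases P with _ | ⟨x, y, h⟩
  · rw [← Affine.Point.zero_def, map_zero]
    exact iff_of_false (Affine.Point.some_ne_zero _).symm (by simp)
  · rw [add_self_eq_zero_iff, H.a₁, H.a₃]
    by_cases hx : x = 0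
    · have h0 : twoIsog H (.some x y h) = 0 := twoIsogFun_some_of_eq_zero H h hx
      rw [h0]
      exact iff_of_false (Affine.Point.some_ne_zero _).symm (by simp)
    · rw [twoIsog_some H h hx, IsTwoIsogenous.origin, Affine.Point.some.injEq]
      constructor
      · rintro ⟨h0, -⟩
        have : y = 0 := by simpa [H.scale_ne_zero, hx] using h0
        exact ⟨by rw [this]; ring, Affine.Point.some_ne_zero _⟩
      · rintro ⟨h0, -⟩
        have : y = 0 := by simpa [H.two_ne_zero] using h0
        simp [this]

lemma two_nsmul_eq_zero_iff_of_form (h2 : (2 : F) ≠ 0) (ha₁ : W.a₁ = 0) (ha₃ : W.a₃ = 0)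
    {x y : F} (h : W.toAffine.Nonsingular x y) :
    2 • (.some x y h : W.toAffine.Point) = 0 ↔ y = 0 := by
  rw [two_nsmul, add_self_eq_zero_iff, ha₁, ha₃]
  simp [h2]

/-- The tangent passes through the origin, so `ν = 0` and `x₃ = 0` in the Vieta relations. -/
lemma sq_eq_of_two_nsmul_eq_origin (ha₁ : W.a₁ = 0) (ha₃ : W.a₃ = 0) (ha₆ : W.a₆ = 0)
    {x y : F} {h : W.toAffine.Nonsingular x y} {h' : W.toAffine.Nonsingular 0 0}
    (e : 2 • (.some x y h : W.toAffine.Point) = .some 0 0 h') : x ^ 2 = W.a₄ := by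
  rw [two_nsmul] at e
  obtain ⟨ℓ, ν, x₃, h₃, -, -, -, e₂, -, e₄⟩ := exists_collinear ha₁ ha₃ ha₆ h h
    (by rw [e]; exact Affine.Point.some_ne_zero _)
  rw [e, Affine.Point.some.injEq] at e₄
  obtain ⟨rfl, e₄⟩ := e₄
  linear_combination -e₂ - 2 * ℓ * e₄

/-- The tangent passes through `(d, 0)`, so `ν = -ℓd`; then `ν² = x²d` gives `ℓ²d = x²`, which is
substituted into the relation for `a₄`. -/
lemma sq_add_eq_of_two_nsmul_eq (ha₁ : W.a₁ = 0) (ha₃ : W.a₃ = 0) (ha₆ : W.a₆ = 0)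
    {x y d : F} {h : W.toAffine.Nonsingular x y} {h' : W.toAffine.Nonsingular d 0} (hd : d ≠ 0)
    (e : 2 • (.some x y h : W.toAffine.Point) = .some d 0 h') : x ^ 2 + W.a₄ = 2 * d * x := by
  rw [two_nsmul] at e
  obtain ⟨ℓ, ν, x₃, h₃, -, -, -, e₂, e₃, e₄⟩ := exists_collinear ha₁ ha₃ ha₆ h h
    (by rw [e]; exact Affine.Point.some_ne_zero _)
  rw [e, Affine.Point.some.injEq] at e₄
  obtain ⟨rfl, e₄⟩ := e₄
  have : ν = -(ℓ * d) := by linear_combination e₄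
  subst this
  have e₅ : ℓ ^ 2 * d = x ^ 2 := mul_right_cancel₀ hd (by linear_combination e₃)
  linear_combination e₂ - 2 * e₅

end TwoTorsionPoint

/-! ### Discriminants and a two-torsion model of `E₁(8)` -/

section Forms

variable {K : Type*} [Field K] {a b a' b' : K}

lemma twoTorsionForm_Δ (a b : K) : (twoTorsionForm a b).Δ = 2 ^ 4 * b ^ 2 * (a ^ 2 - 4 * b) := by
  simp only [WeierstrassCurve.Δ, WeierstrassCurve.b₂, WeierstrassCurve.b₄, WeierstrassCurve.b₆,
    WeierstrassCurve.b₈, twoTorsionForm]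
  ring

lemma twoTorsionForm_ne_zero (h : (twoTorsionForm a b).Δ ≠ 0) :
    (2 : K) ≠ 0 ∧ b ≠ 0 ∧ a ^ 2 - 4 * b ≠ 0 := by
  rw [twoTorsionForm_Δ] at h
  exact ⟨fun h0 ↦ h (by rw [h0]; ring), fun h0 ↦ h (by rw [h0]; ring),
    fun h0 ↦ h (by rw [h0]; ring)⟩

lemma twoTorsionForm_Δ_ne_zero (h2 : (2 : K) ≠ 0) (hb : b ≠ 0) (hd : a ^ 2 - 4 * b ≠ 0) :
    (twoTorsionForm a b).Δ ≠ 0 := by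
  rw [twoTorsionForm_Δ]
  exact mul_ne_zero (mul_ne_zero (pow_ne_zero _ h2) (pow_ne_zero _ hb)) hd

/-- Applied with `c = 1` to the quotient maps and with `c = 1/2` to the dual isogenies. -/
lemma isTwoIsogenous_baseChange (L : Type*) [Field L] [Algebra K L] {c : K} (hc : c ≠ 0)
    (h : (twoTorsionForm a b).Δ ≠ 0) (ha : a' = -2 * c ^ 2 * a)
    (hb : b' = c ^ 4 * (a ^ 2 - 4 * b)) :
    IsTwoIsogenous (algebraMap K L c) ((twoTorsionForm a b).baseChange L)
      ((twoTorsionForm a' b').baseChange L) := by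
  obtain ⟨h2, hb0, hd⟩ := twoTorsionForm_ne_zero h
  have hne : ∀ x : K, x ≠ 0 → algebraMap K L x ≠ 0 := fun x hx ↦ (map_ne_zero _).2 hx
  refine ⟨?_, hne c hc, map_zero _, map_zero _, map_zero _, map_zero _, map_zero _, map_zero _,
    ?_, ?_, hne b hb0, ?_⟩
  · rw [← map_ofNat (algebraMap K L) 2]; exact hne _ h2
  · simp only [WeierstrassCurve.baseChange, map_a₂, twoTorsionForm, ha, map_mul, map_pow, map_neg,
      map_ofNat]
  · simp only [WeierstrassCurve.baseChange, map_a₂, map_a₄, twoTorsionForm, hb, map_mul, map_pow,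
      map_sub, map_ofNat]
  · have := hne _ hd
    rwa [map_sub, map_mul, map_pow, map_ofNat] at this

lemma twoTorsionForm_nonsingular (h : (twoTorsionForm a b).Δ ≠ 0) {x y : K}
    (hxy : y ^ 2 = x * (x ^ 2 + a * x + b)) : (twoTorsionForm a b).toAffine.Nonsingular x y := by
  obtain ⟨h2, hb0, hd⟩ := twoTorsionForm_ne_zero h
  exact nonsingular_of_twoTorsionForm h2 rfl rfl rfl hb0 hd hxy

lemma nonsingular_algebraMap {L : Type*} [Field L] [Algebra K L] {W : WeierstrassCurve K} {x y : K}
    (h : W.toAffine.Nonsingular x y) :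
    (W.baseChange L).toAffine.Nonsingular (algebraMap K L x) (algebraMap K L y) :=
  (Affine.map_nonsingular (W := W) (algebraMap K L).injective x y).2 h

lemma nonsingular_origin {W : WeierstrassCurve K} {L : Type*} [Field L] [Algebra K L]
    (h : W.toAffine.Nonsingular 0 0) : (W.baseChange L).toAffine.Nonsingular 0 0 := by
  simpa using nonsingular_algebraMap (L := L) h

/-- The curve `y² = x (x² + α x + β)` isomorphic to `E₁(8)`. -/
def E18Form (k : K) : WeierstrassCurve K :=
  twoTorsionForm (8 * k ^ 4 - 16 * k ^ 3 + 16 * k ^ 2 - 8 * k + 1) ((2 * k * (k - 1)) ^ 4)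

/-- The change of variables from `E18Form k` to `E18 k`. -/
def E18Change (k : K) (hk : 2 * k ≠ 0) : VariableChange K :=
  ⟨Units.mk0 (2 * k) hk, 4 * k ^ 3 * (1 - k), -(2 * k ^ 2 - 4 * k + 1),
    -4 * k ^ 3 * (2 * k - 1) * (k - 1)⟩

lemma E18Change_smul (k : K) (hk : 2 * k ≠ 0) : E18Change k hk • E18Form k = E18 k := by
  have h2 : (2 : K) ≠ 0 := left_ne_zero_of_mul hk
  have hk0 : k ≠ 0 := right_ne_zero_of_mul hk
  simp only [E18, tate, variableChange_def, E18Form, E18Change, twoTorsionForm,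
    Units.val_inv_eq_inv_val, Units.val_mk0]
  ext <;> dsimp only <;> field_simp <;> ring

lemma E8412_Δ (k : K) : (E8412 k).Δ = 2 ^ 4 * ((8 * k ^ 2 - 8 * k + 1) * (2 * k - 1) ^ 4) ^ 2 *
    (2 ^ 4 * (2 * k * (k - 1)) ^ 4) := by
  rw [E8412, twoTorsionForm_Δ]
  ring

lemma E18_Δ (k : K) (hk : k ≠ 0) : (E18 k).Δ =
    (k - 1) ^ 8 * (2 * k - 1) ^ 4 * (8 * k ^ 2 - 8 * k + 1) / k ^ 4 := by
  rw [E18, tate_Δ]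
  field_simp
  ring

lemma E18Form_Δ (k : K) : (E18Form k).Δ = 2 ^ 4 * ((2 * k * (k - 1)) ^ 4) ^ 2 *
    ((8 * k ^ 2 - 8 * k + 1) * (2 * k - 1) ^ 4) := by
  rw [E18Form, twoTorsionForm_Δ]
  ring

lemma E8412_ne_zero {k : K} (h : (E8412 k).Δ ≠ 0) : (2 : K) ≠ 0 ∧ k ≠ 0 ∧ k - 1 ≠ 0 ∧
    2 * k - 1 ≠ 0 ∧ 8 * k ^ 2 - 8 * k + 1 ≠ 0 := by
  rw [E8412_Δ] at h
  refine ⟨?_, ?_, ?_, ?_, ?_⟩ <;> intro h0 <;> apply h <;> rw [h0] <;> ring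

lemma E18Form_Δ_ne_zero {k : K} (h : (E8412 k).Δ ≠ 0) : (E18Form k).Δ ≠ 0 := by
  obtain ⟨h2, h₁, h₃, h₄, h₅⟩ := E8412_ne_zero h
  rw [E18Form_Δ]
  positivity

lemma E18_Δ_ne_zero {k : K} (h : (E8412 k).Δ ≠ 0) : (E18 k).Δ ≠ 0 := by
  obtain ⟨h2, h₁, h₃, h₄, h₅⟩ := E8412_ne_zero h
  rw [E18_Δ k h₁]
  positivity

end Forms

section E18

variable {K : Type*} [Field K]

lemma E18_nonsingular_zero {k : K} (h : (E18 k).Δ ≠ 0) : (E18 k).toAffine.Nonsingular 0 0 :=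
  tate_nonsingular (tate_ne_zero_of_Δ_ne_zero h)

lemma E18_four_nsmul [DecidableEq K] {k : K} (hk : k ≠ 0) (h : (E18 k).Δ ≠ 0)
    (hO : (E18 k).toAffine.Nonsingular 0 0) :
    ∃ h₄, 4 • (.some 0 0 hO : (E18 k).toAffine.Point) =
      .some (k ^ 2 - k) (k * (k - 1) ^ 2) h₄ := by
  obtain ⟨h₄, e₄⟩ := tate_four_nsmul (h := hO) (d := k) (tate_ne_zero_of_Δ_ne_zero h)
    (by field_simp; ring)
  have : -(k ^ 2 - k) * (k - 1 + (-2 * k ^ 2 + 4 * k - 1) / k) - (-2 * k ^ 2 + 3 * k - 1) =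
    k * (k - 1) ^ 2 := by field_simp; ring
  simp only [this] at e₄ h₄
  exact ⟨h₄, e₄⟩

end E18

section ToGeom

variable {K : Type*} [Field K] {W : WeierstrassCurve K}

open scoped Classical in
/-- The inclusion of the rational points in the geometric points. -/
noncomputable def toGeom : W.toAffine.Point →+ GeomPoint W :=
  Affine.Point.map (W' := W) (Algebra.ofId K (AlgebraicClosure K))

open scoped Classical in
lemma toGeom_some {x y : K} (h : W.toAffine.Nonsingular x y) :
    toGeom (.some x y h : W.toAffine.Point) = .some _ _ (nonsingular_algebraMap h) := rfl

open scoped Classical in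
lemma toGeom_injective : Function.Injective (toGeom : W.toAffine.Point →+ GeomPoint W) :=
  Affine.Point.map_injective (W' := W) _

end ToGeom

/-! ### Quotients by a section of order two -/

section Quotient

variable {K : Type*} [Field K]

open scoped Classical in
-- The isogeny is the isomorphism from `W` to `V` followed by `(x, y) ↦ (y²/x², y(a₄ - x²)/x²)`; the
-- common denominator is the square of the `x`-coordinate on `V`.
lemma isQuotientByTwoTorsion_of {V V' W : WeierstrassCurve K} {C : VariableChange K}
    (h : C • V = W) (H : IsTwoIsogenous 1 (V⁄(AlgebraicClosure K)) (V'⁄(AlgebraicClosure K)))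
    {S : GeomPoint W} (hS : geomHom h S = H.kerPoint) : IsQuotientByTwoTorsion W V' S := by
  refine ⟨?_, (twoIsog H).comp (geomHom h), (twoIsog_surjective H).comp (geomHom_surjective h),
    fun P ↦ ?_, (MvPolynomial.C ((C.u : K) ^ 3) * MvPolynomial.X 1 +
      MvPolynomial.C ((C.u : K) ^ 2 * C.s) * MvPolynomial.X 0 + MvPolynomial.C C.t) ^ 2,
    (MvPolynomial.C ((C.u : K) ^ 3) * MvPolynomial.X 1 +
      MvPolynomial.C ((C.u : K) ^ 2 * C.s) * MvPolynomial.X 0 + MvPolynomial.C C.t) *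
      (MvPolynomial.C V.a₄ - (MvPolynomial.C ((C.u : K) ^ 2) * MvPolynomial.X 0 +
        MvPolynomial.C C.r) ^ 2),
    (MvPolynomial.C ((C.u : K) ^ 2) * MvPolynomial.X 0 + MvPolynomial.C C.r) ^ 2,
    fun x y hxy hne ↦ ?_⟩
  · rw [← addOrderOf_vcHom (baseChange_smul (AlgebraicClosure K) h), hS]
    have := Fact.mk Nat.prime_two
    refine addOrderOf_eq_prime ?_ (Affine.Point.some_ne_zero _)
    rw [two_nsmul, H.kerPoint_add_self]
  · rw [AddMonoidHom.comp_apply, twoIsog_eq_zero_iff, ← hS, (geomHom_injective h).eq_iff,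
      map_eq_zero_iff _ (geomHom_injective h)]
  · rw [AddMonoidHom.comp_apply, vcHom_some] at hne ⊢
    have hx := fun h0 ↦ hne (twoIsogFun_some_of_eq_zero H
      (nonsingular_of_variableChange (baseChange_smul (AlgebraicClosure K) h) hxy) h0)
    have hx' : algebraMap K (AlgebraicClosure K) C.u ^ 2 * x +
        algebraMap K (AlgebraicClosure K) C.r ≠ 0 := hx
    have e₁ : MvPolynomial.aeval ![x, y]
        (MvPolynomial.C ((C.u : K) ^ 2) * MvPolynomial.X 0 + MvPolynomial.C C.r) =
        algebraMap K (AlgebraicClosure K) C.u ^ 2 * x + algebraMap K (AlgebraicClosure K) C.r := by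
      simp
    have e₂ : MvPolynomial.aeval ![x, y] (MvPolynomial.C ((C.u : K) ^ 3) * MvPolynomial.X 1 +
        MvPolynomial.C ((C.u : K) ^ 2 * C.s) * MvPolynomial.X 0 + MvPolynomial.C C.t) =
        algebraMap K (AlgebraicClosure K) C.u ^ 3 * y + algebraMap K (AlgebraicClosure K) C.u ^ 2 *
          algebraMap K (AlgebraicClosure K) C.s * x + algebraMap K (AlgebraicClosure K) C.t := by
      simp
    refine ⟨by rw [map_pow, e₁]; exact pow_ne_zero 2 hx', ?_⟩
    rw [twoIsog_some H _ hx]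
    have e₃ : MvPolynomial.aeval ![x, y] (MvPolynomial.C V.a₄ : MvPolynomial (Fin 2) K) =
      (V⁄(AlgebraicClosure K)).a₄ := by simp
    simp only [map_mul (MvPolynomial.aeval _), map_pow (MvPolynomial.aeval _),
      map_sub (MvPolynomial.aeval _), e₁, e₂, e₃]
    have key : ∀ {X Y X' Y' : AlgebraicClosure K}
        (hX : (V'⁄(AlgebraicClosure K)).toAffine.Nonsingular X Y), X = X' → Y = Y' →
        ∃ h', (Affine.Point.some X Y hX : GeomPoint V') = .some X' Y' h' := by
      rintro X Y _ _ hX rfl rfl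
      exact ⟨hX, rfl⟩
    apply key
    · simp [VariableChange.baseChange]
    · simp [VariableChange.baseChange]

open scoped Classical in
-- `E18Form` is `E18` with `4·(0, 0)` moved to the origin, where the standard isogeny of degree two
-- has its kernel.
lemma E8412_isQuotient {k : K} (h : (E8412 k).Δ ≠ 0) :
    ∃ h, IsQuotientByTwoTorsion (E18 k) (E8412 k) (mulPoint 4 (.some 0 0 h)) := by
  obtain ⟨h2, h₁, h₃, h₄, h₅⟩ := E8412_ne_zero h
  have H : IsTwoIsogenous (algebraMap K _ 1) ((E18Form k)⁄(AlgebraicClosure K))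
      ((E8412 k)⁄(AlgebraicClosure K)) :=
    isTwoIsogenous_baseChange (AlgebraicClosure K) one_ne_zero (E18Form_Δ_ne_zero h)
      (by ring) (by ring)
  rw [map_one] at H
  have hO := E18_nonsingular_zero (E18_Δ_ne_zero h)
  refine ⟨nonsingular_origin hO, ?_⟩
  have hk : 2 * k ≠ 0 := mul_ne_zero h2 h₁
  refine isQuotientByTwoTorsion_of (E18Change_smul k hk) H ?_
  obtain ⟨h₄, e₄⟩ := E18_four_nsmul h₁ (E18_Δ_ne_zero h) hO
  have e := congrArg toGeom e₄
  have e₀ : toGeom (W := E18 k) (.some 0 0 hO) = .some 0 0 (nonsingular_origin hO) := by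
    simp [toGeom_some]
  rw [map_nsmul, e₀, toGeom_some] at e
  rw [mulPoint, e, vcHom_some, IsTwoIsogenous.kerPoint, Affine.Point.some.injEq]
  simp only [VariableChange.baseChange, VariableChange.map_u, VariableChange.map_r,
    VariableChange.map_s, VariableChange.map_t, Units.coe_map, MonoidHom.coe_coe, ← map_pow,
    ← map_mul, ← map_add, map_eq_zero, E18Change, Units.val_mk0]
  constructor <;> ring

lemma E82_Δ {σ : K} (hσ : σ ≠ 0) (h2 : (2 : K) ≠ 0) :
    (E82 σ).Δ = (σ - σ⁻¹) ^ 8 * (σ + σ⁻¹) ^ 2 / 4 := by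
  have h4 : (4 : K) ≠ 0 := by rw [show (4 : K) = 2 * 2 by norm_num]; exact mul_ne_zero h2 h2
  have h16 : (16 : K) ≠ 0 := by rw [show (16 : K) = 4 * 4 by norm_num]; exact mul_ne_zero h4 h4
  rw [E82, twoTorsionForm_Δ]
  field_simp
  ring

lemma E4_Δ (σ : K) : (E4 σ).Δ = 2 ^ 4 * lam σ ^ 2 * (1 - lam σ) ^ 2 := by
  rw [E4, twoTorsionForm_Δ]
  ring

lemma E4_nonsingular_zero {σ : K} (h : (E4 σ).Δ ≠ 0) : (E4 σ).toAffine.Nonsingular 0 0 :=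
  twoTorsionForm_nonsingular h (by ring)

lemma one_sub_lam [CharZero K] {σ : K} (hσ : σ ≠ 0) : 1 - lam σ = -(σ - σ⁻¹) ^ 2 / 4 := by
  rw [lam]
  field_simp
  ring

lemma E4_Δ_ne_zero_iff [CharZero K] {σ : K} (hσ : σ ≠ 0) :
    (E4 σ).Δ ≠ 0 ↔ σ ^ 2 + 1 ≠ 0 ∧ σ ^ 2 - 1 ≠ 0 := by
  have : (E4 σ).Δ = (σ ^ 2 + 1) ^ 4 * (σ ^ 2 - 1) ^ 4 / (2 ^ 4 * σ ^ 8) := by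
    rw [E4_Δ, one_sub_lam hσ, lam]
    field_simp
    ring
  rw [this]
  simp [hσ]

lemma E82_Δ_ne_zero_iff [CharZero K] {σ : K} (hσ : σ ≠ 0) :
    (E82 σ).Δ ≠ 0 ↔ σ ^ 2 + 1 ≠ 0 ∧ σ ^ 2 - 1 ≠ 0 := by
  have : (E82 σ).Δ = (σ ^ 2 - 1) ^ 8 * (σ ^ 2 + 1) ^ 2 / (4 * σ ^ 10) := by
    rw [E82_Δ hσ two_ne_zero]
    field_simp
  rw [this]
  simp [hσ, and_comm]

open scoped Classical in
lemma E82_isQuotient [CharZero K] {σ : K} (hσ : σ ≠ 0) (h : (E82 σ).Δ ≠ 0) :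
    ∃ h, IsQuotientByTwoTorsion (E4 σ) (E82 σ) (.some 0 0 h) := by
  have h4 := (E4_Δ_ne_zero_iff hσ).2 ((E82_Δ_ne_zero_iff hσ).1 h)
  have H : IsTwoIsogenous (algebraMap K _ 1) ((E4 σ)⁄(AlgebraicClosure K))
      ((E82 σ)⁄(AlgebraicClosure K)) :=
    isTwoIsogenous_baseChange (AlgebraicClosure K) one_ne_zero h4
      (by rw [lam]; ring) (by rw [lam]; field_simp; ring)
  rw [map_one] at H
  refine ⟨nonsingular_origin (E4_nonsingular_zero h4), ?_⟩
  refine isQuotientByTwoTorsion_of (C := 1) (one_smul _ _) H ?_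
  rw [vcHom_some, IsTwoIsogenous.kerPoint, Affine.Point.some.injEq]
  simp [VariableChange.baseChange, VariableChange.one_def]

end Quotient

end TateModular

namespace TateModular

open WeierstrassCurve

/-! ### Rational points, scalings and Galois-equivariance of the isogeny -/

section Rational

variable {K : Type*} [Field K] {W W' : WeierstrassCurve K} {C : VariableChange K}

lemma gal_toGeom (g : AlgebraicClosure K ≃ₐ[K] AlgebraicClosure K) (P : W.toAffine.Point) :
    gal g (toGeom P) = toGeom P := by
  rcases P with _ | ⟨x, y, h⟩
  · rfl
  · rw [toGeom_some]; exact gal_algebraMap g _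

lemma exists_toGeom_eq [CharZero K] {P : GeomPoint W} (hP : ∀ g, gal g P = P) :
    ∃ P₀ : W.toAffine.Point, toGeom P₀ = P := by
  rcases P with _ | ⟨x, y, h⟩
  · exact ⟨0, rfl⟩
  · obtain ⟨x₀, y₀, rfl, rfl, h₀⟩ := exists_eq_of_gal_eq hP
    exact ⟨.some x₀ y₀ h₀, rfl⟩

open scoped Classical in
lemma geomHom_some_eq_iff (h : C • W = W') {x y x' y' : AlgebraicClosure K}
    (hxy : (W⁄(AlgebraicClosure K)).toAffine.Nonsingular x y)
    (hxy' : (W'⁄(AlgebraicClosure K)).toAffine.Nonsingular x' y') :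
    .some x y hxy = geomHom h (.some x' y' hxy') ↔
      x = algebraMap K (AlgebraicClosure K) C.u ^ 2 * x' + algebraMap K (AlgebraicClosure K) C.r ∧
      y = algebraMap K (AlgebraicClosure K) C.u ^ 3 * y' +
        algebraMap K (AlgebraicClosure K) C.u ^ 2 * algebraMap K (AlgebraicClosure K) C.s * x' +
        algebraMap K (AlgebraicClosure K) C.t := by
  rw [vcHom_some, Affine.Point.some.injEq]
  rfl

lemma carries_baseChange_scaling (u : Kˣ) {x y x' y' : AlgebraicClosure K}
    (hxy : (W⁄(AlgebraicClosure K)).toAffine.Nonsingular x y)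
    (hx : x = algebraMap K (AlgebraicClosure K) u ^ 2 * x')
    (hy : y = algebraMap K (AlgebraicClosure K) u ^ 3 * y') :
    Carries ((⟨u, 0, 0, 0⟩ : VariableChange K).baseChange (AlgebraicClosure K))
      (.some x y hxy : GeomPoint W) x' y' := by
  have e₁ : (((⟨u, 0, 0, 0⟩ : VariableChange K).baseChange (AlgebraicClosure K)).u :
      AlgebraicClosure K) ^ 2 * x' +
      ((⟨u, 0, 0, 0⟩ : VariableChange K).baseChange (AlgebraicClosure K)).r = x := by
    simp [VariableChange.baseChange, hx]
  have e₂ : (((⟨u, 0, 0, 0⟩ : VariableChange K).baseChange (AlgebraicClosure K)).u :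
      AlgebraicClosure K) ^ 3 * y' +
      (((⟨u, 0, 0, 0⟩ : VariableChange K).baseChange (AlgebraicClosure K)).u :
      AlgebraicClosure K) ^ 2 *
      ((⟨u, 0, 0, 0⟩ : VariableChange K).baseChange (AlgebraicClosure K)).s * x' +
      ((⟨u, 0, 0, 0⟩ : VariableChange K).baseChange (AlgebraicClosure K)).t = y := by
    simp [VariableChange.baseChange, hy]
  refine ⟨by rw [e₁, e₂]; exact hxy, ?_⟩
  simp only [e₁, e₂]

lemma scaling_smul_twoTorsionForm (u : Kˣ) {a b a' b' : K} (ha : a = u ^ 2 * a')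
    (hb : b = u ^ 4 * b') :
    (⟨u, 0, 0, 0⟩ : VariableChange K) • twoTorsionForm a b = twoTorsionForm a' b' := by
  have hu : (u : K) ≠ 0 := u.ne_zero
  rw [ha, hb]
  simp only [variableChange_def, twoTorsionForm, Units.val_inv_eq_inv_val]
  ext <;> dsimp only <;> field_simp <;> ring

open scoped Classical in
lemma exists_twoTorsionForm [CharZero K] {D : GeomPoint W} (hD : addOrderOf D = 2)
    (hg : ∀ g, gal g D = D) :
    ∃ (a b : K) (C : VariableChange K) (h : C • W = twoTorsionForm a b),
      ∃ h₀, D = geomHom h (.some 0 0 h₀) := by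
  obtain ⟨D₀, rfl⟩ := exists_toGeom_eq hg
  rw [addOrderOf_injective _ toGeom_injective] at hD
  rcases D₀ with _ | ⟨d, e, hd⟩
  · rw [← Affine.Point.zero_def, addOrderOf_zero] at hD
    norm_num at hD
  have h2 := addOrderOf_nsmul_eq_zero (.some d e hd : W.toAffine.Point)
  rw [hD, two_nsmul, add_self_eq_zero_iff] at h2
  have heq := hd.1
  rw [Affine.equation_iff'] at heq
  -- Translate `D` to the origin and complete the square to remove `a₁`; `2D = 0` then removes `a₃`.
  have hC : (⟨1, d, -W.a₁ / 2, e⟩ : VariableChange K) • W =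
      twoTorsionForm (W.a₂ + W.a₁ / 2 * W.a₁ + 3 * d - (W.a₁ / 2) ^ 2)
        (W.a₄ + W.a₁ / 2 * W.a₃ + 2 * d * W.a₂ - (e - d * W.a₁ / 2) * W.a₁ + 3 * d ^ 2
          + W.a₁ * e) := by
    simp only [variableChange_def, twoTorsionForm, inv_one, Units.val_one, one_pow, one_mul]
    ext <;> dsimp only
    · ring
    · ring
    · linear_combination h2
    · ring
    · linear_combination -heq
  have hd' : (W⁄(AlgebraicClosure K)).toAffine.Nonsingular
      (algebraMap K (AlgebraicClosure K) d) (algebraMap K (AlgebraicClosure K) e) :=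
    nonsingular_algebraMap hd
  obtain ⟨Q, hQ⟩ := geomHom_surjective hC (toGeom (.some d e hd))
  rcases Q with _ | ⟨x, y, h⟩
  · exact absurd hQ.symm (Affine.Point.some_ne_zero _)
  refine ⟨_, _, _, hC, ?_⟩
  have hQ' := hQ.symm
  rw [toGeom_some, geomHom_some_eq_iff] at hQ'
  simp only [Units.val_one, map_one, one_pow, one_mul, right_eq_add] at hQ'
  obtain ⟨rfl, hy⟩ := hQ'
  obtain rfl : y = 0 := by simpa using hy
  exact ⟨h, hQ.symm⟩

open scoped Classical in
-- Fixing the origin gives `r = t = 0`, and `a₁ = 0` on both curves gives `s = 0`.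
lemma eq_scaling_of_origin [CharZero K] (h : C • W = W') (ha : W.a₁ = 0) (ha' : W'.a₁ = 0)
    {h₀ h₀'} (e : (.some 0 0 h₀ : GeomPoint W) = geomHom h (.some 0 0 h₀')) :
    C = ⟨C.u, 0, 0, 0⟩ := by
  have hu : (C.u : K) ≠ 0 := C.u.ne_zero
  rw [geomHom_some_eq_iff] at e
  have hr : C.r = 0 := by simpa using e.1.symm
  have ht : C.t = 0 := by simpa using e.2.symm
  have hs : C.s = 0 := by
    rw [← h, variableChange_a₁, ha, zero_add, mul_eq_zero, or_iff_right (Units.ne_zero _)] at ha'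
    simpa using ha'
  ext <;> simp [hr, hs, ht]

end Rational

section TwoIsogeny

variable {K : Type*} [Field K] {W W' : WeierstrassCurve K} {c : K}

open scoped Classical in
lemma twoIsog_gal (H : IsTwoIsogenous (algebraMap K (AlgebraicClosure K) c)
    (W⁄(AlgebraicClosure K)) (W'⁄(AlgebraicClosure K)))
    (g : AlgebraicClosure K ≃ₐ[K] AlgebraicClosure K) (P : GeomPoint W) :
    twoIsog H (gal g P) = gal g (twoIsog H P : GeomPoint W') := by
  rcases P with _ | ⟨x, y, h⟩
  · rfl
  · obtain ⟨h₁, e₁⟩ := gal_some g h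
    rw [e₁]
    by_cases hx : x = 0
    · have e₂ : twoIsog H (.some x y h) = 0 := twoIsogFun_some_of_eq_zero H h hx
      have e₃ : twoIsog H (.some (g x) (g y) h₁) = 0 :=
        twoIsogFun_some_of_eq_zero H h₁ (by rw [hx, map_zero])
      rw [e₂, e₃]
      rfl
    · obtain ⟨h₂, e₂⟩ := gal_some g (H.map_nonsingular h hx)
      rw [twoIsog_some H h hx, e₂, twoIsog_some H h₁ (by simpa using hx)]
      simp

open scoped Classical in
-- The isogeny commutes with Galois, so `gU - U` lies in its kernel.
lemma gal_eq_or_eq_add_kerPoint (H : IsTwoIsogenous (algebraMap K (AlgebraicClosure K) c)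
    (W⁄(AlgebraicClosure K)) (W'⁄(AlgebraicClosure K))) {U : GeomPoint W}
    (g : AlgebraicClosure K ≃ₐ[K] AlgebraicClosure K)
    (hU : gal g (twoIsog H U : GeomPoint W') = twoIsog H U) :
    gal g U = U ∨ gal g U = U + H.kerPoint := by
  rw [← twoIsog_gal, ← sub_eq_zero, ← map_sub, twoIsog_eq_zero_iff, sub_eq_zero] at hU
  exact hU.imp_right fun h ↦ by rw [← h, add_sub_cancel]

open scoped Classical in
lemma gal_twoIsog_eq (H : IsTwoIsogenous (algebraMap K (AlgebraicClosure K) c)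
    (W⁄(AlgebraicClosure K)) (W'⁄(AlgebraicClosure K))) {U : GeomPoint W}
    {g : AlgebraicClosure K ≃ₐ[K] AlgebraicClosure K}
    (hU : gal g U = U ∨ gal g U = U + H.kerPoint) :
    gal g (twoIsog H U : GeomPoint W') = twoIsog H U := by
  rw [← twoIsog_gal]
  rcases hU with h | h <;> rw [h]
  rw [map_add, (twoIsog_eq_zero_iff H H.kerPoint).2 (Or.inr rfl), add_zero]

variable {F : Type*} [Field F] [DecidableEq F] {V V' : WeierstrassCurve F} {c : F}

/-- `4U` lies in the kernel. If it were zero, `2U` would be a point of order two outside the kernel,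
and hence would map to the origin. -/
lemma four_nsmul_eq_kerPoint (H : IsTwoIsogenous c V V') {U : V.toAffine.Point}
    (h4 : 4 • twoIsog H U = 0) (h2 : 2 • twoIsog H U ≠ 0) (h2' : 2 • twoIsog H U ≠ H.origin) :
    4 • U = H.kerPoint := by
  rw [← map_nsmul, twoIsog_eq_zero_iff] at h4
  refine h4.resolve_left fun h ↦ h2' ?_
  rw [← map_nsmul] at h2 ⊢
  rw [twoIsog_eq_origin_iff, ← not_or, ← twoIsog_eq_zero_iff H]
  exact ⟨by rw [← mul_nsmul]; exact h, h2⟩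

lemma addOrderOf_eq_eight_of_four_nsmul (H : IsTwoIsogenous c V V') {U : V.toAffine.Point}
    (h : 4 • U = H.kerPoint) : addOrderOf U = 8 := by
  refine addOrderOf_eq_prime_pow (p := 2) (n := 2) ?_ ?_
  · rw [show 2 ^ 2 = 4 from rfl, h]
    exact Affine.Point.some_ne_zero _
  · rw [show 2 ^ (2 + 1) = 4 + 4 from rfl, add_nsmul, h, H.kerPoint_add_self]

lemma dualIsogenyMaps_iff (H : IsTwoIsogenous (1 / 2) V V') {x y X Y : F}
    (h : V.toAffine.Nonsingular x y) (h' : V'.toAffine.Nonsingular X Y) :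
    DualIsogenyMaps V.a₄ x y X Y ↔ twoIsog H (.some x y h) = .some X Y h' := by
  have h2 := H.two_ne_zero
  have h4 : (4 : F) ≠ 0 := by rw [show (4 : F) = 2 * 2 by norm_num]; exact mul_ne_zero h2 h2
  have h8 : (8 : F) ≠ 0 := by rw [show (8 : F) = 2 * 4 by norm_num]; exact mul_ne_zero h2 h4
  by_cases hx : x = 0
  · have e : twoIsog H (.some x y h) = 0 := twoIsogFun_some_of_eq_zero H h hx
    rw [e]
    exact iff_of_false (fun h ↦ h.1 hx) (Affine.Point.some_ne_zero h').symm
  · rw [twoIsog_some H h hx, Affine.Point.some.injEq, DualIsogenyMaps, eq_comm (a := X),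
      eq_comm (a := Y), and_iff_right hx]
    have e₁ : y ^ 2 / (4 * x ^ 2) = (1 / 2) ^ 2 * y ^ 2 / x ^ 2 := by
      field_simp
      norm_num
    have e₂ : y * (V.a₄ - x ^ 2) / (8 * x ^ 2) = (1 / 2) ^ 3 * y * (V.a₄ - x ^ 2) / x ^ 2 := by
      field_simp
      norm_num
    rw [e₁, e₂]

end TwoIsogeny

/-! ### The parameter `σ` -/

section Sigma

variable {K : Type*} [Field K] [CharZero K]

/-- The data are a point `(p, q)` with double `(d, 0)` and a square root `r` of `B`. In the model
`p/r` is `σ` up to scaling by `u`, and `q/r = u(σ² - 1)/2`; this dictates `σ = p/r` and then `u`. -/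
lemma exists_sigma {A B r p q d : K} (hB : B ≠ 0) (hr : r ^ 2 = B)
    (hq : q ^ 2 = p * (p ^ 2 + A * p + B)) (hq0 : q ≠ 0) (hd : d ^ 2 + A * d + B = 0)
    (hpd : p ^ 2 + B = 2 * d * p) :
    ∃ (σ : K) (u : Kˣ), σ ≠ 0 ∧ A = u ^ 2 * -(1 + lam σ) ∧ B = u ^ 4 * lam σ ∧
      r = u ^ 2 * ((σ + σ⁻¹) / 2) ∧ p = u ^ 2 * ((σ ^ 2 + 1) / 2) ∧
      q = u ^ 3 * ((σ ^ 4 - 1) / (4 * σ)) := by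
  have hr0 : r ≠ 0 := by
    rintro rfl
    exact hB (by rw [← hr]; ring)
  have hp0 : p ≠ 0 := by
    rintro rfl
    exact hq0 (by simpa using hq)
  have hd0 : d ≠ 0 := by
    rintro rfl
    exact hB (by linear_combination hd)
  have hpB : p ^ 2 - B ≠ 0 := by
    intro h
    have h1 : p = d := by
      have : 2 * p * (p - d) = 0 := by linear_combination h + hpd
      rcases mul_eq_zero.1 this with h | h
      · exact absurd h (mul_ne_zero two_ne_zero hp0)
      · exact sub_eq_zero.1 h
    rw [← h1] at hd
    exact hq0 (by rw [hd] at hq; simpa using hq)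
  obtain ⟨σ, hσ⟩ : ∃ σ, σ = p / r := ⟨_, rfl⟩
  have hσ0 : σ ≠ 0 := hσ ▸ div_ne_zero hp0 hr0
  rw [eq_div_iff hr0] at hσ
  have hσ1 : σ ^ 2 - 1 ≠ 0 := by
    intro h
    apply hpB
    rw [← hr, ← hσ]
    linear_combination r ^ 2 * h
  have hA : A = -d - B / d := by field_simp; linear_combination hd
  -- From `p² + B = 2dp` one gets `q² = p²(2d + A)`, and `d(2d + A) = d² - B`.
  have hm : q ^ 2 * d = p ^ 2 * (d ^ 2 - B) := by
    rw [hq]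
    linear_combination p * d * hpd + p ^ 2 * hd
  have hd' : d = r * (σ ^ 2 + 1) / (2 * σ) := by
    field_simp
    apply mul_right_cancel₀ hr0
    apply mul_right_cancel₀ hr0
    rw [← hr, ← hσ] at hpd
    linear_combination -r * hpd
  obtain ⟨u, hu⟩ : ∃ u, u = 2 * q / (r * (σ ^ 2 - 1)) := ⟨_, rfl⟩
  have hu0 : u ≠ 0 := hu ▸ div_ne_zero (mul_ne_zero two_ne_zero hq0) (mul_ne_zero hr0 hσ1)
  have hσ2 : σ ^ 2 + 1 ≠ 0 := by
    intro h
    rw [h] at hd'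
    exact hd0 (by rw [hd']; simp)
  have hu2 : u ^ 2 * (σ ^ 2 + 1) = 2 * σ * r := by
    have h1 : q ^ 2 * (2 * (σ ^ 2 + 1)) = σ * r ^ 3 * (σ ^ 2 - 1) ^ 2 := by
      rw [hd', ← hr, ← hσ] at hm
      field_simp at hm
      linear_combination hm
    rw [hu]
    field_simp
    linear_combination h1
  have hr' : r = u ^ 2 * (σ ^ 2 + 1) / (2 * σ) := by
    rw [hu2]; field_simp
  have hq' : q = u * r * (σ ^ 2 - 1) / 2 := by
    rw [hu]; field_simp
  refine ⟨σ, Units.mk0 u hu0, hσ0, ?_, ?_, ?_, ?_, ?_⟩ <;> rw [Units.val_mk0]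
  · rw [hA, ← hr, hd', hr', lam]
    field_simp
    ring
  · rw [← hr, hr', lam]
    field_simp
    ring
  · rw [hr']
    field_simp
  · rw [← hσ, hr']
    field_simp
  · rw [hq', hr']
    field_simp
    ring

/-- The ratio of the two `x`-coordinates is `σ`, which scaling does not change. Then `u² = 1`, and
the nonzero `y`-coordinate of `P` fixes the sign. -/
lemma sigma_unique {σ σ' u : K} (h : σ + σ⁻¹ = u ^ 2 * (σ' + σ'⁻¹)) (hσ : σ ≠ 0) (hσ' : σ' ≠ 0)
    (h₁ : σ ^ 2 + 1 ≠ 0) (h₂ : σ ^ 2 - 1 ≠ 0)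
    (hp : (σ ^ 2 + 1) / 2 = u ^ 2 * ((σ' ^ 2 + 1) / 2))
    (hq : (σ ^ 4 - 1) / (4 * σ) = u ^ 3 * ((σ' ^ 4 - 1) / (4 * σ'))) : σ = σ' ∧ u = 1 := by
  have h0 : σ + σ⁻¹ ≠ 0 := by
    intro h0
    apply h₁
    field_simp at h0
    rwa [mul_zero] at h0
  obtain rfl : σ = σ' := by
    apply mul_right_cancel₀ h0
    have e₁ : σ * (σ + σ⁻¹) = σ ^ 2 + 1 := by field_simp
    have e₂ : σ' * (σ' + σ'⁻¹) = σ' ^ 2 + 1 := by field_simp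
    linear_combination e₁ + 2 * hp - u ^ 2 * e₂ - σ' * h
  refine ⟨rfl, ?_⟩
  have hu2 : u ^ 2 = 1 := by
    apply mul_right_cancel₀ h0
    linear_combination -h
  have h3 : (σ ^ 4 - 1) / (4 * σ) ≠ 0 := by
    rw [show σ ^ 4 - 1 = (σ ^ 2 + 1) * (σ ^ 2 - 1) by ring]
    exact div_ne_zero (mul_ne_zero h₁ h₂) (mul_ne_zero (by norm_num) hσ)
  apply mul_right_cancel₀ h3
  linear_combination -hq - u * ((σ ^ 4 - 1) / (4 * σ)) * hu2

end Sigma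

end TateModular

namespace TateModular

open WeierstrassCurve

/-! ### The universal curve `E(4)` -/

section Level4

variable {K : Type*} [Field K] [CharZero K]

lemma E4_nonsingular {σ : K} (hσ : σ ≠ 0) (h : (E4 σ).Δ ≠ 0) :
    (E4 σ).toAffine.Nonsingular ((σ ^ 2 + 1) / 2) ((σ ^ 4 - 1) / (4 * σ)) := by
  apply twoTorsionForm_nonsingular h
  rw [lam]
  field_simp
  ring

lemma E4_two_nsmul [DecidableEq K] {σ : K} (hσ : σ ≠ 0) (h : (E4 σ).Δ ≠ 0) :
    ∃ h', 2 • (.some _ _ (E4_nonsingular hσ h) : (E4 σ).toAffine.Point) =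
      .some (lam σ) 0 h' := by
  obtain ⟨h₁, h₂⟩ := (E4_Δ_ne_zero_iff hσ).1 h
  rw [two_nsmul]
  -- The tangent at `P` has slope `σ` and meets the `x`-axis at `(λ, 0)`.
  apply exists_add_eq_of_tangent σ
  · simp only [E4, twoTorsionForm, zero_mul, add_zero]
    rw [show σ ^ 4 - 1 = (σ ^ 2 + 1) * (σ ^ 2 - 1) by ring]
    exact mul_ne_zero two_ne_zero (div_ne_zero (mul_ne_zero h₁ h₂) (mul_ne_zero (by norm_num) hσ))
  · simp only [E4, twoTorsionForm, lam]
    field_simp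
    ring
  · simp only [E4, twoTorsionForm, lam]
    field_simp
    ring
  · simp only [E4, twoTorsionForm, lam]
    field_simp
    ring

lemma E4_addOrderOf [DecidableEq K] {σ : K} (hσ : σ ≠ 0) (h : (E4 σ).Δ ≠ 0) :
    addOrderOf (.some _ _ (E4_nonsingular hσ h) : (E4 σ).toAffine.Point) = 4 := by
  obtain ⟨h', e⟩ := E4_two_nsmul hσ h
  refine addOrderOf_eq_prime_pow (p := 2) (n := 1) ?_ ?_
  · rw [pow_one, e]; exact Affine.Point.some_ne_zero _
  · rw [show 2 ^ (1 + 1) = 2 * 2 from rfl, mul_nsmul, e,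
      two_nsmul_eq_zero_iff_of_form two_ne_zero rfl rfl]

lemma E4_lam_ne_zero {K : Type*} [Field K] {σ : K} (h : (E4 σ).Δ ≠ 0) : lam σ ≠ 0 :=
  (twoTorsionForm_ne_zero h).2.1

lemma Δ_ne_zero_of_smul_eq {K : Type*} [Field K] {W W' : WeierstrassCurve K}
    {C : VariableChange K} (h : C • W = W') (hW : W.Δ ≠ 0) : W'.Δ ≠ 0 := by
  rw [← h, variableChange_Δ]
  exact mul_ne_zero (pow_ne_zero _ (Units.ne_zero _)) hW

open scoped Classical in
-- With `l = (σ + σ⁻¹)/2` the curve is `y² = x(x - 1)(x - l²)`. At `x = l` one has `y² = -(l(l -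
-- 1))²`, and the tangent there, of slope `y/l`, passes through the origin.
lemma E4_two_nsmul_eq_origin {σ : K} (h : (E4 σ).Δ ≠ 0) {y : AlgebraicClosure K}
    (hy : ((E4 σ)⁄(AlgebraicClosure K)).toAffine.Nonsingular
      (algebraMap K (AlgebraicClosure K) ((σ + σ⁻¹) / 2)) y) :
    2 • (.some _ _ hy : GeomPoint (E4 σ)) =
      .some 0 0 (nonsingular_origin (E4_nonsingular_zero h)) := by
  have e₁ : ((E4 σ)⁄(AlgebraicClosure K)).a₁ = 0 := map_zero _
  have e₃ : ((E4 σ)⁄(AlgebraicClosure K)).a₃ = 0 := map_zero _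
  have e₆ : ((E4 σ)⁄(AlgebraicClosure K)).a₆ = 0 := map_zero _
  have e₂ : ((E4 σ)⁄(AlgebraicClosure K)).a₂ =
      -(1 + algebraMap K (AlgebraicClosure K) ((σ + σ⁻¹) / 2) ^ 2) := by
    have : (E4 σ).a₂ = -(1 + ((σ + σ⁻¹) / 2) ^ 2) := by simp only [E4, twoTorsionForm, lam]; ring
    simp only [WeierstrassCurve.baseChange, map_a₂, this, map_neg, map_add, map_pow, map_one]
  have e₄ : ((E4 σ)⁄(AlgebraicClosure K)).a₄ =
      algebraMap K (AlgebraicClosure K) ((σ + σ⁻¹) / 2) ^ 2 := by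
    have : (E4 σ).a₄ = ((σ + σ⁻¹) / 2) ^ 2 := by simp only [E4, twoTorsionForm, lam]; ring
    simp only [WeierstrassCurve.baseChange, map_a₄, this, map_pow]
  have hl : algebraMap K (AlgebraicClosure K) ((σ + σ⁻¹) / 2) ≠ 0 := by
    rw [ne_eq, map_eq_zero]
    intro h0
    apply E4_lam_ne_zero h
    rw [lam, show (σ + σ⁻¹) ^ 2 / 4 = ((σ + σ⁻¹) / 2) ^ 2 by ring, h0]
    ring
  have hl1 : algebraMap K (AlgebraicClosure K) ((σ + σ⁻¹) / 2) - 1 ≠ 0 := by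
    rw [← map_one (algebraMap K (AlgebraicClosure K)), ← map_sub, ne_eq, map_eq_zero, sub_eq_zero]
    intro h0
    apply h
    rw [E4_Δ, lam, show (σ + σ⁻¹) ^ 2 / 4 = ((σ + σ⁻¹) / 2) ^ 2 by ring, h0]
    ring
  have heq := form_equation e₁ e₃ e₆ hy
  generalize algebraMap K (AlgebraicClosure K) ((σ + σ⁻¹) / 2) = l at *
  rw [e₂, e₄] at heq
  have hy0 : y ≠ 0 := by
    rintro rfl
    have : (l * (l - 1)) ^ 2 = 0 := by linear_combination heq
    exact mul_ne_zero hl hl1 (pow_eq_zero_iff two_ne_zero |>.1 this)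
  rw [two_nsmul]
  refine (exists_add_eq_of_tangent (y / l) hy ?_ ?_ ?_ ?_).choose_spec
  · rw [e₁, e₃]
    simpa using hy0
  · rw [e₁, e₂, e₃, e₄]
    field_simp
    linear_combination -2 * heq
  · rw [e₁, e₂]
    field_simp
    linear_combination -heq
  · rw [e₁, e₃]
    field_simp
    ring

lemma level4_fibre {σ : K} (hσ : σ ≠ 0) (h : (E4 σ).Δ ≠ 0) : ∃ x₁ y₁ h₁ x₂ y₂ h₂,
    mark4 σ x₁ y₁ x₂ y₂ ∧ level4 K (E4 σ) (.some x₁ y₁ h₁) (.some x₂ y₂ h₂) := by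
  classical
  obtain ⟨y, hy⟩ := IsAlgClosed.exists_pow_nat_eq (n := 2)
    (algebraMap K (AlgebraicClosure K)
      ((σ + σ⁻¹) / 2 * (((σ + σ⁻¹) / 2) ^ 2 + -(1 + lam σ) * ((σ + σ⁻¹) / 2) + lam σ)))
    (by norm_num)
  have H : IsTwoIsogenous (algebraMap K (AlgebraicClosure K) 1) ((E4 σ)⁄(AlgebraicClosure K)) _ :=
    isTwoIsogenous_baseChange (AlgebraicClosure K) one_ne_zero h rfl rfl
  have hQ : ((E4 σ)⁄(AlgebraicClosure K)).toAffine.Nonsingular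
      (algebraMap K (AlgebraicClosure K) ((σ + σ⁻¹) / 2)) y := by
    apply H.nonsingular
    rw [hy]
    simp only [WeierstrassCurve.baseChange, map_a₂, map_a₄, E4, twoTorsionForm, map_mul, map_add,
      map_pow]
  have eP := congrArg toGeom (E4_two_nsmul hσ h).choose_spec
  rw [map_nsmul, toGeom_some, toGeom_some] at eP
  have eQ := E4_two_nsmul_eq_origin h hQ
  refine ⟨_, _, nonsingular_algebraMap (E4_nonsingular hσ h), _, y, hQ, ⟨rfl, rfl, rfl⟩,
    ?_, ?_, ?_, fun g ↦ ⟨gal_algebraMap g _, ?_⟩⟩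
  · have := E4_addOrderOf hσ h
    rw [← addOrderOf_injective _ toGeom_injective] at this
    exact this
  · refine addOrderOf_eq_prime_pow (p := 2) (n := 1) ?_ ?_
    · rw [pow_one, eQ]; exact Affine.Point.some_ne_zero _
    · rw [show 2 ^ (1 + 1) = 2 * 2 from rfl, mul_nsmul, eQ,
        two_nsmul_eq_zero_iff_of_form two_ne_zero H.a₁ H.a₃]
  · rw [eP, eQ, ne_eq, Affine.Point.some.injEq, map_eq_zero]
    exact fun h0 ↦ E4_lam_ne_zero h h0.1
  · obtain ⟨h', e⟩ := gal_some g hQ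
    rw [e]
    exact Affine.Point.X_eq_iff.1 (AlgEquiv.commutes g _)

/-- With `2Q` at the origin, `x(Q)² = B`, and `x(Q)` is rational because Galois sends `Q` to `±Q`.
As `2P ≠ 2Q`, `2P = (d, 0)` with `d ≠ 0`, and `exists_sigma` applies. -/
lemma level4_isMarkedFibre_form {A B : K} (hΔ : (twoTorsionForm A B).Δ ≠ 0)
    {P Q : GeomPoint (twoTorsionForm A B)} (hPQ : level4 K _ P Q) {h₀}
    (hQ : mulPoint 2 Q = .some 0 0 h₀) :
    IsMarkedFibre E4 {σ : K | σ ≠ 0 ∧ (E4 σ).Δ ≠ 0} mark4 _ P Q := by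
  classical
  obtain ⟨hP4, hQ4, hne, hg⟩ := hPQ
  have hB := (twoTorsionForm_ne_zero hΔ).2.1
  obtain ⟨P₀, rfl⟩ := exists_toGeom_eq fun g ↦ (hg g).1
  rw [addOrderOf_injective _ toGeom_injective] at hP4
  change 2 • Q = _ at hQ
  have h2P : 2 • P₀ ≠ 0 := by
    intro h
    have := Nat.le_of_dvd (by norm_num) (addOrderOf_dvd_of_nsmul_eq_zero h)
    omega
  have h4P : 2 • (2 • P₀) = 0 := by
    have := addOrderOf_nsmul_eq_zero P₀
    rwa [hP4, show 4 = 2 * 2 from rfl, mul_nsmul] at this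
  obtain ⟨d, h₁, h2d⟩ : ∃ d h₁, 2 • P₀ = .some d 0 h₁ := by
    generalize 2 • P₀ = T at h2P h4P
    rcases T with _ | ⟨d, e, h₁⟩
    · exact absurd rfl h2P
    · rw [two_nsmul_eq_zero_iff_of_form two_ne_zero rfl rfl] at h4P
      subst h4P
      exact ⟨d, h₁, rfl⟩
  have hd : d ≠ 0 := by
    rintro rfl
    apply hne
    rw [hQ, ← map_nsmul, h2d, toGeom_some]
    simp
  rcases P₀ with _ | ⟨p, q, hp⟩
  · exact absurd (nsmul_zero 2) h2P
  rcases Q with _ | ⟨x, y, hxy⟩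
  · exact absurd ((nsmul_zero 2).symm.trans hQ) (Affine.Point.some_ne_zero _).symm
  have hx2 : x ^ 2 = algebraMap K (AlgebraicClosure K) B :=
    sq_eq_of_two_nsmul_eq_origin (map_zero _) (map_zero _) (map_zero _) hQ
  obtain ⟨r, rfl⟩ : ∃ r, algebraMap K (AlgebraicClosure K) r = x := by
    apply exists_algebraMap_eq
    intro g
    obtain ⟨h', e⟩ := gal_some g hxy
    have hgQ := (hg g).2
    rw [e] at hgQ
    exact Affine.Point.X_eq_iff.2 hgQ
  have hr : r ^ 2 = B := (algebraMap K (AlgebraicClosure K)).injective (by rw [map_pow, hx2])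
  have hq0 : q ≠ 0 := by
    rwa [ne_eq, two_nsmul_eq_zero_iff_of_form two_ne_zero rfl rfl] at h2P
  have hd' : d ^ 2 + A * d + B = 0 := by
    have := form_equation rfl rfl rfl h₁
    apply mul_left_cancel₀ hd
    rw [mul_zero, ← zero_pow two_ne_zero]
    exact this.symm
  obtain ⟨σ, u, hσ, hA, hB', hr', rfl, rfl⟩ := exists_sigma (A := A) hB hr
    (form_equation rfl rfl rfl hp) hq0
    hd' (sq_add_eq_of_two_nsmul_eq rfl rfl rfl hd h2d)
  have hC := scaling_smul_twoTorsionForm u hA hB'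
  have hu : algebraMap K (AlgebraicClosure K) u ≠ 0 := (map_ne_zero _).2 u.ne_zero
  rw [toGeom_some]
  refine ⟨σ, ⟨hσ, Δ_ne_zero_of_smul_eq hC hΔ⟩, _, hC, _, _, _,
    y / algebraMap K (AlgebraicClosure K) u ^ 3,
    ⟨rfl, rfl, rfl⟩, carries_baseChange_scaling u _ ?_ ?_, carries_baseChange_scaling u _ ?_ ?_⟩
  · rw [← map_pow, ← map_mul]
  · rw [← map_pow, ← map_mul]
  · rw [hr', map_mul, map_pow]
  · field_simp

lemma level4_isMarkedFibre (W : WeierstrassCurve K) (hW : W.IsElliptic) (P Q : GeomPoint W)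
    (hPQ : level4 K W P Q) :
    IsMarkedFibre E4 {σ : K | σ ≠ 0 ∧ (E4 σ).Δ ≠ 0} mark4 W P Q := by
  classical
  have hD : addOrderOf (2 • Q) = 2 := by
    rw [addOrderOf_nsmul_of_dvd two_ne_zero (by rw [hPQ.2.1]; norm_num), hPQ.2.1]
  -- `2Q` is rational: Galois changes `Q` at most by sign, and `4Q = 0`.
  obtain ⟨A, B, C, hC, h₀, e⟩ := exists_twoTorsionForm hD fun g ↦ by
    rw [gal_nsmul]
    rcases (hPQ.2.2.2 g).2 with h | h <;> rw [h]
    have := addOrderOf_nsmul_eq_zero Q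
    rw [hPQ.2.1] at this
    rwa [neg_nsmul, neg_eq_iff_add_eq_zero, ← add_nsmul]
  obtain ⟨P', rfl⟩ := geomHom_surjective hC P
  obtain ⟨Q', rfl⟩ := geomHom_surjective hC Q
  rw [← geomHom_nsmul] at e
  refine IsMarkedFibre.of_smul hC (level4_isMarkedFibre_form ?_ (level4_of_smul hC hPQ)
    (geomHom_injective hC e))
  exact Δ_ne_zero_of_smul_eq hC (Δ_ne_zero_of_isElliptic hW)

lemma isUniversal_level4 (K : Type*) [Field K] [CharZero K] :
    IsUniversal (level4 K) E4 {σ : K | σ ≠ 0 ∧ (E4 σ).Δ ≠ 0} mark4 := by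
  classical
  refine isUniversal_of (fun σ hσ ↦ ⟨isElliptic_of_Δ_ne_zero hσ.2, level4_fibre hσ.1 hσ.2⟩)
    level4_isMarkedFibre ?_
  rintro σ ⟨hσ, h⟩ σ' ⟨hσ', h'⟩ C hC x₁ y₁ x₂ y₂ x₁' y₁' x₂' y₂' h₁ h₁' h₂ h₂' ⟨rfl, rfl, rfl⟩
    ⟨rfl, rfl, rfl⟩ e₁ e₂
  -- Doubling `Q` shows that `C` fixes the origin, hence is a scaling.
  have e := congrArg (2 • ·) e₂
  simp only [← geomHom_nsmul, E4_two_nsmul_eq_origin h, E4_two_nsmul_eq_origin h'] at e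
  have hC' := eq_scaling_of_origin hC rfl rfl e
  rw [geomHom_some_eq_iff, hC'] at e₁ e₂
  simp only [map_zero, add_zero, mul_zero, zero_mul, ← map_pow, ← map_mul] at e₁ e₂
  have hinj := (algebraMap K (AlgebraicClosure K)).injective
  have f₁ := hinj e₁.1
  have f₂ := hinj e₁.2
  have f₃ := hinj e₂.1
  obtain ⟨g₁, g₂⟩ := (E4_Δ_ne_zero_iff hσ).1 h
  obtain ⟨rfl, hu⟩ := sigma_unique (u := (C.u : K)) (by linear_combination 2 * f₃)
    hσ hσ' g₁ g₂ f₁ f₂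
  refine ⟨rfl, ?_⟩
  rw [hC', VariableChange.one_def, Units.ext hu (v := 1)]

end Level4

end TateModular

namespace TateModular

open WeierstrassCurve

/-! ### The dual isogeny in coordinates -/

section DualIsogeny

variable {L : Type*} [Field L]

lemma DualIsogenyMaps.of_scale {b b' x y X Y u : L} (hu : u ≠ 0) (hb : b = u ^ 4 * b')
    (h : DualIsogenyMaps b x y (u ^ 2 * X) (u ^ 3 * Y)) :
    DualIsogenyMaps b' (x / u ^ 2) (y / u ^ 3) X Y := by
  obtain ⟨hx, hX, hY⟩ := h
  subst hb
  refine ⟨div_ne_zero hx (pow_ne_zero _ hu), ?_, ?_⟩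
  · apply mul_left_cancel₀ (pow_ne_zero 2 hu)
    rw [hX]
    field_simp
  · apply mul_left_cancel₀ (pow_ne_zero 3 hu)
    rw [hY]
    -- If `8 = 0`, both sides are divisions by zero and so vanish.
    by_cases h8 : (8 : L) = 0
    · simp [h8]
    field_simp

lemma DualIsogenyMaps.scale {b b' x y X Y X' Y' u : L} (hu : u ≠ 0) (hb : b = u ^ 4 * b')
    (h : DualIsogenyMaps b (u ^ 2 * x) (u ^ 3 * y) X Y) (h' : DualIsogenyMaps b' x y X' Y') :
    X = u ^ 2 * X' ∧ Y = u ^ 3 * Y' := by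
  obtain ⟨-, rfl, rfl⟩ := h
  obtain ⟨hx, rfl, rfl⟩ := h'
  subst hb
  constructor
  · field_simp
  · by_cases h8 : (8 : L) = 0
    · simp [h8]
    field_simp

open scoped Classical in
lemma dualIsogenyMaps_baseChange_iff {K : Type*} [Field K] [Algebra K L] {a b a' b' : K}
    (H : IsTwoIsogenous (algebraMap K L (1 / 2)) ((twoTorsionForm a b).baseChange L)
      ((twoTorsionForm a' b').baseChange L)) {x y X Y : L}
    (h : ((twoTorsionForm a b).baseChange L).toAffine.Nonsingular x y)
    (h' : ((twoTorsionForm a' b').baseChange L).toAffine.Nonsingular X Y) :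
    DualIsogenyMaps (algebraMap K L b) x y X Y ↔ twoIsog H (.some x y h) = .some X Y h' := by
  have hc : algebraMap K L (1 / 2) = 1 / 2 := by rw [map_div₀, map_one, map_ofNat]
  generalize algebraMap K L (1 / 2) = c at H hc
  subst hc
  exact dualIsogenyMaps_iff H h h'

end DualIsogeny

/-! ### The universal curve `E(8,2)`, by transfer to `E(4)` -/

section Level82

variable {K : Type*} [Field K]

lemma twoTorsionForm_eq_of_scaling_smul {u : Kˣ} {a b a' b' : K}
    (h : (⟨u, 0, 0, 0⟩ : VariableChange K) • twoTorsionForm a b = twoTorsionForm a' b') :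
    a = u ^ 2 * a' ∧ b = u ^ 4 * b' := by
  have e₂ := congrArg WeierstrassCurve.a₂ h
  have e₄ := congrArg WeierstrassCurve.a₄ h
  have hu : (u : K) ≠ 0 := u.ne_zero
  simp only [twoTorsionForm, variableChange_a₂, variableChange_a₄, Units.val_inv_eq_inv_val]
    at e₂ e₄
  constructor
  · rw [← e₂]; field_simp; ring
  · rw [← e₄]; field_simp; ring

variable [CharZero K]

lemma isTwoIsogenous_half {a b : K} (h : (twoTorsionForm a b).Δ ≠ 0) {a' b' : K}
    (ha : a' = -a / 2) (hb : b' = (a ^ 2 - 4 * b) / 16) :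
    IsTwoIsogenous (algebraMap K (AlgebraicClosure K) (1 / 2))
      ((twoTorsionForm a b)⁄(AlgebraicClosure K)) ((twoTorsionForm a' b')⁄(AlgebraicClosure K)) :=
  isTwoIsogenous_baseChange _ (by norm_num) h (by rw [ha]; ring) (by rw [hb]; ring)

lemma E82_isTwoIsogenous {σ : K} (hσ : σ ≠ 0) (h : (E82 σ).Δ ≠ 0) :
    IsTwoIsogenous (algebraMap K (AlgebraicClosure K) (1 / 2)) ((E82 σ)⁄(AlgebraicClosure K))
      ((E4 σ)⁄(AlgebraicClosure K)) :=
  isTwoIsogenous_half h (by rw [lam]; ring) (by rw [lam]; field_simp; ring)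

open scoped Classical in
lemma E82_four_nsmul {σ : K} (hσ : σ ≠ 0) (h : (E82 σ).Δ ≠ 0)
    (h4 : (E4 σ).Δ ≠ 0) {U : GeomPoint (E82 σ)}
    (hU : twoIsog (E82_isTwoIsogenous hσ h) U = toGeom (.some _ _ (E4_nonsingular hσ h4))) :
    4 • U = (E82_isTwoIsogenous hσ h).kerPoint := by
  obtain ⟨h', e⟩ := E4_two_nsmul hσ h4
  apply four_nsmul_eq_kerPoint <;> rw [hU, ← map_nsmul]
  · have := addOrderOf_nsmul_eq_zero (.some _ _ (E4_nonsingular hσ h4) : (E4 σ).toAffine.Point)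
    rw [E4_addOrderOf hσ h4] at this
    rw [this, map_zero]
  · rw [e, toGeom_some]
    exact Affine.Point.some_ne_zero _
  · rw [e, toGeom_some, IsTwoIsogenous.origin, ne_eq, Affine.Point.some.injEq, map_eq_zero]
    exact fun h0 ↦ E4_lam_ne_zero h4 h0.1

lemma E82_nonsingular {σ : K} (hσ : σ ≠ 0) (h : (E82 σ).Δ ≠ 0) :
    (E82 σ).toAffine.Nonsingular (-(σ - 1) ^ 4 / (4 * σ ^ 2)) 0 := by
  apply twoTorsionForm_nonsingular h
  field_simp
  ring

/-- `U` is any preimage of the rational point `P` of `E(4)`. Since `2P` is not the origin, `4U`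
generates the kernel, and so the Galois-stable fibre `{U, U + T}` is `{U, 5U}`. -/
lemma level82_fibre {σ : K} (hσ : σ ≠ 0) (h : (E82 σ).Δ ≠ 0) : ∃ x₁ y₁ h₁ x₂ y₂ h₂,
    mark82 σ x₁ y₁ x₂ y₂ ∧ level82 K (E82 σ) (.some x₁ y₁ h₁) (.some x₂ y₂ h₂) := by
  classical
  have hσ' := (E82_Δ_ne_zero_iff hσ).1 h
  have h4 := (E4_Δ_ne_zero_iff hσ).2 hσ'
  have H := E82_isTwoIsogenous hσ h
  obtain ⟨U, hU⟩ := twoIsog_surjective H (toGeom (.some _ _ (E4_nonsingular hσ h4)))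
  have e₄ := E82_four_nsmul hσ h h4 hU
  have e₈ := addOrderOf_eq_eight_of_four_nsmul H e₄
  have hgal : ∀ g, gal g U = U ∨ gal g U = 5 • U := by
    intro g
    have : 5 • U = U + H.kerPoint := by rw [← e₄, ← succ_nsmul']
    rw [this]
    exact gal_eq_or_eq_add_kerPoint H g (by rw [hU, gal_toGeom])
  rcases U with _ | ⟨x, y, hxy⟩
  · rw [← Affine.Point.zero_def, addOrderOf_zero] at e₈
    omega
  have hm := (dualIsogenyMaps_baseChange_iff H hxy _).2 hU
  have hQ := E82_nonsingular hσ h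
  refine ⟨x, y, hxy, _, 0, by simpa using nonsingular_algebraMap (L := AlgebraicClosure K) hQ,
    ⟨hm, rfl, rfl⟩, e₈, ?_, ?_, fun g ↦ ⟨hgal g, ?_⟩⟩
  · refine addOrderOf_eq_prime ?_ (Affine.Point.some_ne_zero _)
    rw [two_nsmul_eq_zero_iff_of_form two_ne_zero H.a₁ H.a₃]
  · rw [e₄, IsTwoIsogenous.kerPoint, ne_eq, Affine.Point.some.injEq, map_eq_zero]
    rintro ⟨h0, -⟩
    rw [div_eq_zero_iff] at h0
    rcases h0 with h0 | h0
    · have : σ - 1 = 0 := by simpa using h0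
      exact hσ'.2 (by linear_combination (σ + 1) * this)
    · simp [hσ] at h0
  · have := gal_algebraMap g (nonsingular_algebraMap hQ)
    simp only [map_zero] at this
    exact this

/-- The isogeny with kernel generated by `4U` sends `U` to a rational point `R` of order 4 with `2R`
not the origin, while the rational point `Q` supplies the square root needed in `exists_sigma`. -/
lemma level82_isMarkedFibre_form {a b : K} (hΔ : (twoTorsionForm a b).Δ ≠ 0)
    {U Q : GeomPoint (twoTorsionForm a b)} (hl : level82 K _ U Q) {h₀}
    (hU : mulPoint 4 U = .some 0 0 h₀) :
    IsMarkedFibre E82 {σ : K | σ ≠ 0 ∧ (E82 σ).Δ ≠ 0} mark82 _ U Q := by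
  classical
  obtain ⟨hU8, hQ2, hne, hg⟩ := hl
  obtain ⟨-, hb, hd⟩ := twoTorsionForm_ne_zero hΔ
  have H := isTwoIsogenous_half hΔ rfl rfl
  have h4U : 4 • U = H.kerPoint := hU
  rw [h4U] at hne
  obtain ⟨R, hR⟩ := exists_toGeom_eq (P := twoIsog H U) fun g ↦ gal_twoIsog_eq H (by
    have : 5 • U = U + H.kerPoint := by rw [← h4U, ← succ_nsmul']
    rw [← this]
    exact (hg g).1)
  obtain ⟨Q₀, rfl⟩ := exists_toGeom_eq fun g ↦ (hg g).2
  have hR4 : 4 • R = 0 := by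
    apply toGeom_injective
    rw [map_nsmul, hR, ← map_nsmul, h4U, map_zero, twoIsog_eq_zero_iff]
    exact Or.inr rfl
  have h4U0 : 2 • (2 • U) ≠ 0 := by
    rw [← mul_nsmul, h4U]
    exact Affine.Point.some_ne_zero _
  have hR2 : 2 • R ≠ 0 := by
    intro h
    have h := congrArg toGeom h
    rw [map_nsmul, hR, ← map_nsmul, map_zero, twoIsog_eq_zero_iff] at h
    rcases h with h | h
    · exact h4U0 (by rw [h, nsmul_zero])
    · exact h4U0 (by rw [h, two_nsmul, H.kerPoint_add_self])
  -- Only points of order two lie over the origin, whereas `2U` has order 4.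
  have hR2' : twoIsog H (2 • U) ≠ H.origin := by
    rw [ne_eq, twoIsog_eq_origin_iff]
    exact fun h ↦ h4U0 h.1
  rw [map_nsmul, ← hR, ← map_nsmul] at hR2'
  rcases Q₀ with _ | ⟨e₀, f₀, hQ⟩
  · rw [← Affine.Point.zero_def, map_zero, addOrderOf_zero] at hQ2
    omega
  have hQ0 := addOrderOf_nsmul_eq_zero
    (.some e₀ f₀ hQ : (twoTorsionForm a b).toAffine.Point)
  rw [addOrderOf_injective _ toGeom_injective] at hQ2
  rw [hQ2, two_nsmul_eq_zero_iff_of_form two_ne_zero rfl rfl] at hQ0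
  subst hQ0
  have he₀ : e₀ ≠ 0 := by
    rintro rfl
    apply hne
    rw [toGeom_some, IsTwoIsogenous.kerPoint]
    simp
  have heq : e₀ ^ 2 + a * e₀ + b = 0 := by
    have := form_equation rfl rfl rfl hQ
    apply mul_left_cancel₀ he₀
    rw [mul_zero, ← zero_pow two_ne_zero]
    exact this.symm
  obtain ⟨d, h₁, h2d⟩ : ∃ d h₁, 2 • R = .some d 0 h₁ := by
    have h4R : 2 • (2 • R) = 0 := by rw [← mul_nsmul]; exact hR4
    generalize 2 • R = T at hR2 h4R
    rcases T with _ | ⟨d, e, h₁⟩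
    · exact absurd rfl hR2
    · rw [two_nsmul_eq_zero_iff_of_form two_ne_zero rfl rfl] at h4R
      subst h4R
      exact ⟨d, h₁, rfl⟩
  have hd0 : d ≠ 0 := by
    rintro rfl
    apply hR2'
    rw [h2d, toGeom_some, IsTwoIsogenous.origin]
    simp
  rcases R with _ | ⟨p, q, hp⟩
  · exact absurd (nsmul_zero 2) hR2
  have hq0 : q ≠ 0 := by
    rwa [ne_eq, two_nsmul_eq_zero_iff_of_form two_ne_zero rfl rfl] at hR2
  have hd' : d ^ 2 + -a / 2 * d + (a ^ 2 - 4 * b) / 16 = 0 := by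
    have : 0 ^ 2 = d * (d ^ 2 + -a / 2 * d + (a ^ 2 - 4 * b) / 16) :=
      form_equation rfl rfl rfl h₁
    rw [zero_pow two_ne_zero, zero_eq_mul] at this
    exact this.resolve_left hd0
  -- As `e₀` is a root of `x² + ax + b`, `(2e₀ + a)/4` is a square root of `(a² - 4b)/16`; it plays
  -- the part of `x(Q)` on `E(4)`.
  obtain ⟨σ, u, hσ, hA, hB, hr, rfl, rfl⟩ := exists_sigma (A := -a / 2)
    (B := (a ^ 2 - 4 * b) / 16) (r := (2 * e₀ + a) / 4) (div_ne_zero hd (by norm_num))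
    (by linear_combination heq / 4)
    (form_equation rfl rfl rfl hp) hq0 hd' (sq_add_eq_of_two_nsmul_eq rfl rfl rfl hd0 h2d)
  have ha' : a = u ^ 2 * (2 + (σ + σ⁻¹) ^ 2 / 2) := by
    rw [lam] at hA
    linear_combination -2 * hA
  have he' : e₀ = u ^ 2 * (-(σ - 1) ^ 4 / (4 * σ ^ 2)) := by
    have : e₀ = 2 * (u ^ 2 * ((σ + σ⁻¹) / 2)) - u ^ 2 * (2 + (σ + σ⁻¹) ^ 2 / 2) / 2 := by
      linear_combination 2 * hr - ha' / 2
    rw [this]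
    field_simp
    ring
  have hb' : b = u ^ 4 * ((σ - σ⁻¹) ^ 4 / 16) := by
    rw [show b = a ^ 2 / 4 - 4 * ((a ^ 2 - 4 * b) / 16) by ring, hB, ha', lam]
    field_simp
    ring
  have hC := scaling_smul_twoTorsionForm u ha' hb'
  have hu : algebraMap K (AlgebraicClosure K) u ≠ 0 := (map_ne_zero _).2 u.ne_zero
  rcases U with _ | ⟨x, y, hxy⟩
  · exact absurd (by simp [← Affine.Point.zero_def]) h4U0
  have hm := (dualIsogenyMaps_baseChange_iff H hxy _).2 hR.symm
  rw [map_mul, map_mul, map_pow, map_pow] at hm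
  refine ⟨σ, ⟨hσ, Δ_ne_zero_of_smul_eq hC hΔ⟩, _, hC, _, _, _, 0,
    ⟨hm.of_scale hu (by rw [← map_pow, ← map_mul, ← hb']), rfl, rfl⟩,
    carries_baseChange_scaling u _ ?_ ?_, ?_⟩
  · field_simp
  · field_simp
  · rw [toGeom_some]
    apply carries_baseChange_scaling u _
    · rw [← map_pow, ← map_mul, ← he']
    · rw [map_zero, mul_zero]

lemma level82_isMarkedFibre (W : WeierstrassCurve K) (hW : W.IsElliptic) (U Q : GeomPoint W)
    (hl : level82 K W U Q) :
    IsMarkedFibre E82 {σ : K | σ ≠ 0 ∧ (E82 σ).Δ ≠ 0} mark82 W U Q := by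
  classical
  have h8 := addOrderOf_nsmul_eq_zero U
  rw [hl.1] at h8
  have hD : addOrderOf (4 • U) = 2 := by
    rw [addOrderOf_nsmul_of_dvd four_ne_zero (by rw [hl.1]; norm_num), hl.1]
  obtain ⟨A, B, C, hC, h₀, e⟩ := exists_twoTorsionForm hD fun g ↦ by
    rw [gal_nsmul]
    rcases (hl.2.2.2 g).1 with h | h <;> rw [h]
    rw [← mul_nsmul, show 5 * 4 = 8 + (8 + 4) from rfl, add_nsmul, add_nsmul, h8, zero_add,
      zero_add]
  obtain ⟨U', rfl⟩ := geomHom_surjective hC U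
  obtain ⟨Q', rfl⟩ := geomHom_surjective hC Q
  rw [← geomHom_nsmul] at e
  refine IsMarkedFibre.of_smul hC (level82_isMarkedFibre_form ?_ (level82_of_smul hC hl)
    (geomHom_injective hC e))
  exact Δ_ne_zero_of_smul_eq hC (Δ_ne_zero_of_isElliptic hW)

lemma isUniversal_level82 (K : Type*) [Field K] [CharZero K] :
    IsUniversal (level82 K) E82 {σ : K | σ ≠ 0 ∧ (E82 σ).Δ ≠ 0} mark82 := by
  classical
  refine isUniversal_of (fun σ hσ ↦ ⟨isElliptic_of_Δ_ne_zero hσ.2, level82_fibre hσ.1 hσ.2⟩)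
    level82_isMarkedFibre ?_
  rintro σ ⟨hσ, h⟩ σ' ⟨hσ', h'⟩ C hC x₁ y₁ x₂ y₂ x₁' y₁' x₂' y₂' h₁ h₁' h₂ h₂' ⟨hm, rfl, rfl⟩
    ⟨hm', rfl, rfl⟩ e₁ e₂
  have key : ∀ {σ : K} (hσ : σ ≠ 0) (h : (E82 σ).Δ ≠ 0) {x y} (hxy),
      DualIsogenyMaps (algebraMap K (AlgebraicClosure K) ((σ - σ⁻¹) ^ 4 / 16)) x y
        (algebraMap K _ ((σ ^ 2 + 1) / 2)) (algebraMap K _ ((σ ^ 4 - 1) / (4 * σ))) →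
      4 • (.some x y hxy : GeomPoint (E82 σ)) = (E82_isTwoIsogenous hσ h).kerPoint := by
    intro σ hσ h x y hxy hm
    exact E82_four_nsmul hσ h ((E4_Δ_ne_zero_iff hσ).2 ((E82_Δ_ne_zero_iff hσ).1 h))
      ((dualIsogenyMaps_baseChange_iff _ hxy _).1 hm)
  have e := congrArg (4 • ·) e₁
  simp only [← geomHom_nsmul, key hσ h h₁ hm, key hσ' h' h₁' hm'] at e
  have hC' := eq_scaling_of_origin hC rfl rfl e
  have hC₂ := hC
  rw [hC'] at hC₂
  obtain ⟨ha, hb⟩ := twoTorsionForm_eq_of_scaling_smul hC₂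
  rw [geomHom_some_eq_iff, hC'] at e₁ e₂
  simp only [map_zero, add_zero, mul_zero, zero_mul] at e₁ e₂
  obtain ⟨rfl, rfl⟩ := e₁
  obtain ⟨f₁, f₂⟩ := hm.scale ((map_ne_zero _).2 C.u.ne_zero)
    (by rw [← map_pow, ← map_mul, ← hb]) hm'
  simp only [← map_pow, ← map_mul] at f₁ f₂ e₂
  have hinj := (algebraMap K (AlgebraicClosure K)).injective
  have f₃ := hinj e₂.1
  obtain ⟨g₁, g₂⟩ := (E82_Δ_ne_zero_iff hσ).1 h
  -- Together with `a₂`, the `x`-coordinate of `Q` determines `σ + σ⁻¹` up to the factor `u²`, as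
  -- `sigma_unique` requires.
  have hx : ∀ σ : K, σ ≠ 0 → -(σ - 1) ^ 4 / (4 * σ ^ 2) =
      (σ + σ⁻¹) - (2 + (σ + σ⁻¹) ^ 2 / 2) / 2 := by
    intro σ hσ
    field_simp
    ring
  rw [hx σ hσ, hx σ' hσ'] at f₃
  obtain ⟨rfl, hu⟩ := sigma_unique (u := (C.u : K)) (by linear_combination f₃ + ha / 2) hσ hσ' g₁ g₂
    (hinj f₁) (hinj f₂)
  refine ⟨rfl, ?_⟩
  rw [hC', VariableChange.one_def, Units.ext hu (v := 1)]

end Level82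

end TateModular

namespace TateModular

open WeierstrassCurve

/-! ### The point of order 8 on the two-torsion model of `E₁(8)` -/

section E18Form

variable {K : Type*} [Field K]

lemma E18Form_nonsingular {k : K} (h : (E8412 k).Δ ≠ 0) :
    (E18Form k).toAffine.Nonsingular (4 * k ^ 3 * (1 - k)) (-4 * k ^ 3 * (2 * k - 1) * (k - 1)) :=
  twoTorsionForm_nonsingular (E18Form_Δ_ne_zero h) (by ring)

lemma E18Form_nonsingular_zero {k : K} (h : (E8412 k).Δ ≠ 0) :
    (E18Form k).toAffine.Nonsingular 0 0 :=
  twoTorsionForm_nonsingular (E18Form_Δ_ne_zero h) (by ring)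

lemma E8412_two_mul_ne_zero {k : K} (h : (E8412 k).Δ ≠ 0) : 2 * k ≠ 0 :=
  mul_ne_zero (E8412_ne_zero h).1 (E8412_ne_zero h).2.1

lemma vcHom_E18Change [DecidableEq K] {k : K} (h : (E8412 k).Δ ≠ 0)
    (hO : (E18 k).toAffine.Nonsingular 0 0) :
    vcHom (E18Change_smul k (E8412_two_mul_ne_zero h)) (.some 0 0 hO) =
      .some _ _ (E18Form_nonsingular h) := by
  rw [vcHom_some, Affine.Point.some.injEq, E18Change]
  constructor <;> ring

lemma E18Form_addOrderOf [DecidableEq K] {k : K} (h : (E8412 k).Δ ≠ 0) :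
    addOrderOf (.some _ _ (E18Form_nonsingular h) : (E18Form k).toAffine.Point) = 8 := by
  have hΔ := E18_Δ_ne_zero h
  rw [← vcHom_E18Change h (E18_nonsingular_zero hΔ), addOrderOf_vcHom]
  exact (tate_addOrderOf_eq_eight_iff (tate_ne_zero_of_Δ_ne_zero hΔ)).2
    ⟨k, (E8412_ne_zero h).2.1, rfl, rfl⟩

lemma E18Form_four_nsmul [DecidableEq K] {k : K} (h : (E8412 k).Δ ≠ 0) :
    4 • (.some _ _ (E18Form_nonsingular h) : (E18Form k).toAffine.Point) =
      .some 0 0 (E18Form_nonsingular_zero h) := by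
  have hΔ := E18_Δ_ne_zero h
  have hO := E18_nonsingular_zero hΔ
  obtain ⟨h₄, e₄⟩ := E18_four_nsmul (E8412_ne_zero h).2.1 hΔ hO
  rw [← vcHom_E18Change h hO, ← map_nsmul, e₄, vcHom_some, Affine.Point.some.injEq, E18Change,
    Units.val_mk0]
  constructor <;> ring

lemma carries_E18Change [DecidableEq K] {k : K} (h : (E8412 k).Δ ≠ 0) :
    Carries (E18Change k (E8412_two_mul_ne_zero h))
      (.some _ _ (E18Form_nonsingular h) : (E18Form k).toAffine.Point) 0 0 :=
  (carries_iff (E18Change_smul k _)).2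
    ⟨E18_nonsingular_zero (E18_Δ_ne_zero h), (vcHom_E18Change h _).symm⟩

lemma E8412_Δ_ne_zero {k : K} (h2 : (2 : K) ≠ 0) (hk : k ≠ 0) (h : (E18 k).Δ ≠ 0) :
    (E8412 k).Δ ≠ 0 := by
  rw [E18_Δ k hk] at h
  rw [E8412_Δ]
  have h₁ : k - 1 ≠ 0 := fun h0 ↦ h (by rw [h0]; simp)
  have h₃ : 2 * k - 1 ≠ 0 := fun h0 ↦ h (by rw [h0]; simp)
  have h₄ : 8 * k ^ 2 - 8 * k + 1 ≠ 0 := fun h0 ↦ h (by rw [h0]; simp)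
  positivity

lemma eq_scaling_of_r_t {W W' : WeierstrassCurve K} {C : VariableChange K} (h2 : (2 : K) ≠ 0)
    (h : C • W = W') (ha : W.a₁ = 0) (ha' : W'.a₁ = 0) (hr : C.r = 0) (ht : C.t = 0) :
    C = ⟨C.u, 0, 0, 0⟩ := by
  have hs : C.s = 0 := by
    rw [← h, variableChange_a₁, ha, zero_add, mul_eq_zero, or_iff_right (Units.ne_zero _)] at ha'
    exact (mul_eq_zero.1 ha').resolve_left h2
  ext <;> simp [hr, hs, ht]

/-- Universality of `E₁(8)` gives `k`, and undoing `E18Change` lands on `E18Form k`. Since `4R` is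
the origin on both curves, the remaining change of variables is a scaling. -/
lemma exists_E18Form [DecidableEq K] {A B : K} (hΔ : (twoTorsionForm A B).Δ ≠ 0)
    {R : (twoTorsionForm A B).toAffine.Point} (hR : addOrderOf R = 8) {h₀}
    (hR4 : 4 • R = .some 0 0 h₀) :
    ∃ (k : K) (u : Kˣ), (E8412 k).Δ ≠ 0 ∧
      A = u ^ 2 * (8 * k ^ 4 - 16 * k ^ 3 + 16 * k ^ 2 - 8 * k + 1) ∧
      B = u ^ 4 * (2 * k * (k - 1)) ^ 4 ∧
      ∃ h, R = .some (u ^ 2 * (4 * k ^ 3 * (1 - k)))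
        (u ^ 3 * (-4 * k ^ 3 * (2 * k - 1) * (k - 1))) h := by
  have h2 := (twoTorsionForm_ne_zero hΔ).1
  obtain ⟨⟨k, C⟩, ⟨⟨hk, hkΔ⟩, hC, hP⟩, -⟩ := (isUniversalGamma1_eight K).2 _
    (isElliptic_of_Δ_ne_zero hΔ) R (by convert hR)
  dsimp only at hk hkΔ hC hP
  have h := E8412_Δ_ne_zero h2 hk hkΔ
  have hE := E18Change_smul k (E8412_two_mul_ne_zero h)
  obtain ⟨D, rfl⟩ : ∃ D, C = E18Change k (E8412_two_mul_ne_zero h) * D :=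
    ⟨_, (mul_inv_cancel_left _ _).symm⟩
  have hD : D • twoTorsionForm A B = E18Form k := by
    rw [mul_smul, ← hE] at hC
    exact smul_left_cancel _ hC
  obtain ⟨hO, rfl⟩ := (carries_iff hC).1 hP
  rw [vcHom_mul hD hE hC, vcHom_E18Change h] at hR4 ⊢
  rw [← map_nsmul, E18Form_four_nsmul h, vcHom_some, Affine.Point.some.injEq] at hR4
  have hD' := eq_scaling_of_r_t h2 hD rfl rfl (by simpa using hR4.1) (by simpa using hR4.2)
  have hD₂ := hD
  rw [hD'] at hD₂
  obtain ⟨hA, hB⟩ := twoTorsionForm_eq_of_scaling_smul hD₂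
  refine ⟨k, D.u, h, hA, hB, ?_⟩
  have hns := nonsingular_of_variableChange hD (E18Form_nonsingular h)
  have hr : D.r = 0 := by rw [hD']
  have hs : D.s = 0 := by rw [hD']
  have ht : D.t = 0 := by rw [hD']
  rw [hr, hs, ht, mul_zero, zero_mul, add_zero, add_zero, add_zero] at hns
  refine ⟨hns, ?_⟩
  rw [vcHom_some, Affine.Point.some.injEq, hr, hs, ht]
  constructor <;> ring

end E18Form

/-! ### The universal curve `E(8;4,1,2)`, by transfer to `E₁(8)` -/

section Level8412

variable {K : Type*} [Field K] [CharZero K]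

lemma E8412_isTwoIsogenous {k : K} (h : (E8412 k).Δ ≠ 0) :
    IsTwoIsogenous (algebraMap K (AlgebraicClosure K) (1 / 2)) ((E8412 k)⁄(AlgebraicClosure K))
      ((E18Form k)⁄(AlgebraicClosure K)) :=
  isTwoIsogenous_half h (by ring) (by ring)

/-- Here `D` generates the kernel, and `4U` lies over the origin of `E18Form`. Thus `4U` is a point
of order two outside the kernel, which gives both the order of `U` and `D ≠ 4U`. -/
lemma level8412_fibre {k : K} (h : (E8412 k).Δ ≠ 0) : ∃ x₁ y₁ h₁ x₂ y₂ h₂,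
    mark8412 k x₁ y₁ x₂ y₂ ∧ level8412 K (E8412 k) (.some x₁ y₁ h₁) (.some x₂ y₂ h₂) := by
  classical
  have H := E8412_isTwoIsogenous h
  obtain ⟨U, hU⟩ := twoIsog_surjective H (toGeom (.some _ _ (E18Form_nonsingular h)))
  have e : twoIsog H (4 • U) = H.origin := by
    rw [map_nsmul, hU, ← map_nsmul, E18Form_four_nsmul h, toGeom_some, IsTwoIsogenous.origin]
    simp
  obtain ⟨e₁, e₂, e₃⟩ := (twoIsog_eq_origin_iff H _).1 e
  have e₈ : addOrderOf U = 8 := by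
    refine addOrderOf_eq_prime_pow (p := 2) (n := 2) e₂ ?_
    rw [show 2 ^ (2 + 1) = 4 * 2 from rfl, mul_nsmul]
    exact e₁
  have hgal : ∀ g, gal g U = U ∨ gal g U = U + H.kerPoint := fun g ↦
    gal_eq_or_eq_add_kerPoint H g (by rw [hU, gal_toGeom])
  rcases U with _ | ⟨x, y, hxy⟩
  · rw [← Affine.Point.zero_def, addOrderOf_zero] at e₈
    omega
  have hm := (dualIsogenyMaps_baseChange_iff H hxy _).2 hU
  refine ⟨x, y, hxy, 0, 0, _, ⟨hm, rfl, rfl⟩, e₈, ?_, Ne.symm e₃, fun g ↦ ⟨hgal g, ?_⟩⟩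
  · refine addOrderOf_eq_prime ?_ (Affine.Point.some_ne_zero _)
    rw [two_nsmul]
    exact H.kerPoint_add_self
  · obtain ⟨h', e⟩ := gal_some g (H.nonsingular (x := 0) (y := 0) (by ring))
    simp only [map_zero] at e
    exact e

/-- Dividing by `D` turns `U` into a rational point `R`. As `4U` has order two and differs from `D`,
`4R` is the origin, so `R` has order 8. -/
lemma level8412_isMarkedFibre_form {a b : K} (hΔ : (twoTorsionForm a b).Δ ≠ 0)
    {U D : GeomPoint (twoTorsionForm a b)} (hl : level8412 K _ U D) {h₀}
    (hD : D = .some 0 0 h₀) :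
    IsMarkedFibre E8412 {k : K | (E8412 k).Δ ≠ 0} mark8412 _ U D := by
  classical
  obtain ⟨hU8, -, hne, hg⟩ := hl
  obtain ⟨-, hb, hd⟩ := twoTorsionForm_ne_zero hΔ
  have H := isTwoIsogenous_half hΔ rfl rfl
  replace hD : D = H.kerPoint := hD
  subst hD
  obtain ⟨R, hR⟩ := exists_toGeom_eq (P := twoIsog H U) fun g ↦ gal_twoIsog_eq H (hg g).1
  have h8 := addOrderOf_nsmul_eq_zero U
  rw [hU8, show 8 = 4 * 2 from rfl, mul_nsmul] at h8
  have h4 : 4 • U ≠ 0 := by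
    intro h
    have := Nat.le_of_dvd (by norm_num) (addOrderOf_dvd_of_nsmul_eq_zero h)
    omega
  have hO : twoIsog H (4 • U) = H.origin := (twoIsog_eq_origin_iff H _).2 ⟨h8, h4, hne.symm⟩
  have hΔ' : (twoTorsionForm (-a / 2) ((a ^ 2 - 4 * b) / 16)).Δ ≠ 0 := by
    apply twoTorsionForm_Δ_ne_zero two_ne_zero (div_ne_zero hd (by norm_num))
    rw [show (-a / 2) ^ 2 - 4 * ((a ^ 2 - 4 * b) / 16) = b by ring]
    exact hb
  have hR4 : 4 • R = .some 0 0 (twoTorsionForm_nonsingular hΔ' (by ring)) := by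
    apply toGeom_injective
    rw [map_nsmul, hR, ← map_nsmul, hO, toGeom_some, IsTwoIsogenous.origin]
    simp
  have hR8 : addOrderOf R = 8 := by
    refine addOrderOf_eq_prime_pow (p := 2) (n := 2) ?_ ?_
    · rw [show 2 ^ 2 = 4 from rfl, hR4]
      exact Affine.Point.some_ne_zero _
    · rw [show 2 ^ (2 + 1) = 4 * 2 from rfl, mul_nsmul, hR4,
        two_nsmul_eq_zero_iff_of_form two_ne_zero rfl rfl]
  obtain ⟨k, u, hk, hA, hB, hp, rfl⟩ := exists_E18Form hΔ' hR8 hR4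
  have ha' : a = u ^ 2 * (-2 * (8 * k ^ 4 - 16 * k ^ 3 + 16 * k ^ 2 - 8 * k + 1)) := by
    linear_combination -2 * hA
  have hb' : b = u ^ 4 * ((8 * k ^ 2 - 8 * k + 1) * (2 * k - 1) ^ 4) := by
    rw [show b = a ^ 2 / 4 - 4 * ((a ^ 2 - 4 * b) / 16) by ring, hB, ha']
    ring
  have hC := scaling_smul_twoTorsionForm u ha' hb'
  have hu : algebraMap K (AlgebraicClosure K) u ≠ 0 := (map_ne_zero _).2 u.ne_zero
  rcases U with _ | ⟨x, y, hxy⟩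
  · exact absurd (nsmul_zero 4) h4
  have hm : DualIsogenyMaps _ x y
      (algebraMap K (AlgebraicClosure K) (u ^ 2 * (4 * k ^ 3 * (1 - k))))
      (algebraMap K (AlgebraicClosure K) (u ^ 3 * (-4 * k ^ 3 * (2 * k - 1) * (k - 1)))) :=
    (dualIsogenyMaps_baseChange_iff H hxy _).2 hR.symm
  rw [map_mul (algebraMap K _) ((u : K) ^ 2), map_mul (algebraMap K _) ((u : K) ^ 3), map_pow,
    map_pow] at hm
  refine ⟨k, hk, _, hC, _, _, 0, 0,
    ⟨hm.of_scale hu (by rw [← map_pow, ← map_mul, ← hb']), rfl, rfl⟩,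
    carries_baseChange_scaling u _ ?_ ?_, carries_baseChange_scaling u _ ?_ ?_⟩
  · field_simp
  · field_simp
  · rw [mul_zero]
  · rw [mul_zero]

lemma level8412_isMarkedFibre (W : WeierstrassCurve K) (hW : W.IsElliptic) (U D : GeomPoint W)
    (hl : level8412 K W U D) :
    IsMarkedFibre E8412 {k : K | (E8412 k).Δ ≠ 0} mark8412 W U D := by
  classical
  obtain ⟨A, B, C, hC, h₀, e⟩ := exists_twoTorsionForm hl.2.1 fun g ↦ (hl.2.2.2 g).2
  obtain ⟨U', rfl⟩ := geomHom_surjective hC U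
  obtain ⟨D', rfl⟩ := geomHom_surjective hC D
  refine IsMarkedFibre.of_smul hC (level8412_isMarkedFibre_form ?_ (level8412_of_smul hC hl)
    (geomHom_injective hC e))
  exact Δ_ne_zero_of_smul_eq hC (Δ_ne_zero_of_isElliptic hW)

lemma isUniversal_level8412 (K : Type*) [Field K] [CharZero K] :
    IsUniversal (level8412 K) E8412 {k : K | (E8412 k).Δ ≠ 0} mark8412 := by
  classical
  refine isUniversal_of (fun k hk ↦ ⟨isElliptic_of_Δ_ne_zero hk, level8412_fibre hk⟩)
    level8412_isMarkedFibre ?_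
  rintro k h k' h' C hC x₁ y₁ x₂ y₂ x₁' y₁' x₂' y₂' h₁ h₁' h₂ h₂' ⟨hm, rfl, rfl⟩
    ⟨hm', rfl, rfl⟩ e₁ e₂
  have hC' := eq_scaling_of_origin hC rfl rfl e₂
  have hC₂ := hC
  rw [hC'] at hC₂
  obtain ⟨ha, hb⟩ := twoTorsionForm_eq_of_scaling_smul hC₂
  rw [geomHom_some_eq_iff, hC'] at e₁
  simp only [map_zero, add_zero, mul_zero, zero_mul] at e₁
  obtain ⟨rfl, rfl⟩ := e₁
  obtain ⟨f₁, f₂⟩ := hm.scale ((map_ne_zero _).2 C.u.ne_zero)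
    (by rw [← map_pow, ← map_mul, ← hb]) hm'
  simp only [← map_pow, ← map_mul] at f₁ f₂
  have hinj := (algebraMap K (AlgebraicClosure K)).injective
  replace f₁ := hinj f₁
  replace f₂ := hinj f₂
  -- The target of the isogeny has coefficients `-a/2` and `(a² - 4b)/16`, so the same scaling
  -- relates the targets.
  have hS : (⟨C.u, 0, 0, 0⟩ : VariableChange K) • E18Form k = E18Form k' := by
    apply scaling_smul_twoTorsionForm
    · linear_combination -ha / 2
    · generalize hα : 8 * k ^ 4 - 16 * k ^ 3 + 16 * k ^ 2 - 8 * k + 1 = α at ha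
      have h16 : (2 * k * (k - 1)) ^ 4 =
          (α ^ 2 - (8 * k ^ 2 - 8 * k + 1) * (2 * k - 1) ^ 4) / 4 := by
        rw [← hα]; ring
      have hα' : α = C.u ^ 2 * (8 * k' ^ 4 - 16 * k' ^ 3 + 16 * k' ^ 2 - 8 * k' + 1) := by
        linear_combination -ha / 2
      rw [h16, hb, hα']
      ring
  have hcar : Carries (⟨C.u, 0, 0, 0⟩ : VariableChange K)
      (.some _ _ (E18Form_nonsingular h) : (E18Form k).toAffine.Point)
      (4 * k' ^ 3 * (1 - k')) (-4 * k' ^ 3 * (2 * k' - 1) * (k' - 1)) := by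
    rw [carries_iff hS]
    refine ⟨E18Form_nonsingular h', ?_⟩
    rw [vcHom_some, Affine.Point.some.injEq]
    exact ⟨by linear_combination f₁, by linear_combination f₂⟩
  have hcar' : Carries (E18Change k' (E8412_two_mul_ne_zero h') * ⟨C.u, 0, 0, 0⟩)
      (.some _ _ (E18Form_nonsingular h) : (E18Form k).toAffine.Point) 0 0 := by
    obtain ⟨_, e⟩ := (carries_iff hS).1 hcar
    rw [e]
    exact (carries_E18Change h').mul hS (E18Change_smul k' _)
  -- Two isomorphisms of one curve with a point of order 8 onto fibres of `E₁(8)`: they coincide,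
  -- which yields both `k = k'` and the triviality of the scaling.
  have huniq := ((isUniversalGamma1_eight K).2 (E18Form k)
    (isElliptic_of_Δ_ne_zero (E18Form_Δ_ne_zero h)) _ (E18Form_addOrderOf h)).unique
    (y₁ := (k, E18Change k (E8412_two_mul_ne_zero h)))
    (y₂ := (k', E18Change k' (E8412_two_mul_ne_zero h') * ⟨C.u, 0, 0, 0⟩))
    ⟨⟨(E8412_ne_zero h).2.1, E18_Δ_ne_zero h⟩, E18Change_smul k _, carries_E18Change h⟩
    ⟨⟨(E8412_ne_zero h').2.1, E18_Δ_ne_zero h'⟩,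
      by dsimp only; rw [mul_smul, hS, E18Change_smul], hcar'⟩
  obtain ⟨rfl, hu⟩ := Prod.mk.inj huniq
  exact ⟨rfl, by rw [hC']; exact (mul_eq_left.1 hu.symm)⟩

end Level8412

end TateModular

namespace TateModular

open WeierstrassCurve

/-! ### The universal curve `E(6,2)` -/

section Level62

variable {K : Type*} [Field K]

/-- The two-torsion cubic has the root `x(3P) = 1 - a`; this is the quadratic cofactor. -/
lemma E16_two_torsion_quadratic {a x y : K}
    (h : (E16 a).toAffine.Equation x y)
    (h' : 2 * y + a * x + -((a - 1) * (a - 2)) = 0) (hx : x ≠ 1 - a) :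
    4 * x ^ 2 - (3 * a - 2) * (a - 2) * x + (a - 1) * (a - 2) ^ 2 = 0 := by
  rw [Affine.equation_iff] at h
  simp only [E16, tate] at h
  apply mul_left_cancel₀ (sub_ne_zero.2 hx)
  linear_combination -4 * h + (2 * y + a * x + -((a - 1) * (a - 2))) * h'

lemma E62_sub_ne_zero {ξ : K} (hξ : ξ ^ 2 ≠ 9) : ξ - 3 ≠ 0 ∧ ξ + 3 ≠ 0 ∧ ξ ^ 2 - 9 ≠ 0 :=
  ⟨fun h ↦ hξ (by linear_combination (ξ + 3) * h), fun h ↦ hξ (by linear_combination (ξ - 3) * h),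
    sub_ne_zero.2 hξ⟩

lemma E62_sub_two {ξ : K} (hξ : ξ ^ 2 ≠ 9) :
    (2 * ξ ^ 2 - 10) / (ξ ^ 2 - 9) - 2 = 8 / (ξ ^ 2 - 9) := by
  have := (E62_sub_ne_zero hξ).2.2
  field_simp
  ring

lemma E62_sub_one_ne_zero {ξ : K} (h : (E62 ξ).Δ ≠ 0) : (2 * ξ ^ 2 - 10) / (ξ ^ 2 - 9) - 1 ≠ 0 := by
  have hb := tate_ne_zero_of_Δ_ne_zero h
  rw [neg_ne_zero] at hb
  exact left_ne_zero_of_mul hb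

lemma E62_y_eq {ξ : K} (hξ : ξ ^ 2 ≠ 9) :
    2 * (-8 * (ξ - 1) ^ 2 / ((ξ - 3) ^ 3 * (ξ + 3) ^ 2)) +
      (2 * ξ ^ 2 - 10) / (ξ ^ 2 - 9) * (4 * (ξ - 1) / ((ξ - 3) ^ 2 * (ξ + 3))) +
      -(((2 * ξ ^ 2 - 10) / (ξ ^ 2 - 9) - 1) * ((2 * ξ ^ 2 - 10) / (ξ ^ 2 - 9) - 2)) = 0 := by
  obtain ⟨h₁, h₂, h₃⟩ := E62_sub_ne_zero hξ
  rw [show ξ ^ 2 - 9 = (ξ - 3) * (ξ + 3) by ring]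
  field_simp
  ring

lemma E62_nonsingular {ξ : K} (hξ : ξ ^ 2 ≠ 9) (h : (E62 ξ).Δ ≠ 0) :
    (E62 ξ).toAffine.Nonsingular (4 * (ξ - 1) / ((ξ - 3) ^ 2 * (ξ + 3)))
      (-8 * (ξ - 1) ^ 2 / ((ξ - 3) ^ 3 * (ξ + 3) ^ 2)) := by
  have := isElliptic_of_Δ_ne_zero h
  refine (Affine.equation_iff_nonsingular).1 ?_
  rw [Affine.equation_iff]
  simp only [E62, E16, tate]
  obtain ⟨h₁, h₂, h₃⟩ := E62_sub_ne_zero hξ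
  rw [show ξ ^ 2 - 9 = (ξ - 3) * (ξ + 3) by ring]
  field_simp
  ring

lemma level62_fibre {ξ : K} (hξ : ξ ^ 2 ≠ 9) (h : (E62 ξ).Δ ≠ 0) : ∃ x₁ y₁ h₁ x₂ y₂ h₂,
    mark62 ξ x₁ y₁ x₂ y₂ ∧ level62 K (E62 ξ) (.some x₁ y₁ h₁) (.some x₂ y₂ h₂) := by
  classical
  have hb := tate_ne_zero_of_Δ_ne_zero h
  have hO : (E62 ξ).toAffine.Nonsingular 0 0 := tate_nonsingular hb
  have h6 : addOrderOf (.some 0 0 hO : (E62 ξ).toAffine.Point) = 6 :=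
    (tate_addOrderOf_eq_six_iff hb).2 rfl
  obtain ⟨h₃, e₃⟩ := tate_three_nsmul (h := hO) hb
  have hQ := E62_nonsingular hξ h
  have hQ2 : addOrderOf (.some _ _ hQ : (E62 ξ).toAffine.Point) = 2 := by
    refine addOrderOf_eq_prime ?_ (Affine.Point.some_ne_zero _)
    rw [two_nsmul, add_self_eq_zero_iff]
    exact E62_y_eq hξ
  have hne : (.some _ _ hQ : (E62 ξ).toAffine.Point) ≠ 3 • .some 0 0 hO := by
    intro h0
    have hx := (Affine.Point.some.inj (h0.trans e₃)).1
    have h1 := E62_sub_one_ne_zero h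
    obtain ⟨g₁, g₂, g₃⟩ := E62_sub_ne_zero hξ
    have hξ1 : ξ - 1 ≠ 0 := by
      intro h0
      apply h1
      field_simp
      linear_combination (ξ + 1) * h0
    rw [show ξ ^ 2 - 9 = (ξ - 3) * (ξ + 3) by ring] at hx
    field_simp at hx
    -- Equality of the two `x`-coordinates reduces to `(ξ - 1)³ = 0`, and `ξ = 1` would give `a =
    -- 1`.
    apply pow_ne_zero 3 hξ1
    linear_combination hx
  have e₀ : toGeom (W := E62 ξ) (.some 0 0 hO) = .some 0 0 (nonsingular_origin hO) := by
    simp [toGeom_some]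
  refine ⟨0, 0, nonsingular_origin hO, _, _, nonsingular_algebraMap hQ, ⟨rfl, rfl, rfl, rfl⟩,
    ?_, ?_, ?_, fun g ↦ ⟨?_, gal_algebraMap g _⟩⟩
  · rw [← e₀, addOrderOf_injective _ toGeom_injective, h6]
  · rw [← addOrderOf_injective _ toGeom_injective, toGeom_some] at hQ2
    exact hQ2
  · rw [← e₀, ← map_nsmul, ← toGeom_some hQ]
    exact toGeom_injective.ne hne
  · rw [← e₀, gal_toGeom]

variable [CharZero K]

/-- For given `a` the coordinate is affine linear in `ξ`, so `a` and `Q` determine `ξ`. -/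
lemma E62_x_eq {ξ : K} (hξ : ξ ^ 2 ≠ 9) :
    4 * (ξ - 1) / ((ξ - 3) ^ 2 * (ξ + 3)) = ((2 * ξ ^ 2 - 10) / (ξ ^ 2 - 9) - 2) *
      (3 * ((2 * ξ ^ 2 - 10) / (ξ ^ 2 - 9)) - 2 + ((2 * ξ ^ 2 - 10) / (ξ ^ 2 - 9) - 2) * ξ) /
        8 := by
  obtain ⟨h₁, h₂, h₃⟩ := E62_sub_ne_zero hξ
  rw [show ξ ^ 2 - 9 = (ξ - 3) * (ξ + 3) by ring]
  field_simp
  ring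

lemma level62_isMarkedFibre (W : WeierstrassCurve K) (hW : W.IsElliptic) (P Q : GeomPoint W)
    (hl : level62 K W P Q) :
    IsMarkedFibre E62 {ξ : K | ξ ^ 2 ≠ 9 ∧ (E62 ξ).Δ ≠ 0} mark62 W P Q := by
  classical
  obtain ⟨h6, h2, hne, hg⟩ := hl
  obtain ⟨P₀, rfl⟩ := exists_toGeom_eq fun g ↦ (hg g).1
  obtain ⟨Q₀, rfl⟩ := exists_toGeom_eq fun g ↦ (hg g).2
  rw [← map_nsmul, toGeom_injective.ne_iff] at hne
  rw [addOrderOf_injective _ toGeom_injective] at h6 h2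
  obtain ⟨⟨a, C⟩, ⟨hΔ, hC, hP⟩, -⟩ := (isUniversalGamma1_six K).2 W hW P₀ h6
  dsimp only at hΔ hC hP
  obtain ⟨hO, rfl⟩ := (carries_iff hC).1 hP
  obtain ⟨Q', rfl⟩ := vcHom_surjective hC Q₀
  have hb := tate_ne_zero_of_Δ_ne_zero (a := a) hΔ
  obtain ⟨h₃, e₃⟩ := tate_three_nsmul (h := hO) hb
  rw [neg_ne_zero] at hb
  have ha₁ := left_ne_zero_of_mul hb
  have ha₂ := right_ne_zero_of_mul hb
  rw [← map_nsmul, (vcHom_injective hC).ne_iff] at hne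
  rw [addOrderOf_vcHom] at h2
  have h2Q := addOrderOf_nsmul_eq_zero Q'
  rw [h2] at h2Q
  rcases Q' with _ | ⟨x, y, hxy⟩
  · rw [← Affine.Point.zero_def, addOrderOf_zero] at h2
    omega
  rw [two_nsmul, add_self_eq_zero_iff] at h2Q
  have h2Q' : 2 * y + a * x + -((a - 1) * (a - 2)) = 0 := h2Q
  have hx : x ≠ 1 - a := by
    rintro rfl
    obtain rfl : y = a - 1 - -((a - 1) * (a - 2)) := by linear_combination h2Q' / 2
    exact hne e₃.symm
  have hquad := E16_two_torsion_quadratic hxy.1 h2Q' hx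
  -- The quadratic has discriminant `(a - 2)³(9a - 10)`. Writing its square root as `(a - 2)²ξ`
  -- gives `(a - 2)ξ² = 9a - 10`, which is solved for `a`.
  obtain ⟨ξ, hξ⟩ : ∃ ξ, x = (a - 2) * (3 * a - 2 + (a - 2) * ξ) / 8 :=
    ⟨(8 * x / (a - 2) - (3 * a - 2)) / (a - 2), by field_simp; ring⟩
  have hξ2 : (a - 2) * (ξ ^ 2 - 9) = 8 := by
    subst hξ
    apply mul_left_cancel₀ (pow_ne_zero 3 ha₂)
    linear_combination 16 * hquad
  have hξ9 : ξ ^ 2 - 9 ≠ 0 := fun h0 ↦ by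
    rw [h0, mul_zero] at hξ2
    norm_num at hξ2
  obtain rfl : a = (2 * ξ ^ 2 - 10) / (ξ ^ 2 - 9) := by
    rw [eq_div_iff hξ9]
    linear_combination hξ2
  have hξ9' : ξ ^ 2 ≠ 9 := sub_ne_zero.1 hξ9
  rw [← E62_x_eq hξ9'] at hξ
  subst hξ
  obtain rfl : y = -8 * (ξ - 1) ^ 2 / ((ξ - 3) ^ 3 * (ξ + 3) ^ 2) := by
    linear_combination h2Q' / 2 - E62_y_eq hξ9' / 2
  have hC' : C • W = E62 ξ := hC
  have key : ∀ {x y : K} (hxy : (E62 ξ).toAffine.Nonsingular x y),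
      toGeom (vcHom hC' (.some x y hxy)) = geomHom hC' (toGeom (.some x y hxy)) := by
    intro x y hxy
    rw [vcHom_some, toGeom_some, toGeom_some, geomHom_some_eq_iff]
    simp only [map_add, map_mul, map_pow, and_self]
  refine ⟨ξ, ⟨hξ9', hΔ⟩, C, hC, 0, 0, _, _, ⟨rfl, rfl, rfl, rfl⟩,
    (carries_iff (baseChange_smul _ hC')).2 ⟨nonsingular_origin hO, ?_⟩,
    (carries_iff (baseChange_smul _ hC')).2 ⟨nonsingular_algebraMap hxy, key hxy⟩⟩
  have hO' : (E62 ξ).toAffine.Nonsingular 0 0 := hO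
  refine (key hO').trans ?_
  rw [toGeom_some]
  simp only [map_zero]

lemma isUniversal_level62 (K : Type*) [Field K] [CharZero K] :
    IsUniversal (level62 K) E62 {ξ : K | ξ ^ 2 ≠ 9 ∧ (E62 ξ).Δ ≠ 0} mark62 := by
  classical
  refine isUniversal_of (fun ξ hξ ↦ ⟨isElliptic_of_Δ_ne_zero hξ.2, level62_fibre hξ.1 hξ.2⟩)
    level62_isMarkedFibre ?_
  rintro ξ ⟨hξ, h⟩ ξ' ⟨hξ', h'⟩ C hC x₁ y₁ x₂ y₂ x₁' y₁' x₂' y₂' h₁ h₁' h₂ h₂' ⟨rfl, rfl, rfl, rfl⟩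
    ⟨rfl, rfl, rfl, rfl⟩ e₁ e₂
  rw [geomHom_some_eq_iff] at e₁ e₂
  have hr : C.r = 0 := by simpa using e₁.1.symm
  have ht : C.t = 0 := by simpa using e₁.2.symm
  have hO : (E62 ξ).toAffine.Nonsingular 0 0 := tate_nonsingular (tate_ne_zero_of_Δ_ne_zero h)
  have hO' : (E62 ξ').toAffine.Nonsingular 0 0 := tate_nonsingular (tate_ne_zero_of_Δ_ne_zero h')
  have h6 : addOrderOf (.some 0 0 hO : (E62 ξ).toAffine.Point) = 6 :=
    (tate_addOrderOf_eq_six_iff (tate_ne_zero_of_Δ_ne_zero h)).2 rfl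
  have hc : Carries C (.some 0 0 hO : (E62 ξ).toAffine.Point) 0 0 := by
    rw [carries_iff hC]
    refine ⟨hO', ?_⟩
    simp [hr, ht]
  have hc₁ : Carries 1 (.some 0 0 hO : (E62 ξ).toAffine.Point) 0 0 := by
    rw [carries_iff (one_smul _ _)]
    refine ⟨hO, ?_⟩
    simp [VariableChange.one_def]
  -- Since `C` fixes the point of order 6, uniqueness for `E₁(6)` already gives `C = 1` and equal
  -- values of `a`.
  obtain ⟨ha, rfl⟩ := Prod.mk.inj (((isUniversalGamma1_six K).2 (E62 ξ)
    (isElliptic_of_Δ_ne_zero h) _ h6).unique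
    (y₁ := ((2 * ξ ^ 2 - 10) / (ξ ^ 2 - 9), 1)) (y₂ := ((2 * ξ' ^ 2 - 10) / (ξ' ^ 2 - 9), C))
    ⟨h, one_smul _ _, hc₁⟩ ⟨h', hC, hc⟩)
  refine ⟨?_, rfl⟩
  have hx := (algebraMap K (AlgebraicClosure K)).injective
    (by simpa only [VariableChange.one_def, Units.val_one, map_one, one_pow, one_mul, map_zero,
      add_zero] using e₂.1)
  rw [E62_x_eq hξ, E62_x_eq hξ', ← ha] at hx
  have h0 : (2 * ξ ^ 2 - 10) / (ξ ^ 2 - 9) - 2 ≠ 0 := by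
    rw [E62_sub_two hξ]
    exact div_ne_zero (by norm_num) (sub_ne_zero.2 hξ)
  generalize (2 * ξ ^ 2 - 10) / (ξ ^ 2 - 9) = a at *
  apply mul_left_cancel₀ (pow_ne_zero 2 h0)
  linear_combination 8 * hx

end Level62

end TateModular

namespace TateModular

open WeierstrassCurve

/-! ## Singular fibres of a polynomial model -/

section Minimal

open WithZero

variable {F : Type*} [Field F] {v : Valuation (RatFunc F) ℤᵐ⁰} {W : WeierstrassCurve (RatFunc F)}

lemma IsIntegralAt.exists_map (h : IsIntegralAt v W) :
    ∃ W₀ : WeierstrassCurve v.valuationSubring, W₀.map (algebraMap v.valuationSubring _) = W :=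
  ⟨⟨⟨_, h.1⟩, ⟨_, h.2.1⟩, ⟨_, h.2.2.1⟩, ⟨_, h.2.2.2.1⟩, ⟨_, h.2.2.2.2⟩⟩, rfl⟩

lemma IsIntegralAt.c₄_le (h : IsIntegralAt v W) : v W.c₄ ≤ 1 := by
  obtain ⟨W₀, rfl⟩ := h.exists_map
  rw [map_c₄]
  exact W₀.c₄.2

lemma IsIntegralAt.Δ_le (h : IsIntegralAt v W) : v W.Δ ≤ 1 := by
  obtain ⟨W₀, rfl⟩ := h.exists_map
  rw [map_Δ]
  exact W₀.Δ.2

/-- A change of variables multiplies `c₄` by `u⁻⁴` and `Δ` by `u⁻¹²`. If `u⁻¹` had a pole, one of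
these would cease to be integral. -/
lemma isMinimalAt_of (h : IsIntegralAt v W) (h' : v W.c₄ = 1 ∨ exp (-12) < v W.Δ) :
    IsMinimalAt v W := by
  refine ⟨h, fun C hC ↦ ?_⟩
  rw [variableChange_Δ, map_mul, map_pow]
  suffices hu : v ↑C.u⁻¹ ≤ 1 from mul_le_of_le_one_left' (pow_le_one' hu _)
  by_contra! hu
  rcases h' with h' | h'
  · have := hC.c₄_le
    rw [variableChange_c₄, map_mul, map_pow, h', mul_one] at this
    exact absurd (one_lt_pow' hu four_ne_zero) this.not_gt
  · have := hC.Δ_le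
    rw [variableChange_Δ, map_mul, map_pow] at this
    have h1 : exp 1 ≤ v ↑C.u⁻¹ := by
      have h0 : v ↑C.u⁻¹ ≠ 0 := (zero_lt_one.trans hu).ne'
      rw [← exp_zero, ← lt_log_iff_exp_lt h0] at hu
      exact (le_log_iff_exp_le h0).1 hu
    have h12 : exp 12 ≤ v ↑C.u⁻¹ ^ 12 := by
      have := pow_le_pow_left' h1 12
      rwa [← exp_nsmul] at this
    refine absurd this (not_le.2 ?_)
    calc (1 : ℤᵐ⁰) = exp 12 * exp (-12) := by rw [← exp_add]; rfl
      _ < exp 12 * v W.Δ := by gcongr; exact exp_pos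
      _ ≤ _ := by gcongr

lemma hasKodairaType_I {c : OnePoint F} {C : VariableChange (RatFunc F)} {n : ℕ}
    (h : IsIntegralAt (placeVal c) (C • W)) (hΔ : placeVal c (C • W).Δ = exp (-(n : ℤ)))
    (hc₄ : n ≠ 0 → placeVal c (C • W).c₄ = 1) : HasKodairaType W c (.I n) := by
  refine ⟨C, isMinimalAt_of h ?_, hΔ, fun hn ↦ hc₄ hn.ne'⟩
  -- A smooth fibre carries no condition on `c₄`; minimality then comes from `Δ` being a unit.
  by_cases hn : n = 0
  · right
    rw [hΔ, exp_lt_exp, hn]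
    norm_num
  · exact Or.inl (hc₄ hn)

end Minimal

/-! ### Valuations at finite places and at infinity -/

section Places

open WithZero Polynomial

variable {F : Type*} [Field F]

lemma placeVal_coe_X_sub_C (c : F) :
    placeVal (c : OnePoint F) (algebraMap F[X] (RatFunc F) (X - C c)) = exp (-1) := by
  change (finitePlace c).valuation (RatFunc F) _ = _
  rw [IsDedekindDomain.HeightOneSpectrum.valuation_of_algebraMap]
  exact IsDedekindDomain.HeightOneSpectrum.intValuation_singleton _ (X_sub_C_ne_zero c) rfl

lemma placeVal_coe_eq_one {c : F} {p : F[X]} (hp : p.eval c ≠ 0) :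
    placeVal (c : OnePoint F) (algebraMap F[X] (RatFunc F) p) = 1 := by
  change (finitePlace c).valuation (RatFunc F) _ = _
  rw [IsDedekindDomain.HeightOneSpectrum.valuation_of_algebraMap,
    IsDedekindDomain.HeightOneSpectrum.intValuation_eq_one_iff]
  change p ∉ Ideal.span {X - C c}
  rwa [Ideal.mem_span_singleton, dvd_iff_isRoot]

lemma placeVal_coe_le_one (c : F) (p : F[X]) :
    placeVal (c : OnePoint F) (algebraMap F[X] (RatFunc F) p) ≤ 1 :=
  (finitePlace c).valuation_le_one (K := RatFunc F) p

lemma placeVal_coe {c : F} {p : F[X]} (hp : p ≠ 0) :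
    placeVal (c : OnePoint F) (algebraMap F[X] (RatFunc F) p) =
      exp (-(p.rootMultiplicity c : ℤ)) := by
  obtain ⟨q, hq, hc⟩ := exists_eq_pow_rootMultiplicity_mul_and_not_dvd p hp c
  have hc' : q.eval c ≠ 0 := by rwa [dvd_iff_isRoot] at hc
  conv_lhs => rw [hq]
  rw [map_mul, map_mul, map_pow, map_pow, placeVal_coe_X_sub_C, placeVal_coe_eq_one hc', mul_one,
    ← exp_nsmul]
  simp

lemma placeVal_infty {p : F[X]} (hp : p ≠ 0) :
    placeVal (OnePoint.infty : OnePoint F) (algebraMap F[X] (RatFunc F) p) =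
      exp (p.natDegree : ℤ) := by
  classical
  exact RatFunc.inftyValuation.polynomial F hp

lemma placeVal_infty_X :
    placeVal (OnePoint.infty : OnePoint F) RatFunc.X = exp 1 := by
  classical
  exact RatFunc.inftyValuation.X F

/-- The scaling of coordinates by `t ^ d`. -/
noncomputable def scalingX (F : Type*) [Field F] (d : ℕ) : VariableChange (RatFunc F) :=
  ⟨Units.mk0 (RatFunc.X ^ d) (pow_ne_zero d RatFunc.X_ne_zero), 0, 0, 0⟩

lemma placeVal_infty_scaling (d n : ℕ) {p : F[X]} (hp : p ≠ 0) :
    placeVal (OnePoint.infty : OnePoint F)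
      (((scalingX F d).u⁻¹ : (RatFunc F)ˣ) ^ n * algebraMap F[X] (RatFunc F) p) =
      exp (p.natDegree - n * d : ℤ) := by
  rw [scalingX, Units.val_inv_eq_inv_val, Units.val_mk0, map_mul, map_pow, map_inv₀, map_pow,
    placeVal_infty_X, placeVal_infty hp, ← exp_nsmul, ← exp_neg, ← exp_nsmul, ← exp_add]
  congr 1
  simp
  ring

lemma placeVal_infty_scaling_le (d n : ℕ) {p : F[X]} (hp : p.natDegree ≤ n * d) :
    placeVal (OnePoint.infty : OnePoint F)
      (((scalingX F d).u⁻¹ : (RatFunc F)ˣ) ^ n * algebraMap F[X] (RatFunc F) p) ≤ 1 := by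
  by_cases h0 : p = 0
  · simp [h0]
  · rw [placeVal_infty_scaling d n h0, ← exp_zero, exp_le_exp]
    have : (p.natDegree : ℤ) ≤ n * d := by exact_mod_cast hp
    linarith

end Places

/-! ### Kodaira types read off a polynomial model -/

section PolynomialModel

open WithZero Polynomial

variable {F : Type*} [Field F] {W : WeierstrassCurve (RatFunc F)} {V : WeierstrassCurve F[X]}
  {C : VariableChange (RatFunc F)}

lemma hasKodairaType_coe (h : C • W = V.map (algebraMap F[X] (RatFunc F))) (hΔ : V.Δ ≠ 0) {c : F}
    (hc : V.Δ.eval c = 0 → V.c₄.eval c ≠ 0) :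
    HasKodairaType W (c : OnePoint F) (.I (V.Δ.rootMultiplicity c)) := by
  apply hasKodairaType_I (C := C)
  · rw [h]
    exact ⟨placeVal_coe_le_one _ _, placeVal_coe_le_one _ _, placeVal_coe_le_one _ _,
      placeVal_coe_le_one _ _, placeVal_coe_le_one _ _⟩
  · rw [h, map_Δ, placeVal_coe hΔ]
  · intro hn
    rw [h, map_c₄, placeVal_coe_eq_one (hc _)]
    exact (rootMultiplicity_pos hΔ).1 (Nat.pos_of_ne_zero hn)

/-- The coefficients `aᵢ` have degree at most `i d`. -/
structure DegreeLE (V : WeierstrassCurve F[X]) (d : ℕ) : Prop where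
  a₁ : V.a₁.natDegree ≤ 1 * d
  a₂ : V.a₂.natDegree ≤ 2 * d
  a₃ : V.a₃.natDegree ≤ 3 * d
  a₄ : V.a₄.natDegree ≤ 4 * d
  a₆ : V.a₆.natDegree ≤ 6 * d

lemma DegreeLE.isIntegralAt {d : ℕ} (hV : DegreeLE V d) :
    IsIntegralAt (placeVal (OnePoint.infty : OnePoint F))
      (scalingX F d • V.map (algebraMap F[X] (RatFunc F))) := by
  have e₁ := placeVal_infty_scaling_le _ _ hV.a₁
  rw [pow_one] at e₁
  refine ⟨?_, ?_, ?_, ?_, ?_⟩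
  · simpa [variableChange_a₁, scalingX] using e₁
  · simpa [variableChange_a₂, scalingX] using placeVal_infty_scaling_le _ _ hV.a₂
  · simpa [variableChange_a₃, scalingX] using placeVal_infty_scaling_le _ _ hV.a₃
  · simpa [variableChange_a₄, scalingX] using placeVal_infty_scaling_le _ _ hV.a₄
  · simpa [variableChange_a₆, scalingX] using placeVal_infty_scaling_le _ _ hV.a₆

/-- Scaling by `t^d` makes the model integral at infinity, with discriminant of order `12d - deg Δ`;
the coefficient of `t^(4d)` in `c₄` is the value of the new `c₄` there. -/
lemma hasKodairaType_infty_I (h : C • W = V.map (algebraMap F[X] (RatFunc F))) {d n : ℕ}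
    (hV : DegreeLE V d) (hΔ : V.Δ ≠ 0) (hn : V.Δ.natDegree + n = 12 * d)
    (hc₄ : V.c₄.coeff (4 * d) ≠ 0) :
    HasKodairaType W OnePoint.infty (.I n) := by
  have h' : (scalingX F d * C) • W = scalingX F d • V.map (algebraMap F[X] (RatFunc F)) := by
    rw [mul_smul, h]
  have hint := hV.isIntegralAt
  apply hasKodairaType_I (C := scalingX F d * C) <;> rw [h']
  · exact hint
  · rw [variableChange_Δ, map_Δ, placeVal_infty_scaling _ _ hΔ]
    congr 1
    push_cast
    have : (V.Δ.natDegree + n : ℤ) = 12 * d := by exact_mod_cast hn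
    linarith
  · intro _
    apply le_antisymm hint.c₄_le
    have h0 : V.c₄ ≠ 0 := fun h0 ↦ hc₄ (by rw [h0, coeff_zero])
    rw [variableChange_c₄, map_c₄, placeVal_infty_scaling _ _ h0, ← exp_zero, exp_le_exp]
    have : (4 * d : ℤ) ≤ V.c₄.natDegree := by exact_mod_cast le_natDegree_of_ne_zero hc₄
    push_cast
    linarith

/-- The bound `n < 6` keeps the order `n + 6` of the discriminant below 12, which ensures minimality
although `c₄` vanishes. -/
lemma hasKodairaType_infty_Istar (h : C • W = V.map (algebraMap F[X] (RatFunc F))) {d n : ℕ}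
    (hV : DegreeLE V d) (hn0 : n < 6) (hΔ : V.Δ ≠ 0) (hn : V.Δ.natDegree + (n + 6) = 12 * d)
    (h₄ : V.c₄ ≠ 0) (hc₄ : V.c₄.natDegree + 2 = 4 * d)
    (h₆ : V.c₆ ≠ 0) (hc₆ : V.c₆.natDegree + 3 = 6 * d) :
    HasKodairaType W OnePoint.infty (.Istar n) := by
  have h' : (scalingX F d * C) • W = scalingX F d • V.map (algebraMap F[X] (RatFunc F)) := by
    rw [mul_smul, h]
  have eΔ : placeVal (OnePoint.infty : OnePoint F)
      (scalingX F d • V.map (algebraMap F[X] (RatFunc F))).Δ = exp (-(n + 6 : ℤ)) := by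
    rw [variableChange_Δ, map_Δ, placeVal_infty_scaling _ _ hΔ]
    congr 1
    push_cast
    have : (V.Δ.natDegree + (n + 6) : ℤ) = 12 * d := by exact_mod_cast hn
    linarith
  have e₄ : placeVal (OnePoint.infty : OnePoint F)
      (scalingX F d • V.map (algebraMap F[X] (RatFunc F))).c₄ = exp (-2) := by
    rw [variableChange_c₄, map_c₄, placeVal_infty_scaling _ _ h₄]
    congr 1
    push_cast
    have : (V.c₄.natDegree + 2 : ℤ) = 4 * d := by exact_mod_cast hc₄
    linarith
  have e₆ : placeVal (OnePoint.infty : OnePoint F)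
      (scalingX F d • V.map (algebraMap F[X] (RatFunc F))).c₆ = exp (-3) := by
    rw [variableChange_c₆, map_c₆, placeVal_infty_scaling _ _ h₆]
    congr 1
    push_cast
    have : (V.c₆.natDegree + 3 : ℤ) = 6 * d := by exact_mod_cast hc₆
    linarith
  refine ⟨scalingX F d * C, ?_, ?_⟩ <;> rw [h']
  · apply isMinimalAt_of hV.isIntegralAt
    right
    rw [eΔ, exp_lt_exp]
    have : (n : ℤ) < 6 := by exact_mod_cast hn0
    linarith
  · exact ⟨eΔ, e₄.le, e₆.le, fun _ ↦ ⟨e₄, e₆⟩⟩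

lemma monic_list_prod (l : List (F × ℕ)) :
    (l.map fun p ↦ (X - Polynomial.C p.1) ^ p.2 : List F[X]).prod.Monic := by
  induction l with
  | nil => exact monic_one
  | cons p l ih =>
    rw [List.map_cons, List.prod_cons]
    exact ((monic_X_sub_C _).pow _).mul ih

lemma natDegree_list_prod (l : List (F × ℕ)) :
    (l.map fun p ↦ (X - Polynomial.C p.1) ^ p.2 : List F[X]).prod.natDegree =
      (l.map Prod.snd).sum := by
  induction l with
  | nil => simp
  | cons p l ih =>
    rw [List.map_cons, List.prod_cons, ((monic_X_sub_C _).pow _).natDegree_mul (monic_list_prod l),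
      ih, (monic_X_sub_C _).natDegree_pow, natDegree_X_sub_C, mul_one, List.map_cons, List.sum_cons]

lemma rootMultiplicity_list_prod {e : F} (he : e ≠ 0) (l : List (F × ℕ)) (c : F) [DecidableEq F] :
    (Polynomial.C e * (l.map fun p ↦ (X - Polynomial.C p.1) ^ p.2).prod).rootMultiplicity c =
      (l.map fun p ↦ if p.1 = c then p.2 else 0).sum := by
  have hne := fun l : List (F × ℕ) ↦ (monic_list_prod l).ne_zero
  have hC : (Polynomial.C e : F[X]) ≠ 0 := C_ne_zero.2 he
  rw [rootMultiplicity_mul (mul_ne_zero hC (hne l)), rootMultiplicity_C, zero_add]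
  induction l with
  | nil => simp
  | cons p l ih =>
    have h0 : (X - Polynomial.C p.1) ^ p.2 ≠ 0 := pow_ne_zero _ (X_sub_C_ne_zero _)
    rw [List.map_cons, List.prod_cons, rootMultiplicity_mul (mul_ne_zero h0 (hne l)), ih,
      List.map_cons, List.sum_cons]
    congr 1
    split_ifs with hp
    · rw [hp, rootMultiplicity_X_sub_C_pow]
    · apply rootMultiplicity_eq_zero
      simp [sub_eq_zero, Ne.symm hp]

lemma sum_ite_of_nodup {α : Type*} [DecidableEq α] {l : List (α × ℕ)}
    (hl : (l.map Prod.fst).Nodup) {p : α × ℕ} (hp : p ∈ l) :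
    (l.map fun q ↦ if q.1 = p.1 then q.2 else 0).sum = p.2 := by
  induction l with
  | nil => simp at hp
  | cons q l ih =>
    rw [List.map_cons, List.nodup_cons] at hl
    rw [List.map_cons, List.sum_cons]
    rcases List.mem_cons.1 hp with rfl | hp
    · rw [if_pos rfl, List.sum_eq_zero, add_zero]
      intro x hx
      obtain ⟨r, hr, rfl⟩ := List.mem_map.1 hx
      exact if_neg fun h : r.1 = p.1 ↦ hl.1 (h ▸ List.mem_map_of_mem hr)
    · rw [if_neg fun h : q.1 = p.1 ↦ hl.1 (h ▸ List.mem_map_of_mem hp), zero_add, ih hl.2 hp]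

lemma singularFibres_of_polynomial_model [Infinite F]
    (h : C • W = V.map (algebraMap F[X] (RatFunc F))) {e : F} (he : e ≠ 0) {l : List (F × ℕ)}
    (hl : (l.map Prod.fst).Nodup) (hl0 : ∀ p ∈ l, p.2 ≠ 0)
    (hΔ : ∀ x, (V.map (evalRingHom x)).Δ = e * (l.map fun p ↦ (x - p.1) ^ p.2).prod)
    (hc₄ : ∀ p ∈ l, (V.map (evalRingHom p.1)).c₄ ≠ 0) {T : KodairaType}
    (hT : V.Δ.natDegree = (l.map Prod.snd).sum → V.Δ ≠ 0 → HasKodairaType W OnePoint.infty T)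
    (hT0 : T ≠ .I 0) :
    SingularFibres W (T ::ₘ (l.map fun p ↦ KodairaType.I p.2 : Multiset KodairaType)) := by
  classical
  have hV : V.Δ = Polynomial.C e * (l.map fun p ↦ (X - Polynomial.C p.1) ^ p.2).prod := by
    -- Over an infinite field the factorisation of `Δ` may be checked on values.
    apply Polynomial.funext
    intro x
    have := hΔ x
    rw [map_Δ, coe_evalRingHom] at this
    rw [this, eval_mul, eval_C, ← coe_evalRingHom, map_list_prod, List.map_map]
    simp [Function.comp_def]
  have hV0 : V.Δ ≠ 0 := hV ▸ mul_ne_zero (C_ne_zero.2 he) (monic_list_prod (F := F) l).ne_zero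
  have hdeg : V.Δ.natDegree = (l.map Prod.snd).sum := by
    rw [hV, natDegree_C_mul he, natDegree_list_prod]
  have hmult := fun c ↦ rootMultiplicity_list_prod he l c
  rw [← hV] at hmult
  have hroot : ∀ c, V.Δ.rootMultiplicity c ≠ 0 ↔ c ∈ l.map Prod.fst := by
    intro c
    constructor
    · intro hc
      by_contra hcl
      rw [hmult, List.sum_eq_zero] at hc
      · exact hc rfl
      · intro x hx
        obtain ⟨r, hr, rfl⟩ := List.mem_map.1 hx
        exact if_neg fun h : r.1 = c ↦ hcl (h ▸ List.mem_map_of_mem hr)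
    · intro hc
      obtain ⟨p, hp, rfl⟩ := List.mem_map.1 hc
      rw [hmult, sum_ite_of_nodup hl hp]
      exact hl0 p hp
  obtain ⟨f, hf₀, hf⟩ : ∃ f : Option F → KodairaType, f none = T ∧
      ∀ c, f (some c) = .I (V.Δ.rootMultiplicity c) :=
    ⟨fun c ↦ c.elim T fun c ↦ .I (V.Δ.rootMultiplicity c), rfl, fun _ ↦ rfl⟩
  -- `none` is the point at infinity, counted as singular by `hT0`.
  refine ⟨Finset.insertNone (l.map Prod.fst).toFinset, f, ?_, ?_, ?_⟩
  · rintro (_ | c)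
    · rw [hf₀]
      exact hT hdeg hV0
    · rw [hf]
      apply hasKodairaType_coe h hV0
      intro hc
      obtain ⟨p, hp, rfl⟩ := List.mem_map.1 ((hroot c).1
        ((rootMultiplicity_pos hV0).2 hc).ne')
      have := hc₄ p hp
      rwa [map_c₄] at this
  · rintro (_ | c)
    · rw [hf₀]
      exact iff_of_true hT0 Finset.none_mem_insertNone
    · rw [hf, ne_eq, KodairaType.I.injEq]
      refine (hroot c).trans ?_
      rw [← List.mem_toFinset]
      exact Finset.some_mem_insertNone.symm
  · change Multiset.map f (none ::ₘ (l.map Prod.fst).toFinset.val.map some) = _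
    rw [Multiset.map_cons, Multiset.map_map, List.toFinset_val, hl.dedup, Multiset.map_coe,
      List.map_map, hf₀]
    congr 2
    apply List.map_congr_left
    intro p hp
    rw [Function.comp_apply, Function.comp_apply, hf, hmult, sum_ite_of_nodup hl hp]

end PolynomialModel

end TateModular

namespace TateModular

open WeierstrassCurve

/-! ### Models all of whose singular fibres are multiplicative -/

section Semistable

open Polynomial

variable {F : Type*} [Field F] {W : WeierstrassCurve (RatFunc F)} {V : WeierstrassCurve F[X]}
  {C : VariableChange (RatFunc F)}

/-- `c₄` has weight 4, so its coefficient in degree `4d` involves only the top coefficients of the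
`aᵢ`, that is, the reduction at infinity. -/
lemma DegreeLE.coeff_c₄ {d : ℕ} (hV : DegreeLE V d) : V.c₄.coeff (4 * d) =
    (⟨V.a₁.coeff d, V.a₂.coeff (2 * d), V.a₃.coeff (3 * d), V.a₄.coeff (4 * d),
      V.a₆.coeff (6 * d)⟩ : WeierstrassCurve F).c₄ := by
  have h₁ : V.a₁.natDegree ≤ d := by simpa using hV.a₁
  have hb₂ : V.b₂.natDegree ≤ 2 * d := by
    have := hV.a₂
    rw [WeierstrassCurve.b₂]
    compute_degree!
  have hb₂' : V.b₂.coeff (2 * d) = V.a₁.coeff d ^ 2 + 4 * V.a₂.coeff (2 * d) := by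
    rw [WeierstrassCurve.b₂, coeff_add, coeff_ofNat_mul, coeff_pow_of_natDegree_le h₁]
  have hb₄' : V.b₄.coeff (4 * d) =
      2 * V.a₄.coeff (4 * d) + V.a₁.coeff d * V.a₃.coeff (3 * d) := by
    rw [WeierstrassCurve.b₄, coeff_add, coeff_ofNat_mul, show 4 * d = d + 3 * d by ring,
      coeff_mul_add_eq_of_natDegree_le h₁ hV.a₃]
  rw [WeierstrassCurve.c₄, coeff_sub, coeff_ofNat_mul, show 4 * d = 2 * (2 * d) by ring,
    coeff_pow_of_natDegree_le hb₂, show 2 * (2 * d) = 4 * d by ring, hb₂', hb₄']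
  rfl

lemma singularFibres_of_semistable_model [Infinite F]
    (h : C • W = V.map (algebraMap F[X] (RatFunc F))) {e : F} (he : e ≠ 0) {l : List (F × ℕ)}
    (hl : (l.map Prod.fst).Nodup) (hl0 : ∀ p ∈ l, p.2 ≠ 0)
    (hΔ : ∀ x, (V.map (evalRingHom x)).Δ = e * (l.map fun p ↦ (x - p.1) ^ p.2).prod)
    (hc₄ : ∀ p ∈ l, (V.map (evalRingHom p.1)).c₄ ≠ 0) {d n : ℕ} (hd : DegreeLE V d) (hn0 : n ≠ 0)
    (hn : (l.map Prod.snd).sum + n = 12 * d)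
    (hinf : (⟨V.a₁.coeff d, V.a₂.coeff (2 * d), V.a₃.coeff (3 * d), V.a₄.coeff (4 * d),
      V.a₆.coeff (6 * d)⟩ : WeierstrassCurve F).c₄ ≠ 0)
    {L : List ℕ} (hL : L.Perm (n :: l.map Prod.snd)) :
    SingularFibres W (L.map KodairaType.I : Multiset KodairaType) := by
  have := singularFibres_of_polynomial_model h he hl hl0 hΔ hc₄
    (fun hdeg hΔ0 ↦ hasKodairaType_infty_I h hd hΔ0 (hdeg ▸ hn) (hd.coeff_c₄ ▸ hinf))
    (fun h ↦ hn0 (KodairaType.I.inj h))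
  rw [Multiset.coe_eq_coe.2 (hL.map KodairaType.I)]
  rw [List.map_cons, List.map_map]
  exact this

end Semistable

/-! ### The seven surfaces -/

section Surfaces

open Polynomial

variable {F : Type*} [Field F] [CharZero F]

lemma singularFibres_E14 : SingularFibres (E14 (RatFunc.X : RatFunc F))
    {.Istar 1, .I 4, .I 1} := by
  have h : (1 : VariableChange (RatFunc F)) • E14 (RatFunc.X : RatFunc F) =
      (⟨1, X, X, 0, 0⟩ : WeierstrassCurve F[X]).map (algebraMap F[X] (RatFunc F)) := by
    rw [one_smul]
    ext <;> simp [E14, tate]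
  -- `Δ = -16 t⁴(t - 1/16)` has degree 5, so its order at infinity is `12 - 5 = 7 = 1 + 6`.
  refine singularFibres_of_polynomial_model h (e := -16) (by norm_num)
    (l := [(0, 4), (1 / 16, 1)]) ?_ ?_ ?_ ?_ (T := .Istar 1) ?_ nofun
  · simp
  · simp
  · intro x
    simp [WeierstrassCurve.Δ, b₂, b₄, b₆, b₈]
    ring
  · simp only [List.forall_mem_cons, c₄, b₂, b₄, map_a₁, map_a₂, map_a₃, map_a₄, coe_evalRingHom]
    norm_num
  · intro hdeg hΔ
    have e₄ : (⟨1, X, X, 0, 0⟩ : WeierstrassCurve F[X]).c₄ = 16 * X ^ 2 - 16 * X + 1 := by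
      simp only [c₄, b₂, b₄]
      ring
    have e₆ : (⟨1, X, X, 0, 0⟩ : WeierstrassCurve F[X]).c₆ =
        -64 * X ^ 3 - 120 * X ^ 2 + 24 * X - 1 := by
      simp only [c₆, b₂, b₄, b₆]
      ring
    have d₄ : (16 * X ^ 2 - 16 * X + 1 : F[X]).natDegree = 2 := by compute_degree!
    have d₆ : (-64 * X ^ 3 - 120 * X ^ 2 + 24 * X - 1 : F[X]).natDegree = 3 := by compute_degree!
    refine hasKodairaType_infty_Istar h (d := 1) ⟨?_, ?_, ?_, ?_, ?_⟩ (by norm_num) hΔ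
      (by rw [hdeg]; simp) ?_ ?_ ?_ ?_
    · simp
    · simp
    · simp
    · simp
    · simp
    · rw [e₄]
      exact ne_zero_of_natDegree_gt (n := 0) (by rw [d₄]; norm_num)
    · rw [e₄, d₄]
    · rw [e₆]
      exact ne_zero_of_natDegree_gt (n := 0) (by rw [d₆]; norm_num)
    · rw [e₆, d₆]

lemma singularFibres_E16 : SingularFibres (E16 (RatFunc.X : RatFunc F))
    {.I 6, .I 3, .I 2, .I 1} := by
  have h : (1 : VariableChange (RatFunc F)) • E16 (RatFunc.X : RatFunc F) =
      (⟨X, -X ^ 2 + 3 * X - 2, -X ^ 2 + 3 * X - 2, 0, 0⟩ : WeierstrassCurve F[X]).map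
        (algebraMap F[X] (RatFunc F)) := by
    rw [one_smul]
    ext <;> simp [E16, tate, map_ofNat] <;> ring
  -- `Δ` has degree 10, leaving `I 2` at infinity.
  refine singularFibres_of_semistable_model h (e := 9) (by norm_num)
    (l := [(1, 6), (2, 3), (10 / 9, 1)])
    ?_ ?_ ?_ ?_ (d := 1) (n := 2) ⟨?_, ?_, ?_, ?_, ?_⟩
    (by norm_num) (by simp) ?_ (L := [6, 3, 2, 1])
    (show [6, 3, 2, 1].Perm [2, 6, 3, 1] by decide)
  · norm_num
  · simp
  · intro x
    simp [WeierstrassCurve.Δ, b₂, b₄, b₆, b₈]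
    ring
  · simp only [List.forall_mem_cons, c₄, b₂, b₄, map_a₁, map_a₂, map_a₃, map_a₄, coe_evalRingHom]
    norm_num
  · dsimp only; compute_degree!
  · dsimp only; compute_degree!
  · dsimp only; compute_degree!
  · dsimp only; compute_degree!
  · dsimp only; compute_degree!
  · simp only [c₄, b₂, b₄]
    have h0 : (X : F[X]).coeff (1 * 1) = 1 := by simp
    have h1 : (-X ^ 2 + 3 * X - 2 : F[X]).coeff (2 * 1) = -1 := by compute_degree!
    have h2 : (-X ^ 2 + 3 * X - 2 : F[X]).coeff (3 * 1) = 0 := by compute_degree!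
    simp only [h0, h1, h2, coeff_zero]
    norm_num

lemma X_sq_sub_nine_ne_zero (F : Type*) [Field F] : (RatFunc.X : RatFunc F) ^ 2 - 9 ≠ 0 := by
  have h : (X ^ 2 - 9 : F[X]) ≠ 0 := Monic.ne_zero (by monicity!)
  have := (map_ne_zero_iff _ (RatFunc.algebraMap_injective F)).2 h
  simpa [map_ofNat] using this

lemma roots_ne_of_sq_eq_two {s : F} (hs : s ^ 2 = 2) :
    0 ≠ (2 + s) / 4 ∧ 0 ≠ (2 - s) / 4 ∧ 1 ≠ (2 + s) / 4 ∧ 1 ≠ (2 - s) / 4 ∧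
      1 / 2 ≠ (2 + s) / 4 ∧ 1 / 2 ≠ (2 - s) / 4 ∧ (2 + s) / 4 ≠ (2 - s) / 4 := by
  have hs0 : s ≠ 0 := by
    rintro rfl
    norm_num at hs
  have d₁ : 0 ≠ (2 + s) / 4 := fun h ↦ two_ne_zero (α := F) (by
    linear_combination (4 * s - 8) * h + hs)
  have d₂ : 0 ≠ (2 - s) / 4 := fun h ↦ two_ne_zero (α := F) (by
    linear_combination (-8 - 4 * s) * h + hs)
  have d₃ : 1 ≠ (2 + s) / 4 := fun h ↦ two_ne_zero (α := F) (by
    linear_combination (8 + 4 * s) * h + hs)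
  have d₄ : 1 ≠ (2 - s) / 4 := fun h ↦ two_ne_zero (α := F) (by
    linear_combination (8 - 4 * s) * h + hs)
  have d₅ : 1 / 2 ≠ (2 + s) / 4 := fun h ↦ hs0 (by linear_combination -4 * h)
  have d₆ : 1 / 2 ≠ (2 - s) / 4 := fun h ↦ hs0 (by linear_combination 4 * h)
  have d₇ : (2 + s) / 4 ≠ (2 - s) / 4 := fun h ↦ hs0 (by linear_combination 2 * h)
  exact ⟨d₁, d₂, d₃, d₄, d₅, d₆, d₇⟩

variable [IsAlgClosed F]

lemma exists_root_cubic (F : Type*) [Field F] [IsAlgClosed F] :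
    ∃ r : F, r ^ 3 - 8 * r ^ 2 + 5 * r + 1 = 0 := by
  have hd : (X ^ 3 - 8 * X ^ 2 + 5 * X + 1 : F[X]).natDegree = 3 := by compute_degree!
  obtain ⟨r, hr⟩ := IsAlgClosed.exists_root (X ^ 3 - 8 * X ^ 2 + 5 * X + 1 : F[X])
    (fun h ↦ by rw [natDegree_eq_of_degree_eq_some h] at hd; norm_num at hd)
  exact ⟨r, by simpa using hr⟩

/-- The cubic factor of `Δ` is permuted by `r ↦ 1/(1 - r)`, of order three, which gives all its
roots from one. The degree of `Δ` is 17, leaving `I 7` at infinity. -/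
lemma singularFibres_E17 : SingularFibres (E17 (RatFunc.X : RatFunc F))
    {.I 7, .I 7, .I 7, .I 1, .I 1, .I 1} := by
  obtain ⟨r, hr⟩ := exists_root_cubic F
  have h0 : r ≠ 0 := by
    rintro rfl
    norm_num at hr
  have h1 : 1 - r ≠ 0 := by
    intro h
    obtain rfl : r = 1 := by linear_combination -h
    norm_num at hr
  -- A fixed point of `r ↦ 1/(1 - r)` would satisfy this quadratic; modulo it the cubic becomes `8 -
  -- 3r`.
  have h2 : r ^ 2 - r + 1 ≠ 0 := by
    intro h
    have h' : r = 8 / 3 := by linear_combination ((r - 7) * h - hr) / 3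
    rw [h'] at h
    norm_num at h
  have key : ∀ t : F, t ^ 3 - 8 * t ^ 2 + 5 * t + 1 = 0 →
      (⟨1 + t - t ^ 2, t ^ 2 - t ^ 3, t ^ 2 - t ^ 3, 0, 0⟩ : WeierstrassCurve F).c₄ ≠ 0 := by
    intro t ht h
    simp only [c₄, b₂, b₄] at h
    have : (49 : F) = 0 := by
      -- A Bézout identity between `c₄` and the cubic: the combination is the constant 49.
      linear_combination (1710 + 3005 * t - 444 * t ^ 2) * h +
        (-1661 - 1540 * t + 6776 * t ^ 2 - 693 * t ^ 3 - 6853 * t ^ 4 + 12530 * t ^ 5 -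
          4781 * t ^ 6 + 444 * t ^ 7) * ht
    norm_num at this
  have e₁ : (1 / (1 - r)) ^ 3 - 8 * (1 / (1 - r)) ^ 2 + 5 * (1 / (1 - r)) + 1 = 0 := by
    field_simp
    linear_combination -hr
  have e₂ : ((r - 1) / r) ^ 3 - 8 * ((r - 1) / r) ^ 2 + 5 * ((r - 1) / r) + 1 = 0 := by
    field_simp
    linear_combination -hr
  have hprod : ∀ x, (x - r) * ((x - 1 / (1 - r)) * (x - (r - 1) / r)) =
      x ^ 3 - 8 * x ^ 2 + 5 * x + 1 := by
    intro x
    field_simp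
    linear_combination (x ^ 2 - x) * hr
  have h : (1 : VariableChange (RatFunc F)) • E17 (RatFunc.X : RatFunc F) =
      (⟨1 + X - X ^ 2, X ^ 2 - X ^ 3, X ^ 2 - X ^ 3, 0, 0⟩ : WeierstrassCurve F[X]).map
        (algebraMap F[X] (RatFunc F)) := by
    rw [one_smul]
    ext <;> simp [E17, tate]
  refine singularFibres_of_semistable_model h (e := 1) (by norm_num)
    (l := [(0, 7), (1, 7), (r, 1), (1 / (1 - r), 1), ((r - 1) / r, 1)])
    ?_ ?_ ?_ ?_ (d := 2) (n := 7) ⟨?_, ?_, ?_, ?_, ?_⟩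
    (by norm_num) (by simp) ?_ (L := [7, 7, 7, 1, 1, 1])
    (show [7, 7, 7, 1, 1, 1].Perm [7, 7, 7, 1, 1, 1] by decide)
  · have d₁ : r ≠ 1 / (1 - r) := fun h ↦ h2 (by field_simp at h; linear_combination -h)
    have d₂ : r ≠ (r - 1) / r := fun h ↦ h2 (by field_simp at h; linear_combination h)
    have d₃ : 1 / (1 - r) ≠ (r - 1) / r := fun h ↦ h2 (by field_simp at h; linear_combination h)
    have d₄ : 0 ≠ 1 / (1 - r) := (one_div_ne_zero h1).symm
    have d₅ : 0 ≠ (r - 1) / r := (div_ne_zero (fun h ↦ h1 (by linear_combination -h)) h0).symm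
    have d₆ : 1 ≠ r := fun h ↦ h1 (by linear_combination h)
    have d₇ : 1 ≠ 1 / (1 - r) := fun h ↦ h0 (by field_simp at h; linear_combination -h)
    have d₈ : 1 ≠ (r - 1) / r := fun h ↦ one_ne_zero (α := F) (by
      field_simp at h; linear_combination h)
    simp only [List.map_cons, List.map_nil, List.nodup_cons, List.mem_cons, List.not_mem_nil,
      or_false, not_or, List.nodup_nil, not_false_eq_true, and_true]
    exact ⟨⟨zero_ne_one, h0.symm, d₄, d₅⟩, ⟨d₆, d₇, d₈⟩, ⟨d₁, d₂⟩, d₃⟩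
  · simp
  · intro x
    simp only [List.map_cons, List.map_nil, List.prod_cons, List.prod_nil, pow_one, mul_one, hprod]
    simp [WeierstrassCurve.Δ, b₂, b₄, b₆, b₈]
    ring
  · have e : ∀ t : F, (⟨1 + X - X ^ 2, X ^ 2 - X ^ 3, X ^ 2 - X ^ 3, 0, 0⟩ :
        WeierstrassCurve F[X]).map (evalRingHom t) =
        ⟨1 + t - t ^ 2, t ^ 2 - t ^ 3, t ^ 2 - t ^ 3, 0, 0⟩ := by
      intro t
      ext <;> simp
    simp only [List.forall_mem_cons, e]
    refine ⟨?_, ?_, key _ hr, key _ e₁, key _ e₂, by simp⟩ <;> simp [c₄, b₂, b₄]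
  · dsimp only; compute_degree!
  · dsimp only; compute_degree!
  · dsimp only; compute_degree!
  · dsimp only; compute_degree!
  · dsimp only; compute_degree!
  · simp only [c₄, b₂, b₄]
    have h0 : (1 + X - X ^ 2 : F[X]).coeff (1 * 2) = -1 := by compute_degree!
    have h1 : (X ^ 2 - X ^ 3 : F[X]).coeff (2 * 2) = 0 := by compute_degree!
    have h2 : (X ^ 2 - X ^ 3 : F[X]).coeff (3 * 2) = 0 := by compute_degree!
    simp only [h0, h1, h2, coeff_zero]
    norm_num

lemma singularFibres_E18 : SingularFibres (E18 (RatFunc.X : RatFunc F))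
    {.I 8, .I 8, .I 4, .I 2, .I 1, .I 1} := by
  obtain ⟨s, hs⟩ := IsAlgClosed.exists_pow_nat_eq (2 : F) two_pos
  -- Scaling with `u = 1/k` clears the denominator of `a`, at the cost of a factor `k¹²` in `Δ`.
  have h : (⟨Units.mk0 RatFunc.X⁻¹ (inv_ne_zero RatFunc.X_ne_zero), 0, 0, 0⟩ :
      VariableChange (RatFunc F)) • E18 (RatFunc.X : RatFunc F) =
      (⟨-2 * X ^ 2 + 4 * X - 1, -2 * X ^ 4 + 3 * X ^ 3 - X ^ 2,
        -2 * X ^ 5 + 3 * X ^ 4 - X ^ 3, 0, 0⟩ :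
        WeierstrassCurve F[X]).map
        (algebraMap F[X] (RatFunc F)) := by
    have hX : (RatFunc.X : RatFunc F) ≠ 0 := RatFunc.X_ne_zero
    ext <;> simp [E18, tate, map_ofNat, variableChange_def] <;> field_simp
  refine singularFibres_of_semistable_model h (e := 128) (by norm_num)
    (l := [(0, 8), (1, 8), (1 / 2, 4), ((2 + s) / 4, 1), ((2 - s) / 4, 1)])
    ?_ ?_ ?_ ?_ (d := 2) (n := 2) ⟨?_, ?_, ?_, ?_, ?_⟩
    (by norm_num) (by simp) ?_ (L := [8, 8, 4, 2, 1, 1])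
    (show [8, 8, 4, 2, 1, 1].Perm [2, 8, 8, 4, 1, 1] by decide)
  · obtain ⟨d₁, d₂, d₃, d₄, d₅, d₆, d₇⟩ := roots_ne_of_sq_eq_two hs
    simp only [List.map_cons, List.map_nil, List.nodup_cons, List.mem_cons, List.not_mem_nil,
      or_false, not_or, List.nodup_nil, not_false_eq_true, and_true]
    refine ⟨⟨zero_ne_one, ?_, d₁, d₂⟩, ⟨?_, d₃, d₄⟩, ⟨d₅, d₆⟩, d₇⟩ <;> norm_num
  · simp
  · intro x
    have e : x ^ 2 - x + 1 / 8 = (x - (2 + s) / 4) * (x - (2 - s) / 4) := by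
      linear_combination hs / 16
    simp only [List.map_cons, List.map_nil, List.prod_cons, List.prod_nil, pow_one, mul_one, ← e]
    simp [WeierstrassCurve.Δ, b₂, b₄, b₆, b₈]
    ring
  · simp only [List.forall_mem_cons, c₄, b₂, b₄, map_a₁, map_a₂, map_a₃, map_a₄, coe_evalRingHom]
    refine ⟨?_, ?_, ?_, ?_, ?_, by simp⟩
    · simp
    · norm_num
    · norm_num
    · intro h
      simp at h
      grind
    · intro h
      simp at h
      grind
  · dsimp only; compute_degree!
  · dsimp only; compute_degree!
  · dsimp only; compute_degree!
  · dsimp only; compute_degree!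
  · dsimp only; compute_degree!
  · simp only [c₄, b₂, b₄]
    have h0 : (-2 * X ^ 2 + 4 * X - 1 : F[X]).coeff (1 * 2) = -2 := by compute_degree!
    have h1 : (-2 * X ^ 4 + 3 * X ^ 3 - X ^ 2 : F[X]).coeff (2 * 2) = -2 := by compute_degree!
    have h2 : (-2 * X ^ 5 + 3 * X ^ 4 - X ^ 3 : F[X]).coeff (3 * 2) = 0 := by compute_degree!
    simp only [h0, h1, h2, coeff_zero]
    norm_num

lemma singularFibres_E62 : SingularFibres (E62 (RatFunc.X : RatFunc F))
    {.I 6, .I 6, .I 6, .I 2, .I 2, .I 2} := by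
  have hX := X_sq_sub_nine_ne_zero F
  have h : (⟨Units.mk0 (RatFunc.X ^ 2 - 9)⁻¹ (inv_ne_zero hX), 0, 0, 0⟩ :
      VariableChange (RatFunc F)) • E62 (RatFunc.X : RatFunc F) =
      (⟨2 * X ^ 2 - 10, -8 * X ^ 2 + 8, -8 * X ^ 4 + 80 * X ^ 2 - 72, 0, 0⟩ :
        WeierstrassCurve F[X]).map
        (algebraMap F[X] (RatFunc F)) := by
    ext <;> simp [E62, E16, tate, map_ofNat, variableChange_def] <;> field_simp <;> ring
  -- After clearing denominators by `ξ² - 9`, `Δ` has degree 18, leaving `I 6` at infinity.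
  refine singularFibres_of_semistable_model h (e := 4096) (by norm_num)
    (l := [(1, 6), (-1, 6), (0, 2), (3, 2), (-3, 2)])
    ?_ ?_ ?_ ?_ (d := 2) (n := 6) ⟨?_, ?_, ?_, ?_, ?_⟩
    (by norm_num) (by simp) ?_ (L := [6, 6, 6, 2, 2, 2])
    (show [6, 6, 6, 2, 2, 2].Perm [6, 6, 6, 2, 2, 2] by decide)
  · norm_num
  · simp
  · intro x
    simp [WeierstrassCurve.Δ, b₂, b₄, b₆, b₈]
    ring
  · simp only [List.forall_mem_cons, c₄, b₂, b₄, map_a₁, map_a₂, map_a₃, map_a₄, coe_evalRingHom]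
    norm_num
  · dsimp only; compute_degree!
  · dsimp only; compute_degree!
  · dsimp only; compute_degree!
  · dsimp only; compute_degree!
  · dsimp only; compute_degree!
  · simp only [c₄, b₂, b₄]
    have h0 : (2 * X ^ 2 - 10 : F[X]).coeff (1 * 2) = 2 := by compute_degree!
    have h1 : (-8 * X ^ 2 + 8 : F[X]).coeff (2 * 2) = 0 := by compute_degree!
    have h2 : (-8 * X ^ 4 + 80 * X ^ 2 - 72 : F[X]).coeff (3 * 2) = 0 := by compute_degree!
    simp only [h0, h1, h2, coeff_zero]
    norm_num

lemma singularFibres_E82 : SingularFibres (E82 (RatFunc.X : RatFunc F))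
    {.I 8, .I 8, .I 2, .I 2, .I 2, .I 2} := by
  obtain ⟨s, hs⟩ := IsAlgClosed.exists_pow_nat_eq (-1 : F) two_pos
  have hs0 : s ≠ 0 := by
    rintro rfl
    norm_num at hs
  have h : (⟨Units.mk0 RatFunc.X⁻¹ (inv_ne_zero RatFunc.X_ne_zero), 0, 0, 0⟩ :
      VariableChange (RatFunc F)) • E82 (RatFunc.X : RatFunc F) =
      (⟨0, C (1 / 2) * X ^ 4 + 3 * X ^ 2 + C (1 / 2), 0,
        C (1 / 16) * (X ^ 8 - 4 * X ^ 6 + 6 * X ^ 4 - 4 * X ^ 2 + 1), 0⟩ :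
        WeierstrassCurve F[X]).map
        (algebraMap F[X] (RatFunc F)) := by
    have hX : (RatFunc.X : RatFunc F) ≠ 0 := RatFunc.X_ne_zero
    ext <;> simp [E82, twoTorsionForm, map_ofNat, variableChange_def] <;> field_simp <;> ring
  -- Here `s` is a square root of `-1`, so `±s` are the zeros of `σ² + 1`; the degree is 22, leaving
  -- `I 2` at infinity.
  refine singularFibres_of_semistable_model h (e := 1 / 4) (by norm_num)
    (l := [(1, 8), (-1, 8), (0, 2), (s, 2), (-s, 2)])
    ?_ ?_ ?_ ?_ (d := 2) (n := 2) ⟨?_, ?_, ?_, ?_, ?_⟩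
    (by norm_num) (by simp) ?_ (L := [8, 8, 2, 2, 2, 2])
    (show [8, 8, 2, 2, 2, 2].Perm [2, 8, 8, 2, 2, 2] by decide)
  · have d₁ : 1 ≠ s := by
      rintro rfl
      norm_num at hs
    have d₂ : 1 ≠ -s := fun h ↦ two_ne_zero (α := F) (by linear_combination (1 - s) * h + hs)
    have d₃ : -1 ≠ s := by
      rintro rfl
      norm_num at hs
    have d₄ : s ≠ -s := fun h ↦ hs0 (by linear_combination h / 2)
    simp only [List.map_cons, List.map_nil, List.nodup_cons, List.mem_cons, List.not_mem_nil,
      or_false, not_or, List.nodup_nil, not_false_eq_true, and_true]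
    refine ⟨⟨?_, one_ne_zero, d₁, d₂⟩, ⟨?_, d₃, fun h ↦ d₁ (neg_injective h)⟩,
      ⟨hs0.symm, fun h ↦ hs0 (neg_eq_zero.1 h.symm)⟩, d₄⟩ <;> norm_num
  · simp
  · intro x
    have e : (x - s) ^ 2 * (x - -s) ^ 2 = (x ^ 2 + 1) ^ 2 := by
      rw [← mul_pow]
      congr 1
      linear_combination -hs
    simp only [List.map_cons, List.map_nil, List.prod_cons, List.prod_nil, mul_one, e]
    simp [WeierstrassCurve.Δ, b₂, b₄, b₆, b₈]
    ring
  · simp only [List.forall_mem_cons, c₄, b₂, b₄, map_a₁, map_a₂, map_a₃, map_a₄, coe_evalRingHom]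
    have h4 : s ^ 4 = 1 := by linear_combination (s ^ 2 - 1) * hs
    have h6 : s ^ 6 = -1 := by linear_combination (s ^ 4 - s ^ 2 + 1) * hs
    have h8 : s ^ 8 = 1 := by linear_combination (s ^ 6 - s ^ 4 + s ^ 2 - 1) * hs
    refine ⟨?_, ?_, ?_, ?_, ?_, by simp⟩
    · norm_num
    · norm_num
    · norm_num
    · norm_num [hs, h4, h6, h8]
    · norm_num [hs, h4, h6, h8, even_two, Even.neg_pow]
  · dsimp only; compute_degree!
  · dsimp only; compute_degree!
  · dsimp only; compute_degree!
  · dsimp only; compute_degree!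
  · dsimp only; compute_degree!
  · simp only [c₄, b₂, b₄]
    have h0 : (C (1 / 2) * X ^ 4 + 3 * X ^ 2 + C (1 / 2) : F[X]).coeff (2 * 2) = 1 / 2 := by
      compute_degree!
    have h1 : (C (1 / 16) * (X ^ 8 - 4 * X ^ 6 + 6 * X ^ 4 - 4 * X ^ 2 + 1) : F[X]).coeff (4 * 2) =
        1 / 16 := by
      compute_degree!
    simp only [h0, h1, coeff_zero]
    norm_num

lemma singularFibres_E8412 : SingularFibres (E8412 (RatFunc.X : RatFunc F))
    {.I 8, .I 4, .I 4, .I 4, .I 2, .I 2} := by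
  obtain ⟨s, hs⟩ := IsAlgClosed.exists_pow_nat_eq (2 : F) two_pos
  have h : (1 : VariableChange (RatFunc F)) • E8412 (RatFunc.X : RatFunc F) =
      (⟨0, -16 * X ^ 4 + 32 * X ^ 3 - 32 * X ^ 2 + 16 * X - 2, 0,
        128 * X ^ 6 - 384 * X ^ 5 + 464 * X ^ 4 - 288 * X ^ 3 + 96 * X ^ 2 - 16 * X + 1, 0⟩ :
        WeierstrassCurve F[X]).map
        (algebraMap F[X] (RatFunc F)) := by
    rw [one_smul]
    ext <;> simp [E8412, twoTorsionForm, map_ofNat] <;> ring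
  -- The constant is `2²⁶`, and `(2 ± s)/4` are the roots of `8k² - 8k + 1`; the degree is 20,
  -- leaving `I 4` at infinity.
  refine singularFibres_of_semistable_model h (e := 67108864) (by norm_num)
    (l := [(1 / 2, 8), (0, 4), (1, 4), ((2 + s) / 4, 2), ((2 - s) / 4, 2)])
    ?_ ?_ ?_ ?_ (d := 2) (n := 4) ⟨?_, ?_, ?_, ?_, ?_⟩
    (by norm_num) (by simp) ?_ (L := [8, 4, 4, 4, 2, 2])
    (show [8, 4, 4, 4, 2, 2].Perm [4, 8, 4, 4, 2, 2] by decide)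
  · obtain ⟨d₁, d₂, d₃, d₄, d₅, d₆, d₇⟩ := roots_ne_of_sq_eq_two hs
    simp only [List.map_cons, List.map_nil, List.nodup_cons, List.mem_cons, List.not_mem_nil,
      or_false, not_or, List.nodup_nil, not_false_eq_true, and_true]
    refine ⟨⟨?_, ?_, d₅, d₆⟩, ⟨zero_ne_one, d₁, d₂⟩, ⟨d₃, d₄⟩, d₇⟩ <;> norm_num
  · simp
  · intro x
    have e : (x - (2 + s) / 4) ^ 2 * (x - (2 - s) / 4) ^ 2 = (x ^ 2 - x + 1 / 8) ^ 2 := by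
      rw [← mul_pow]
      congr 1
      linear_combination -hs / 16
    simp only [List.map_cons, List.map_nil, List.prod_cons, List.prod_nil, mul_one, e]
    simp [WeierstrassCurve.Δ, b₂, b₄, b₆, b₈]
    ring
  · simp only [List.forall_mem_cons, c₄, b₂, b₄, map_a₁, map_a₂, map_a₃, map_a₄, coe_evalRingHom]
    refine ⟨?_, ?_, ?_, ?_, ?_, by simp⟩
    · norm_num
    · norm_num
    · norm_num
    · intro h
      simp at h
      grind
    · intro h
      simp at h
      grind
  · dsimp only; compute_degree!
  · dsimp only; compute_degree!
  · dsimp only; compute_degree!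
  · dsimp only; compute_degree!
  · dsimp only; compute_degree!
  · simp only [c₄, b₂, b₄]
    have h0 : (-16 * X ^ 4 + 32 * X ^ 3 - 32 * X ^ 2 + 16 * X - 2 : F[X]).coeff (2 * 2) = -16 := by
      compute_degree!
    have h1 : (128 * X ^ 6 - 384 * X ^ 5 + 464 * X ^ 4 - 288 * X ^ 3 + 96 * X ^ 2 - 16 * X + 1 :
        F[X]).coeff (4 * 2) = 0 := by
      compute_degree!
    simp only [h0, h1, coeff_zero]
    norm_num

end Surfaces

end TateModular

theorem mainTheorem7
    (K : Type*) [Field K] (F : Type*) [Field F] [IsAlgClosed F] [CharZero F] :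
    -- Tate's normal form
    TateModular.HasTateNormalForms K ∧
    -- universal elliptic curves with a point of order 4, 6, 8, 7
    ((4 : K) ≠ 0 →
      TateModular.IsUniversalGamma1 4 TateModular.E14 {t : K | (TateModular.E14 t).Δ ≠ 0}) ∧
    ((6 : K) ≠ 0 →
      TateModular.IsUniversalGamma1 6 TateModular.E16 {a : K | (TateModular.E16 a).Δ ≠ 0}) ∧
    ((8 : K) ≠ 0 →
      TateModular.IsUniversalGamma1 8 TateModular.E18
        {k : K | k ≠ 0 ∧ (TateModular.E18 k).Δ ≠ 0}) ∧
    ((7 : K) ≠ 0 →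
      TateModular.IsUniversalGamma1 7 TateModular.E17 {t : K | (TateModular.E17 t).Δ ≠ 0}) ∧
    -- the other universal elliptic curves with level structure
    (CharZero K →
      TateModular.IsUniversal (TateModular.level62 K) TateModular.E62
        {ξ : K | ξ ^ 2 ≠ 9 ∧ (TateModular.E62 ξ).Δ ≠ 0} TateModular.mark62 ∧
      TateModular.IsUniversal (TateModular.level4 K) TateModular.E4
        {σ : K | σ ≠ 0 ∧ (TateModular.E4 σ).Δ ≠ 0} TateModular.mark4 ∧
      TateModular.IsUniversal (TateModular.level82 K) TateModular.E82
        {σ : K | σ ≠ 0 ∧ (TateModular.E82 σ).Δ ≠ 0} TateModular.mark82 ∧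
      TateModular.IsUniversal (TateModular.level8412 K) TateModular.E8412
        {k : K | (TateModular.E8412 k).Δ ≠ 0} TateModular.mark8412) ∧
    -- the last two families are quotients by a section of order two
    (CharZero K →
      (∀ σ : K, σ ≠ 0 → (TateModular.E82 σ).Δ ≠ 0 →
        ∃ h, TateModular.IsQuotientByTwoTorsion (TateModular.E4 σ) (TateModular.E82 σ)
          (.some 0 0 h)) ∧
      (∀ k : K, (TateModular.E8412 k).Δ ≠ 0 →
        ∃ h, TateModular.IsQuotientByTwoTorsion (TateModular.E18 k) (TateModular.E8412 k)
          (TateModular.mulPoint 4 (.some 0 0 h)))) ∧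
    -- the singular fibres
    TateModular.SingularFibres (TateModular.E14 (RatFunc.X : RatFunc F))
      {.Istar 1, .I 4, .I 1} ∧
    TateModular.SingularFibres (TateModular.E16 (RatFunc.X : RatFunc F))
      {.I 6, .I 3, .I 2, .I 1} ∧
    TateModular.SingularFibres (TateModular.E18 (RatFunc.X : RatFunc F))
      {.I 8, .I 8, .I 4, .I 2, .I 1, .I 1} ∧
    TateModular.SingularFibres (TateModular.E17 (RatFunc.X : RatFunc F))
      {.I 7, .I 7, .I 7, .I 1, .I 1, .I 1} ∧
    TateModular.SingularFibres (TateModular.E62 (RatFunc.X : RatFunc F))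
      {.I 6, .I 6, .I 6, .I 2, .I 2, .I 2} ∧
    TateModular.SingularFibres (TateModular.E82 (RatFunc.X : RatFunc F))
      {.I 8, .I 8, .I 2, .I 2, .I 2, .I 2} ∧
    TateModular.SingularFibres (TateModular.E8412 (RatFunc.X : RatFunc F))
      {.I 8, .I 4, .I 4, .I 4, .I 2, .I 2} := by
  refine ⟨TateModular.hasTateNormalForms K, fun _ ↦ TateModular.isUniversalGamma1_four K,
    fun _ ↦ TateModular.isUniversalGamma1_six K, fun _ ↦ TateModular.isUniversalGamma1_eight K,
    fun _ ↦ TateModular.isUniversalGamma1_seven K,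
    fun _ ↦ ⟨TateModular.isUniversal_level62 K, TateModular.isUniversal_level4 K,
      TateModular.isUniversal_level82 K, TateModular.isUniversal_level8412 K⟩,
    fun _ ↦ ⟨fun _ hσ h ↦ TateModular.E82_isQuotient hσ h,
      fun _ h ↦ TateModular.E8412_isQuotient h⟩,
    TateModular.singularFibres_E14, TateModular.singularFibres_E16,
    TateModular.singularFibres_E18, TateModular.singularFibres_E17,
    TateModular.singularFibres_E62, TateModular.singularFibres_E82,
    TateModular.singularFibres_E8412⟩
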